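/- **Setting.** Let $d\ge 1$ and $1\le q<\infty$. Let $\omega:[0,\infty)\to[0,\infty)$ be a modulus of continuity (nondecreasing, subadditive, $\omega(0)=0$) with the Dini condition $$\int_0^1\omega(t)\,\frac{dt}{t}<\infty .$$ Let $T$ be an $\omega$-Calderón–Zygmund operator on $\mathbb R^d$ with kernel $K$ and constant $A$, i.e. $T$ is a bounded linear operator on $L^2(\mathbb R^d)$ with $Tf(x)=\int K(x,y)f(y)\,dy$ for a.e. $x\notin\operatorname{supp} f$ whenever $f\in L^2$ has compact support, where $|K(x,y)|\le A|x-y|^{-d}$ for $x\neq y$ and $$|K(x,y)-K(x',y)|+|K(y,x)-K(y,x')|\le A\,\omega\Big(\frac{|x-x'|}{|x-y|}\Big)\frac1{|x-y|^d}\qquad\text{for } |x-y|>2|x-x'|>0 .$$ Let $\phi\in C^\infty(\mathbb R^d)$ satisfy $1_{B(0,1)^c}\le\phi\le 1_{B(0,1/2)^c}$, and put $T^\phi_\epsilon f(x)=\int\phi\big(\tfrac{x-y}{\epsilon}\big)K(x,y)f(y)\,dy$ for $\epsilon>0$ and $$V_q^\phi Tf(x)=\sup\Big(\sum_{i\in\mathbb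 Z}|T^\phi_{\epsilon_i}f(x)-T^\phi_{\epsilon_{i+1}}f(x)|^q\Big)^{1/q},$$ the supremum being over all increasing sequences $(\epsilon_i)_{i\in\mathbb Z}$ of positive numbers. Let $Mf(x)$ be the supremum of the averages $|Q|^{-1}\int_Q|f|$ over all cubes $Q\ni x$ with sides parallel to the axes. For $u\in\{0,\frac13,\frac23\}^d$ let $$\mathscr D^u=\{2^{-j}([0,1)^d+m+(-1)^ju): j\in\mathbb Z,\ m\in\mathbb Z^d\},$$ and for $R\in\mathscr D^u$ let $R^{(k)}$ be the cube of $\mathscr D^u$ that contains $R$ and has side length $2^k\ell(R)$. A positive dyadic shift of complexity $k$ with respect to $\mathscr D^u$, with bounds $B=(B_p)_{1<p<\infty}$, is an operator on nonnegative functions of the form $$Sg=\sum_{R\in\mathscr L}1_R\,\frac{1}{|R^{(k)}|}\int_{R^{(k)}}g,\qquad \mathscr L\subseteq\mathscr D^u,$$ such that $\|Sg\|_{L^p}\le B_p\|g\|_{L^p}$ for all $p\in(1,\infty)$ and all measurable $g\ge0$. **Theorem.** Suppose that the smooth $q$-variation of $T$ satisfies the weak $(1,1)$ estimate $\|V_q^\phi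 Tf\|_{L^{1,\infty}}\le W\|f\|_{L^1}$ for all $f\in L^1(\mathbb R^d)$. Let $f\in L^1(\mathbb R^d)$ and let $Q_0$ be a cube that contains the support of $f$. Then, for all $u\in\{0,\frac13,\frac23\}^d$ and $k\in\{0,1,2,\dots\}$, there are positive dyadic shifts $S^u_k$ of complexity $k$ with respect to $\mathscr D^u$, depending on $f$ and $Q_0$, with bounds $B_p$ that depend only on $d$ and $p$, such that pointwise on $\mathbb R^d$ $$1_{Q_0}V_q^\phi Tf\le C\Big(Mf+\sum_{u\in\{0,\frac13,\frac23\}^d}\sum_{k=0}^\infty\omega(2^{-k})\,S^u_k|f|\Big),$$ where the constant $C$ depends only on $d,q,\phi,\omega,A,W$. -/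

import Mathlib

open MeasureTheory
open scoped NNReal ENNReal

noncomputable section

/-- A modulus of continuity: a nondecreasing subadditive function on `[0, ∞)` vanishing at `0`
(its values at negative arguments are irrelevant). -/
structure IsModulusOfContinuity (ω : ℝ → ℝ) : Prop where
  zero : ω 0 = 0
  mono : MonotoneOn ω (Set.Ici 0)
  subadd : ∀ s t : ℝ, 0 ≤ s → 0 ≤ t → ω (s + t) ≤ ω s + ω t

/-- The Dini condition `∫₀¹ ω(t) dt/t < ∞`. -/
def DiniCondition (ω : ℝ → ℝ) : Prop :=
  IntegrableOn (fun t : ℝ => ω t / t) (Set.Ioo 0 1) volume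

/-- `K` is an `ω`-Calderón–Zygmund kernel with constant `A`. The values of `K` on the diagonal
are irrelevant. -/
structure IsCZKernel {d : ℕ} (ω : ℝ → ℝ) (A : ℝ)
    (K : EuclideanSpace ℝ (Fin d) → EuclideanSpace ℝ (Fin d) → ℂ) : Prop where
  size : ∀ x y, x ≠ y → ‖K x y‖ ≤ A / ‖x - y‖ ^ d
  regularity : ∀ x x' y, 0 < ‖x - x'‖ → 2 * ‖x - x'‖ < ‖x - y‖ →
    ‖K x y - K x' y‖ + ‖K y x - K y x'‖ ≤ A * ω (‖x - x'‖ / ‖x - y‖) / ‖x - y‖ ^ d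

/-- The bounded linear operator `T` on `L²` is an `ω`-Calderón–Zygmund operator with kernel `K`:
`Tf(x) = ∫ K(x,y) f(y) dy` for almost every `x` outside the (compact) support of `f`. -/
structure IsCZOperator {d : ℕ} (ω : ℝ → ℝ) (A : ℝ)
    (K : EuclideanSpace ℝ (Fin d) → EuclideanSpace ℝ (Fin d) → ℂ)
    (T : Lp ℂ 2 (volume : Measure (EuclideanSpace ℝ (Fin d))) →L[ℂ]
      Lp ℂ 2 (volume : Measure (EuclideanSpace ℝ (Fin d)))) : Prop where
  kernel : IsCZKernel ω A K
  representation : ∀ (f : EuclideanSpace ℝ (Fin d) → ℂ) (hf : MemLp f 2 volume),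
    HasCompactSupport f → ∀ᵐ x ∂(volume : Measure (EuclideanSpace ℝ (Fin d))),
      x ∉ tsupport f → T (hf.toLp f) x = ∫ y, K x y * f y

/-- A smooth cut-off `φ` with `1_{B(0,1)ᶜ} ≤ φ ≤ 1_{B(0,1/2)ᶜ}`. -/
structure IsSmoothCutoff {d : ℕ} (φ : EuclideanSpace ℝ (Fin d) → ℝ) : Prop where
  smooth : ContDiff ℝ ((⊤ : ℕ∞) : WithTop ℕ∞) φ
  lower : (Metric.ball (0 : EuclideanSpace ℝ (Fin d)) 1)ᶜ.indicator 1 ≤ φ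
  upper : φ ≤ (Metric.ball (0 : EuclideanSpace ℝ (Fin d)) (1 / 2))ᶜ.indicator 1

/-- The smooth truncation `T_ε^φ f(x) = ∫ φ((x - y)/ε) K(x,y) f(y) dy`. -/
def smoothTruncation {d : ℕ} (φ : EuclideanSpace ℝ (Fin d) → ℝ)
    (K : EuclideanSpace ℝ (Fin d) → EuclideanSpace ℝ (Fin d) → ℂ) (ε : ℝ)
    (f : EuclideanSpace ℝ (Fin d) → ℂ) (x : EuclideanSpace ℝ (Fin d)) : ℂ :=
  ∫ y, (φ (ε⁻¹ • (x - y)) : ℂ) * K x y * f y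

/-- The `q`-variation norm of a family `(y_ε)_{ε > 0}`: the supremum, over nondecreasing two-sided
sequences of positive numbers, of the `ℓ^q` norm of the increments. (Strictly increasing sequences
give the same supremum.) -/
def variationNorm (q : ℝ) (y : ℝ → ℂ) : ℝ≥0∞ :=
  ⨆ (ε : ℤ → ℝ) (_ : Monotone ε) (_ : ∀ i, 0 < ε i),
    (∑' i : ℤ, ‖y (ε i) - y (ε (i + 1))‖ₑ ^ q) ^ (1 / q)

/-- The smooth `q`-variation operator `V_q^φ T`. -/
def smoothVariation {d : ℕ} (q : ℝ) (φ : EuclideanSpace ℝ (Fin d) → ℝ)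
    (K : EuclideanSpace ℝ (Fin d) → EuclideanSpace ℝ (Fin d) → ℂ)
    (f : EuclideanSpace ℝ (Fin d) → ℂ) (x : EuclideanSpace ℝ (Fin d)) : ℝ≥0∞ :=
  variationNorm q (fun ε => smoothTruncation φ K ε f x)

/-- The weak `(1,1)` estimate `‖V f‖_{L^{1,∞}} ≤ W ‖f‖_{L¹}` for all `f ∈ L¹`. -/
def WeakOneOne {d : ℕ} (W : ℝ≥0)
    (V : (EuclideanSpace ℝ (Fin d) → ℂ) → EuclideanSpace ℝ (Fin d) → ℝ≥0∞) : Prop :=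
  ∀ f : EuclideanSpace ℝ (Fin d) → ℂ, Integrable f volume → ∀ t : ℝ≥0,
    (t : ℝ≥0∞) * volume {x | (t : ℝ≥0∞) < V f x} ≤ W * ∫⁻ y, ‖f y‖ₑ

/-- The closed axis-parallel cube with lower corner `a` and side length `ℓ`. -/
def closedCube {d : ℕ} (a : EuclideanSpace ℝ (Fin d)) (ℓ : ℝ) : Set (EuclideanSpace ℝ (Fin d)) :=
  {x | ∀ i, a i ≤ x i ∧ x i ≤ a i + ℓ}

/-- The Hardy–Littlewood maximal function over all cubes containing the point. -/
def cubeMaximal {d : ℕ} (f : EuclideanSpace ℝ (Fin d) → ℂ) (x : EuclideanSpace ℝ (Fin d)) :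
    ℝ≥0∞ :=
  ⨆ (a : EuclideanSpace ℝ (Fin d)) (ℓ : ℝ) (_ : 0 < ℓ) (_ : x ∈ closedCube a ℓ),
    ⨍⁻ y in closedCube a ℓ, ‖f y‖ₑ ∂volume

/-- The cube `2^{-j} ([0,1)^d + m + (-1)^j u)` of the dyadic system `𝒟^u`. -/
def dyadicCube {d : ℕ} (u : Fin d → ℝ) (j : ℤ) (m : Fin d → ℤ) :
    Set (EuclideanSpace ℝ (Fin d)) :=
  {x | ∀ i, (2 : ℝ) ^ (-j) * (m i + (-1) ^ j * u i) ≤ x i ∧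
    x i < (2 : ℝ) ^ (-j) * (1 + m i + (-1) ^ j * u i)}

/-- The `k`-th ancestor `R^{(k)}` of `R = 2^{-j} ([0,1)^d + m + (-1)^j u)`: the cube of `𝒟^u` with
side length `2^k · 2^{-j}` that contains `R`. It exists and is unique if `3 u` has integer
coordinates; being the only such cube, it is the union of them. -/
def dyadicAncestor {d : ℕ} (u : Fin d → ℝ) (k : ℕ) (j : ℤ) (m : Fin d → ℤ) :
    Set (EuclideanSpace ℝ (Fin d)) :=
  ⋃ (m' : Fin d → ℤ) (_ : dyadicCube u j m ⊆ dyadicCube u (j - k) m'), dyadicCube u (j - k) m'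

/-- `S` is a positive dyadic shift of complexity `k` in the system `𝒟^u`, with bounds `B`:
`S g = ∑_{R ∈ 𝓛} 1_R ⨍_{R^{(k)}} g` for some collection `𝓛 ⊆ 𝒟^u` (whose members are given by their
parameters `(j, m)`), and `‖S g‖_p ≤ B(p) ‖g‖_p` for all `p ∈ (1, ∞)`. -/
def IsPositiveDyadicShift {d : ℕ} (u : Fin d → ℝ) (k : ℕ) (B : ℝ → ℝ≥0)
    (S : (EuclideanSpace ℝ (Fin d) → ℝ≥0∞) → EuclideanSpace ℝ (Fin d) → ℝ≥0∞) : Prop :=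
  (∃ L : Set (ℤ × (Fin d → ℤ)), ∀ (g : EuclideanSpace ℝ (Fin d) → ℝ≥0∞) (x),
    S g x = ∑' R : L, (dyadicCube u R.1.1 R.1.2).indicator
      (fun _ => ⨍⁻ y in dyadicAncestor u k R.1.1 R.1.2, g y ∂volume) x) ∧
  ∀ p : ℝ, 1 < p → ∀ g : EuclideanSpace ℝ (Fin d) → ℝ≥0∞, Measurable g →
    (∫⁻ x, S g x ^ p) ^ (1 / p) ≤ B p * (∫⁻ x, g x ^ p) ^ (1 / p)

end

/-! The variation is dominated pointwise by a sparse operator, and a sparse operator is already a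
sum of shifts of complexity `0`. The term `k = 0` carries the weight `ω 1`, so if `ω 1 > 0` this
single term suffices, at the price of a factor `1 / ω 1` in `C`; the maximal function and the terms
with `k ≥ 1` are nonnegative and are discarded. If `ω 1 = 0`, regularity and decay force the kernel
to vanish off the diagonal, and the left side is zero (`smoothVariation_eq_zero`).

The sparse family is built by stopping times. Fix a dyadic system and a cube `R₀` of it containing
`Q₀`. For a cube `R` let `f_R` be the restriction of `f` to a large concentric-scale ball around
`R`, and `a_R` its integral over that ball divided by `|R|`. The exceptional set `E(R)` is where the
variation of `f_R`, or its dyadic maximal function in one of the `3 ^ d` systems, exceeds a large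
multiple of `a_R`. The weak `(1,1)` bounds give `|E(R)| ≤ 2 ^ (-d-2) |R|`
(`volume_exceptionalSet_le`). The stopping children of `R` are the maximal proper subcubes `P` with
`|P ∩ E(R)| > 2 ^ (-d-1) |P|`. They fill at most half of `R`, whence sparseness
(`isSparse_stoppingCubes`). By maximality `E(R)` fills at most half of each child `P`, and `E(P)` at
most a quarter, so `P` has a point `x'` outside both (`exists_good_point`).

For `x` in `P` write `f_R = f_P + (f_R - f_P)`. The second function vanishes near `P`, so by kernel
regularity and the Dini condition its variation at `x` differs from that at `x'` by at most a
multiple of `a_R`; at `x'` everything is bounded by `a_R`. Hence the variation of `f_R` at `x` is at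
most that of `f_P` plus `C a_R` (`variationAlong_localized_le_child`). Along a sequence `ε` bounded
away from zero the truncations of `f_R` vanish once `R` is small, so the iteration stops after
finitely many steps and yields `C ∑ a_R` over the stopping cubes containing `x`, at every point and
not just almost everywhere.

Finally each ball lies in a comparable host cube of one of the `3 ^ d` systems. The host cubes are
again sparse, and shifts over sparse collections are bounded on `L^p` uniformly in the complexity,
by duality and the dyadic maximal theorem (`IsThirds.dyadicShift_Lp_le`). -/

noncomputable section

/-! ### Dyadic systems: nesting, volumes, and the one-third trick. -/

/-- The index of the cube of the `j`-th generation of `𝒟^u` that contains `x`. -/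
def dyadicIndex {d : ℕ} (u : Fin d → ℝ) (j : ℤ) (x : EuclideanSpace ℝ (Fin d)) : Fin d → ℤ :=
  fun i => ⌊(2 : ℝ) ^ j * x i - (-1) ^ j * u i⌋

theorem mem_dyadicCube_iff {d : ℕ} {u : Fin d → ℝ} {j : ℤ} {m : Fin d → ℤ}
    {x : EuclideanSpace ℝ (Fin d)} : x ∈ dyadicCube u j m ↔ dyadicIndex u j x = m := by
  have h2 : (0 : ℝ) < 2 ^ j := by positivity
  rw [funext_iff]
  refine forall_congr' fun i => ?_
  rw [dyadicIndex, Int.floor_eq_iff, zpow_neg, inv_mul_le_iff₀ h2, lt_inv_mul_iff₀ h2]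
  constructor <;> rintro ⟨h, h'⟩ <;> constructor <;> linarith

theorem mem_dyadicCube_dyadicIndex {d : ℕ} (u : Fin d → ℝ) (j : ℤ)
    (x : EuclideanSpace ℝ (Fin d)) : x ∈ dyadicCube u j (dyadicIndex u j x) :=
  mem_dyadicCube_iff.2 rfl

/-- The translation parameters for which the generations of cubes are nested. -/
def IsThirds {d : ℕ} (u : Fin d → ℝ) : Prop := ∀ i, ∃ n : ℤ, 3 * u i = n

theorem isThirds_div_three {d : ℕ} (u : Fin d → Fin 3) :
    IsThirds (fun i => ((u i : ℕ) : ℝ) / 3) := fun i => ⟨(u i : ℕ), by push_cast; ring⟩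

theorem neg_one_zpow_eq_intCast (j : ℤ) : ∃ s : ℤ, ((-1 : ℝ)) ^ j = s := by
  rcases Int.even_or_odd j with h | h
  · exact ⟨1, by simp [h.neg_one_zpow]⟩
  · exact ⟨-1, by simp [h.neg_one_zpow]⟩

/-- Since `(-1) ^ (j - 1) = -(-1) ^ j`, passing to the parent generation turns the number under the
floor into half of itself plus `3 (-1) ^ j u i / 2`. As `3 u i` is an integer, the parent index is a
function of the index alone. -/
theorem IsThirds.dyadicIndex_sub_one {d : ℕ} {u : Fin d → ℝ} (hu : IsThirds u) (j : ℤ)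
    {x y : EuclideanSpace ℝ (Fin d)} (h : dyadicIndex u j x = dyadicIndex u j y) :
    dyadicIndex u (j - 1) x = dyadicIndex u (j - 1) y := by
  have key : ∀ i, ∃ s : ℤ, ∀ z : EuclideanSpace ℝ (Fin d),
      dyadicIndex u (j - 1) z i = (dyadicIndex u j z i + s) / 2 := by
    intro i
    obtain ⟨n, hn⟩ := hu i
    obtain ⟨s, hs⟩ := neg_one_zpow_eq_intCast j
    refine ⟨s * n, fun z => ?_⟩
    have : (2 : ℝ) ^ (j - 1) * z i - (-1) ^ (j - 1) * u i
        = ((2 : ℝ) ^ j * z i - (-1) ^ j * u i + (s * n : ℤ)) / (2 : ℕ) := by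
      rw [zpow_sub_one₀ two_ne_zero, zpow_sub_one₀ (by norm_num)]
      push_cast
      rw [← hs, ← hn]
      ring
    rw [dyadicIndex, this, Int.floor_div_natCast, Int.floor_add_intCast]
    rfl
  funext i
  obtain ⟨s, hs⟩ := key i
  rw [hs, hs, h]

theorem IsThirds.dyadicIndex_eq_of_le {d : ℕ} {u : Fin d → ℝ} (hu : IsThirds u) {j j' : ℤ}
    (hj : j' ≤ j) {x y : EuclideanSpace ℝ (Fin d)} (h : dyadicIndex u j x = dyadicIndex u j y) :
    dyadicIndex u j' x = dyadicIndex u j' y := by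
  induction j', hj using Int.leInductionDown with
  | base => exact h
  | pred n _ ih => exact hu.dyadicIndex_sub_one n ih

theorem exists_mem_dyadicCube {d : ℕ} (u : Fin d → ℝ) (j : ℤ) (m : Fin d → ℤ) :
    ∃ x, x ∈ dyadicCube u j m := by
  refine ⟨WithLp.toLp 2 fun i => (2 : ℝ) ^ (-j) * (m i + (-1) ^ j * u i), fun i => ?_⟩
  have h2 : (0 : ℝ) < 2 ^ (-j) := by positivity
  refine ⟨le_rfl, ?_⟩
  simp only
  gcongr
  linarith

theorem IsThirds.dyadicCube_subset {d : ℕ} {u : Fin d → ℝ} (hu : IsThirds u) {j j' : ℤ}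
    (hj : j' ≤ j) {m : Fin d → ℤ} {x : EuclideanSpace ℝ (Fin d)} (hx : x ∈ dyadicCube u j m) :
    dyadicCube u j m ⊆ dyadicCube u j' (dyadicIndex u j' x) := fun y hy => by
  rw [mem_dyadicCube_iff] at *
  exact hu.dyadicIndex_eq_of_le hj (hy.trans hx.symm)

theorem IsThirds.dyadicAncestor_eq {d : ℕ} {u : Fin d → ℝ} (hu : IsThirds u) (k : ℕ) {j : ℤ}
    {m : Fin d → ℤ} {x : EuclideanSpace ℝ (Fin d)} (hx : x ∈ dyadicCube u j m) :
    dyadicAncestor u k j m = dyadicCube u (j - k) (dyadicIndex u (j - k) x) := by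
  apply Set.Subset.antisymm
  · refine Set.iUnion₂_subset fun m' hm' => ?_
    rw [mem_dyadicCube_iff.1 (hm' hx)]
  · exact Set.subset_iUnion₂_of_subset _ (hu.dyadicCube_subset (by omega) hx) subset_rfl

theorem dyadicCube_eq_preimage {d : ℕ} (u : Fin d → ℝ) (j : ℤ) (m : Fin d → ℤ) :
    dyadicCube u j m = WithLp.ofLp ⁻¹' (Set.univ.pi fun i =>
      Set.Ico ((2 : ℝ) ^ (-j) * (m i + (-1) ^ j * u i))
        ((2 : ℝ) ^ (-j) * (1 + m i + (-1) ^ j * u i))) := by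
  ext x
  simp [dyadicCube, Set.mem_pi]

theorem measurableSet_dyadicCube {d : ℕ} (u : Fin d → ℝ) (j : ℤ) (m : Fin d → ℤ) :
    MeasurableSet (dyadicCube u j m) := by
  rw [dyadicCube_eq_preimage]
  exact (PiLp.volume_preserving_ofLp (Fin d)).measurable
    (MeasurableSet.univ_pi fun i => measurableSet_Ico)

/-- The volume of the cubes of the `j`-th generation. -/
def cubeVolume (d : ℕ) (j : ℤ) : ℝ≥0∞ := ENNReal.ofReal ((2 : ℝ) ^ (-j)) ^ d

theorem volume_dyadicCube {d : ℕ} (u : Fin d → ℝ) (j : ℤ) (m : Fin d → ℤ) :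
    volume (dyadicCube u j m) = cubeVolume d j := by
  rw [dyadicCube_eq_preimage, (PiLp.volume_preserving_ofLp (Fin d)).measure_preimage
    (MeasurableSet.univ_pi fun i => measurableSet_Ico).nullMeasurableSet, volume_pi_pi]
  simp only [Real.volume_Ico]
  rw [cubeVolume, Finset.prod_congr rfl (g := fun _ => ENNReal.ofReal ((2 : ℝ) ^ (-j)))]
  · simp
  · intro i _
    congr 1
    ring

theorem cubeVolume_ne_zero (d : ℕ) (j : ℤ) : cubeVolume d j ≠ 0 := by
  refine pow_ne_zero _ ?_
  rw [Ne, ENNReal.ofReal_eq_zero, not_le]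
  positivity

theorem cubeVolume_ne_top (d : ℕ) (j : ℤ) : cubeVolume d j ≠ ∞ :=
  ENNReal.pow_ne_top ENNReal.ofReal_ne_top

theorem cubeVolume_sub (d : ℕ) (j : ℤ) (k : ℕ) :
    cubeVolume d (j - k) = 2 ^ (k * d) * cubeVolume d j := by
  rw [cubeVolume, cubeVolume, pow_mul, ← mul_pow, neg_sub, sub_eq_add_neg,
    zpow_add₀ two_ne_zero, ENNReal.ofReal_mul (by positivity), zpow_natCast,
    ENNReal.ofReal_pow (by norm_num), ENNReal.ofReal_ofNat]

/-- Every closed ball lies in a comparable cube of one of the `3 ^ d` dyadic systems. -/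
theorem exists_closedBall_subset_dyadicCube {d : ℕ} (c : EuclideanSpace ℝ (Fin d)) {r : ℝ}
    {j : ℤ} (hr : 6 * r < (2 : ℝ) ^ (-j)) :
    ∃ (u : Fin d → Fin 3) (m : Fin d → ℤ),
      Metric.closedBall c r ⊆ dyadicCube (fun i => ((u i : ℕ) : ℝ) / 3) j m := by
  have h2 : (0 : ℝ) < 2 ^ j := by positivity
  have hr' : 6 * (2 ^ j * r) < 1 := by
    rw [zpow_neg] at hr
    calc 6 * (2 ^ j * r) = 2 ^ j * (6 * r) := by ring
      _ < 2 ^ j * (2 ^ j)⁻¹ := by gcongr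
      _ = 1 := mul_inv_cancel₀ h2.ne'
  have key : ∀ i, ∃ (s : Fin 3) (n : ℤ), ∀ y ∈ Metric.closedBall c r,
      ⌊(2 : ℝ) ^ j * y i - (-1) ^ j * (((s : ℕ) : ℝ) / 3)⌋ = n := by
    intro i
    set t : ℝ := 2 ^ j * (c i - r) with ht
    set N : ℤ := ⌊3 * t⌋ with hN
    have h1 : (N : ℝ) ≤ 3 * t := Int.floor_le _
    have h3 : 3 * t < N + 1 := Int.lt_floor_add_one _
    -- The rescaled interval starts at `t` and is shorter than `1/3`. The grid point `n + (-1) ^ j s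
    -- / 3` is taken to be `N / 3`, the last multiple of `1/3` not exceeding `t`; the interval then
    -- ends before `N / 3 + 2 / 3`, inside the unit cell starting at `N / 3`.
    have hs : ∃ (s : Fin 3) (n : ℤ), (3 * n + (-1) ^ j * ((s : ℕ) : ℝ)) = N := by
      rcases Int.even_or_odd j with h | h
      · refine ⟨⟨(N % 3).toNat, by omega⟩, N / 3, ?_⟩
        rw [h.neg_one_zpow]
        have : (((N % 3).toNat : ℕ) : ℝ) = ((N % 3 : ℤ) : ℝ) := by
          exact_mod_cast Int.toNat_of_nonneg (by omega)
        simp only [this]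
        exact_mod_cast (by omega : 3 * (N / 3) + 1 * (N % 3) = N)
      · refine ⟨⟨((-N) % 3).toNat, by omega⟩, -((-N) / 3), ?_⟩
        rw [h.neg_one_zpow]
        have : ((((-N) % 3).toNat : ℕ) : ℝ) = (((-N) % 3 : ℤ) : ℝ) := by
          exact_mod_cast Int.toNat_of_nonneg (by omega)
        simp only [this]
        exact_mod_cast (by omega : 3 * (-((-N) / 3)) + (-1) * ((-N) % 3) = N)
    obtain ⟨s, n, hsn⟩ := hs
    refine ⟨s, n, fun y hy => ?_⟩
    have hy' : |y i - c i| ≤ r := by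
      have := (PiLp.norm_apply_le (y - c) i).trans (mem_closedBall_iff_norm.1 hy)
      simpa using this
    rw [abs_le] at hy'
    have e1 : t ≤ 2 ^ j * y i := by rw [ht]; gcongr; linarith
    have e2 : 2 ^ j * y i ≤ t + 2 * (2 ^ j * r) := by
      have : 2 ^ j * y i ≤ 2 ^ j * (c i + r) := by gcongr; linarith
      rw [ht]; linarith
    rw [Int.floor_eq_iff]
    constructor <;> linarith
  choose s n h using key
  exact ⟨s, n, fun y hy => mem_dyadicCube_iff.2 (funext fun i => h i y hy)⟩

/-! ### Maximal cubes and the dyadic maximal function. -/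

/-- The maximal cubes with the property `p` among those of generation at least `j₀`. -/
def maximalCubes {d : ℕ} (u : Fin d → ℝ) (j₀ : ℤ) (p : ℤ → (Fin d → ℤ) → Prop) :
    Set (ℤ × (Fin d → ℤ)) :=
  {R | j₀ ≤ R.1 ∧ p R.1 R.2 ∧ ∀ x ∈ dyadicCube u R.1 R.2, ∀ j', j₀ ≤ j' → j' < R.1 →
    ¬ p j' (dyadicIndex u j' x)}

theorem maximalCubes_eq_of_mem {d : ℕ} {u : Fin d → ℝ} {j₀ : ℤ} {p : ℤ → (Fin d → ℤ) → Prop}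
    {R R' : ℤ × (Fin d → ℤ)} (hR : R ∈ maximalCubes u j₀ p) (hR' : R' ∈ maximalCubes u j₀ p)
    {x : EuclideanSpace ℝ (Fin d)} (hx : x ∈ dyadicCube u R.1 R.2)
    (hx' : x ∈ dyadicCube u R'.1 R'.2) : R = R' := by
  have e := mem_dyadicCube_iff.1 hx
  have e' := mem_dyadicCube_iff.1 hx'
  rcases lt_trichotomy R.1 R'.1 with h | h | h
  · exact absurd (e ▸ hR.2.1) (hR'.2.2 x hx' _ hR.1 h)
  · refine Prod.ext h ?_
    rw [← e, ← e', h]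
  · exact absurd (e' ▸ hR'.2.1) (hR.2.2 x hx _ hR'.1 h)

/-- The bound `j₀` on the generations guarantees a coarsest cube around `x` with the property;
nesting makes its maximality independent of the chosen point. -/
theorem IsThirds.exists_maximalCubes {d : ℕ} {u : Fin d → ℝ} (hu : IsThirds u) {j₀ : ℤ}
    {p : ℤ → (Fin d → ℤ) → Prop} {x : EuclideanSpace ℝ (Fin d)} {j : ℤ} (hj : j₀ ≤ j)
    (hp : p j (dyadicIndex u j x)) :
    ∃ R ∈ maximalCubes u j₀ p, x ∈ dyadicCube u R.1 R.2 := by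
  classical
  obtain ⟨j', ⟨h1, h2⟩, h3⟩ := Int.exists_least_of_bdd
    (P := fun j => j₀ ≤ j ∧ p j (dyadicIndex u j x)) ⟨j₀, fun z hz => hz.1⟩ ⟨j, hj, hp⟩
  refine ⟨(j', dyadicIndex u j' x), ⟨h1, h2, fun y hy j'' h h' => ?_⟩,
    mem_dyadicCube_dyadicIndex u j' x⟩
  rw [hu.dyadicIndex_eq_of_le h'.le (mem_dyadicCube_iff.1 hy)]
  intro hp'
  exact absurd (h3 j'' ⟨h, hp'⟩) (not_le.2 h')

theorem pairwiseDisjoint_maximalCubes {d : ℕ} (u : Fin d → ℝ) (j₀ : ℤ)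
    (p : ℤ → (Fin d → ℤ) → Prop) :
    (maximalCubes u j₀ p).PairwiseDisjoint fun R => dyadicCube u R.1 R.2 := by
  intro R hR R' hR' hne
  rw [Function.onFun, Set.disjoint_left]
  exact fun x hx hx' => hne (maximalCubes_eq_of_mem hR hR' hx hx')

/-- Maximal cubes are disjoint, so the lower bounds for their `ν`-masses add up without overlap. -/
theorem mul_volume_maximalCubes_le {d : ℕ} {u : Fin d → ℝ} {j₀ : ℤ}
    {p : ℤ → (Fin d → ℤ) → Prop} (ν : Measure (EuclideanSpace ℝ (Fin d))) (c : ℝ≥0∞)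
    (h : ∀ j m, p j m → c * volume (dyadicCube u j m) ≤ ν (dyadicCube u j m)) :
    c * volume (⋃ R ∈ maximalCubes u j₀ p, dyadicCube u R.1 R.2) ≤ ν Set.univ := by
  rw [measure_biUnion (Set.to_countable _) (pairwiseDisjoint_maximalCubes u j₀ p)
    fun R _ => measurableSet_dyadicCube u R.1 R.2, ← ENNReal.tsum_mul_left]
  calc ∑' R : maximalCubes u j₀ p, c * volume (dyadicCube u R.1.1 R.1.2)
      ≤ ∑' R : maximalCubes u j₀ p, ν (dyadicCube u R.1.1 R.1.2) :=
        ENNReal.tsum_le_tsum fun R => h _ _ R.2.2.1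
    _ = ν (⋃ R ∈ maximalCubes u j₀ p, dyadicCube u R.1 R.2) :=
        (measure_biUnion (Set.to_countable _) (pairwiseDisjoint_maximalCubes u j₀ p)
          fun R _ => measurableSet_dyadicCube u R.1 R.2).symm
    _ ≤ ν Set.univ := measure_mono (Set.subset_univ _)

/-- The dyadic maximal function of the system `𝒟^u`. -/
def dyadicMaximal {d : ℕ} (u : Fin d → ℝ) (g : EuclideanSpace ℝ (Fin d) → ℝ≥0∞)
    (x : EuclideanSpace ℝ (Fin d)) : ℝ≥0∞ :=
  ⨆ j : ℤ, ⨍⁻ y in dyadicCube u j (dyadicIndex u j x), g y ∂volume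

theorem laverage_dyadicCube_le_dyadicMaximal {d : ℕ} (u : Fin d → ℝ)
    (g : EuclideanSpace ℝ (Fin d) → ℝ≥0∞) {x : EuclideanSpace ℝ (Fin d)} {j : ℤ}
    {m : Fin d → ℤ} (hx : x ∈ dyadicCube u j m) :
    ⨍⁻ y in dyadicCube u j m, g y ∂volume ≤ dyadicMaximal u g x := by
  rw [← mem_dyadicCube_iff.1 hx]
  exact le_iSup (fun j => ⨍⁻ y in dyadicCube u j (dyadicIndex u j x), g y ∂volume) j

theorem setLIntegral_dyadicCube_le_dyadicMaximal {d : ℕ} (u : Fin d → ℝ)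
    (g : EuclideanSpace ℝ (Fin d) → ℝ≥0∞) {x : EuclideanSpace ℝ (Fin d)} {j : ℤ}
    {m : Fin d → ℤ} (hx : x ∈ dyadicCube u j m) :
    ∫⁻ y in dyadicCube u j m, g y ≤ cubeVolume d j * dyadicMaximal u g x := by
  refine le_trans (le_of_eq ?_)
    (mul_le_mul_right (laverage_dyadicCube_le_dyadicMaximal u g hx) (cubeVolume d j))
  rw [setLAverage_eq, volume_dyadicCube, ENNReal.mul_div_cancel (cubeVolume_ne_zero d j)
    (cubeVolume_ne_top d j)]

theorem measurable_dyadicIndex {d : ℕ} (u : Fin d → ℝ) (j : ℤ) :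
    Measurable (dyadicIndex u j) := by
  refine measurable_pi_lambda _ fun i => Int.measurable_floor.comp ?_
  fun_prop

theorem measurable_dyadicMaximal {d : ℕ} (u : Fin d → ℝ)
    (g : EuclideanSpace ℝ (Fin d) → ℝ≥0∞) : Measurable (dyadicMaximal u g) := by
  refine Measurable.iSup fun j => ?_
  exact (measurable_of_countable fun m => ⨍⁻ y in dyadicCube u j m, g y ∂volume).comp
    (measurable_dyadicIndex u j)

/-- The weak `(1,1)` estimate for the dyadic maximal function. -/
theorem IsThirds.mul_volume_dyadicMaximal_le {d : ℕ} {u : Fin d → ℝ} (hu : IsThirds u)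
    (g : EuclideanSpace ℝ (Fin d) → ℝ≥0∞) (t : ℝ≥0∞) :
    t * volume {x | t < dyadicMaximal u g x} ≤ ∫⁻ y, g y := by
  set p : ℤ → (Fin d → ℤ) → Prop := fun j m => t < ⨍⁻ y in dyadicCube u j m, g y ∂volume with hp
  -- Maximal cubes need not exist among all generations, so the level set is exhausted by the
  -- increasing sets that use only generations from `-N` on.
  have hset : {x | t < dyadicMaximal u g x}
      = ⋃ N : ℕ, {x | ∃ j : ℤ, -(N : ℤ) ≤ j ∧ p j (dyadicIndex u j x)} := by
    ext x
    simp only [dyadicMaximal, Set.mem_ofPred_eq, lt_iSup_iff, Set.mem_iUnion]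
    constructor
    · rintro ⟨j, hj⟩
      exact ⟨j.natAbs, j, by omega, hj⟩
    · rintro ⟨N, j, -, hj⟩
      exact ⟨j, hj⟩
  have hmono : Monotone fun N : ℕ =>
      {x | ∃ j : ℤ, -(N : ℤ) ≤ j ∧ p j (dyadicIndex u j x)} := by
    rintro N N' h x ⟨j, hj, hj'⟩
    exact ⟨j, by omega, hj'⟩
  rw [hset, hmono.measure_iUnion, ENNReal.mul_iSup]
  refine iSup_le fun N => ?_
  have hsub : {x | ∃ j : ℤ, -(N : ℤ) ≤ j ∧ p j (dyadicIndex u j x)}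
      ⊆ ⋃ R ∈ maximalCubes u (-N) p, dyadicCube u R.1 R.2 := by
    rintro x ⟨j, hj, hj'⟩
    obtain ⟨R, hR, hx⟩ := hu.exists_maximalCubes hj hj'
    exact Set.mem_biUnion hR hx
  refine (mul_le_mul_right (measure_mono hsub) t).trans ?_
  refine (mul_volume_maximalCubes_le (volume.withDensity g) t fun j m h => ?_).trans ?_
  · rw [withDensity_apply _ (measurableSet_dyadicCube u j m)]
    refine (mul_le_mul_left h.le _).trans (le_of_eq ?_)
    rw [setLAverage_eq, volume_dyadicCube, ENNReal.div_mul_cancel (cubeVolume_ne_zero d j)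
      (cubeVolume_ne_top d j)]
  · rw [withDensity_apply _ MeasurableSet.univ, Measure.restrict_univ]

/-- The part of `g` not exceeding `t` contributes at most `t` to any average. This sharpens the weak
type estimate to one that involves only the large values of `g`, as interpolation requires. -/
theorem dyadicMaximal_le_add {d : ℕ} (u : Fin d → ℝ)
    (g : EuclideanSpace ℝ (Fin d) → ℝ≥0∞) (t : ℝ≥0∞)
    (x : EuclideanSpace ℝ (Fin d)) :
    dyadicMaximal u g x ≤ dyadicMaximal u ({y | t < g y}.indicator g) x + t := by
  refine iSup_le fun j => ?_
  set Q := dyadicCube u j (dyadicIndex u j x)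
  have hle : ∀ y, g y ≤ {y | t < g y}.indicator g y + t := by
    intro y
    by_cases h : t < g y
    · rw [Set.indicator_of_mem (show y ∈ {y | t < g y} from h)]
      exact le_self_add
    · exact (not_lt.1 h).trans le_add_self
  calc ⨍⁻ y in Q, g y ∂volume
      ≤ ⨍⁻ y in Q, ({y | t < g y}.indicator g y + t) ∂volume := lintegral_mono hle
    _ = (⨍⁻ y in Q, {y | t < g y}.indicator g y ∂volume) + ⨍⁻ _y in Q, t ∂volume := by
        rw [laverage, laverage, laverage, lintegral_add_right _ measurable_const]
    _ ≤ _ := by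
        gcongr
        · exact laverage_dyadicCube_le_dyadicMaximal u _ (mem_dyadicCube_dyadicIndex u j x)
        · rw [setLAverage_const]
          · rw [volume_dyadicCube]; exact cubeVolume_ne_zero d j
          · rw [volume_dyadicCube]; exact cubeVolume_ne_top d j

theorem IsThirds.mul_volume_dyadicMaximal_le_indicator {d : ℕ} {u : Fin d → ℝ}
    (hu : IsThirds u) (g : EuclideanSpace ℝ (Fin d) → ℝ≥0∞) (t : ℝ) :
    ENNReal.ofReal t * volume {x | ENNReal.ofReal t < dyadicMaximal u g x}
      ≤ 2 * ∫⁻ y, {y | ENNReal.ofReal t < 2 * g y}.indicator g y := by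
  set s : ℝ≥0∞ := ENNReal.ofReal (t / 2)
  have hs : ENNReal.ofReal t = 2 * s := by
    rw [← ENNReal.ofReal_ofNat, ← ENNReal.ofReal_mul (by norm_num)]
    congr 1; ring
  have hset : {y | ENNReal.ofReal t < 2 * g y} = {y | s < g y} := by
    ext y
    simp only [Set.mem_ofPred_eq, hs]
    exact ENNReal.mul_lt_mul_iff_right (by norm_num) (by norm_num)
  rw [hset]
  have hsub : {x | ENNReal.ofReal t < dyadicMaximal u g x}
      ⊆ {x | s < dyadicMaximal u ({y | s < g y}.indicator g) x} := by
    intro x hx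
    simp only [Set.mem_ofPred_eq, hs, two_mul] at hx ⊢
    exact lt_of_add_lt_add_right (hx.trans_le (dyadicMaximal_le_add u g s x))
  refine (mul_le_mul_right (measure_mono hsub) _).trans ?_
  rw [hs, mul_assoc]
  exact mul_le_mul_right (hu.mul_volume_dyadicMaximal_le _ s) _

/-! ### From level set estimates to `L^p` bounds. -/

theorem setLIntegral_rpow_sub_two_le {p : ℝ} (hp : 1 < p) (b : ℝ≥0∞) :
    ∫⁻ t in Set.Ioi (0 : ℝ), {t | ENNReal.ofReal t < b}.indicator
      (fun t => ENNReal.ofReal (t ^ (p - 2))) t ≤ ENNReal.ofReal (p - 1)⁻¹ * b ^ (p - 1) := by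
  have hp1 : 0 < p - 1 := by linarith
  rcases eq_or_ne b ∞ with rfl | hb
  · rw [ENNReal.top_rpow_of_pos hp1, ENNReal.mul_top]
    · exact le_top
    · simpa using hp
  have hI : IntegrableOn (fun t : ℝ => t ^ (p - 2)) (Set.Ioc 0 b.toReal) :=
    (intervalIntegrable_iff_integrableOn_Ioc_of_le ENNReal.toReal_nonneg).1
      (intervalIntegral.intervalIntegrable_rpow' (by linarith))
  calc ∫⁻ t in Set.Ioi (0 : ℝ), {t | ENNReal.ofReal t < b}.indicator
        (fun t => ENNReal.ofReal (t ^ (p - 2))) t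
      ≤ ∫⁻ t in Set.Ioi (0 : ℝ), (Set.Ioc 0 b.toReal).indicator
        (fun t => ENNReal.ofReal (t ^ (p - 2))) t := by
        refine setLIntegral_mono' measurableSet_Ioi fun t ht => ?_
        by_cases h : ENNReal.ofReal t < b
        · have : t ∈ Set.Ioc 0 b.toReal := ⟨ht, (ENNReal.ofReal_le_iff_le_toReal hb).1 h.le⟩
          rw [Set.indicator_of_mem this, Set.indicator_of_mem (by exact h)]
        · rw [Set.indicator_of_notMem (by exact h)]
          exact zero_le
    _ ≤ ∫⁻ t in Set.Ioc 0 b.toReal, ENNReal.ofReal (t ^ (p - 2)) := by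
        rw [← lintegral_indicator measurableSet_Ioc]
        exact setLIntegral_le_lintegral _ _
    _ = ENNReal.ofReal (∫ t in Set.Ioc 0 b.toReal, t ^ (p - 2)) := by
        rw [ofReal_integral_eq_lintegral_ofReal hI]
        exact (ae_restrict_iff' measurableSet_Ioc).2
          (Filter.Eventually.of_forall fun t ht => Real.rpow_nonneg ht.1.le _)
    _ = ENNReal.ofReal (p - 1)⁻¹ * b ^ (p - 1) := by
        rw [← intervalIntegral.integral_of_le ENNReal.toReal_nonneg,
          integral_rpow (Or.inl (by linarith)), show p - 2 + 1 = p - 1 by ring,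
          Real.zero_rpow hp1.ne', sub_zero, div_eq_inv_mul,
          ENNReal.ofReal_mul (inv_nonneg.2 hp1.le),
          ← ENNReal.ofReal_rpow_of_nonneg ENNReal.toReal_nonneg hp1.le, ENNReal.ofReal_toReal hb]

/-- A function that is controlled by `g` at every level, as a maximal function is, is controlled
in `L^p`. -/
theorem lintegral_rpow_le_of_level_bound {α : Type*} [MeasurableSpace α] {μ : Measure α}
    [SFinite μ] {g h : α → ℝ≥0∞} (hg : Measurable g) (hh : Measurable h)
    (H : ∀ t : ℝ, 0 < t → ENNReal.ofReal t * μ {x | ENNReal.ofReal t < h x}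
      ≤ 2 * ∫⁻ y, {y | ENNReal.ofReal t < 2 * g y}.indicator g y ∂μ) {p : ℝ} (hp : 1 < p) :
    ∫⁻ x, h x ^ p ∂μ ≤ ENNReal.ofReal (2 ^ p * p * (p - 1)⁻¹) * ∫⁻ x, g x ^ p ∂μ := by
  have hp0 : 0 < p := by linarith
  have hp1 : 0 < p - 1 := by linarith
  -- Truncation at `N` makes the function real-valued, so that the layer cake formula applies;
  -- monotone convergence removes the truncation at the end.
  have htrunc : ∀ N : ℕ, ∫⁻ x, (min (h x) N) ^ p ∂μ
      ≤ ENNReal.ofReal (2 ^ p * p * (p - 1)⁻¹) * ∫⁻ x, g x ^ p ∂μ := by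
    intro N
    have hfin : ∀ x, min (h x) (N : ℝ≥0∞) ≠ ∞ := fun x =>
      ((min_le_right _ _).trans_lt (ENNReal.natCast_lt_top N)).ne
    have hmeas : Measurable fun x => (min (h x) (N : ℝ≥0∞)).toReal :=
      (hh.min measurable_const).ennreal_toReal
    have e1 : ∫⁻ x, (min (h x) N) ^ p ∂μ
        = ∫⁻ x, ENNReal.ofReal ((min (h x) (N : ℝ≥0∞)).toReal ^ p) ∂μ := by
      refine lintegral_congr fun x => ?_
      rw [← ENNReal.ofReal_rpow_of_nonneg ENNReal.toReal_nonneg hp0.le,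
        ENNReal.ofReal_toReal (hfin x)]
    rw [e1, lintegral_rpow_eq_lintegral_meas_lt_mul μ
      (Filter.Eventually.of_forall fun x => ENNReal.toReal_nonneg) hmeas.aemeasurable hp0]
    have e2 : ∀ t ∈ Set.Ioi (0 : ℝ),
        μ {x | t < (min (h x) (N : ℝ≥0∞)).toReal} * ENNReal.ofReal (t ^ (p - 1))
        ≤ ∫⁻ y, 2 * (g y * {t | ENNReal.ofReal t < 2 * g y}.indicator
            (fun t => ENNReal.ofReal (t ^ (p - 2))) t) ∂μ := by
      intro t ht
      have ht0 : (0 : ℝ) < t := ht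
      have hsub : {x | t < (min (h x) (N : ℝ≥0∞)).toReal} ⊆ {x | ENNReal.ofReal t < h x} := by
        intro x hx
        exact ((ENNReal.ofReal_lt_iff_lt_toReal ht0.le (hfin x)).2 hx).trans_le (min_le_left _ _)
      have e3 : ENNReal.ofReal (t ^ (p - 1)) = ENNReal.ofReal t * ENNReal.ofReal (t ^ (p - 2)) := by
        rw [← ENNReal.ofReal_mul ht0.le, show p - 1 = 1 + (p - 2) by ring, Real.rpow_add ht0,
          Real.rpow_one]
      calc μ {x | t < (min (h x) (N : ℝ≥0∞)).toReal} * ENNReal.ofReal (t ^ (p - 1))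
          ≤ μ {x | ENNReal.ofReal t < h x} * ENNReal.ofReal (t ^ (p - 1)) :=
            mul_le_mul_left (measure_mono hsub) _
        _ = (ENNReal.ofReal t * μ {x | ENNReal.ofReal t < h x}) * ENNReal.ofReal (t ^ (p - 2)) := by
            rw [e3]; ring
        _ ≤ (2 * ∫⁻ y, {y | ENNReal.ofReal t < 2 * g y}.indicator g y ∂μ)
              * ENNReal.ofReal (t ^ (p - 2)) := mul_le_mul_left (H t ht0) _
        _ = ∫⁻ y, 2 * (g y * {t | ENNReal.ofReal t < 2 * g y}.indicator
            (fun t => ENNReal.ofReal (t ^ (p - 2))) t) ∂μ := by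
            rw [lintegral_const_mul' _ _ (by norm_num), mul_assoc,
              ← lintegral_mul_const' _ _ ENNReal.ofReal_ne_top]
            congr 1
            refine lintegral_congr fun y => ?_
            by_cases hy : ENNReal.ofReal t < 2 * g y <;> simp [hy]
    refine (mul_le_mul_right (setLIntegral_mono' measurableSet_Ioi e2) _).trans ?_
    -- After Tonelli the inner integral runs over the levels `t < 2 g y`, which is
    -- `setLIntegral_rpow_sub_two_le` with `b = 2 g y`.
    rw [lintegral_lintegral_swap]
    · have e4 : ∀ y, ∫⁻ t in Set.Ioi (0 : ℝ), 2 * (g y * {t | ENNReal.ofReal t < 2 * g y}.indicator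
            (fun t => ENNReal.ofReal (t ^ (p - 2))) t)
          ≤ ENNReal.ofReal (2 ^ p * (p - 1)⁻¹) * g y ^ p := by
        intro y
        rw [lintegral_const_mul' _ _ (by norm_num), lintegral_const_mul]
        · refine (mul_le_mul_right (mul_le_mul_right
            (setLIntegral_rpow_sub_two_le hp (2 * g y)) _) _).trans (le_of_eq ?_)
          rw [ENNReal.mul_rpow_of_nonneg _ _ hp1.le,
            ENNReal.ofReal_mul (by positivity),
            ← ENNReal.ofReal_rpow_of_pos two_pos, ENNReal.ofReal_ofNat]
          have h2 : (2 : ℝ≥0∞) ^ p = 2 * 2 ^ (p - 1) := by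
            conv_lhs => rw [show p = 1 + (p - 1) by ring]
            rw [ENNReal.rpow_add _ _ (by norm_num) (by norm_num), ENNReal.rpow_one]
          have h3 : g y ^ p = g y * g y ^ (p - 1) := by
            conv_lhs => rw [show p = 1 + (p - 1) by ring]
            rw [ENNReal.rpow_add_of_nonneg _ _ zero_le_one hp1.le, ENNReal.rpow_one]
          rw [h2, h3]
          ring
        · refine Measurable.indicator (by fun_prop) ?_
          exact measurableSet_lt (by fun_prop) measurable_const
      refine (mul_le_mul_right (lintegral_mono e4) _).trans (le_of_eq ?_)
      rw [lintegral_const_mul' _ _ ENNReal.ofReal_ne_top, ← mul_assoc,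
        ← ENNReal.ofReal_mul hp0.le]
      congr 2
      ring
    · refine Measurable.aemeasurable ?_
      refine Measurable.const_mul (Measurable.mul (hg.comp measurable_snd) ?_) _
      exact Measurable.indicator (f := fun z : ℝ × α => ENNReal.ofReal (z.1 ^ (p - 2)))
        (s := {z : ℝ × α | ENNReal.ofReal z.1 < 2 * g z.2}) (by fun_prop)
        (measurableSet_lt (by fun_prop) (by fun_prop))
  have hlim : ∫⁻ x, h x ^ p ∂μ = ⨆ N : ℕ, ∫⁻ x, (min (h x) N) ^ p ∂μ := by
    rw [← lintegral_iSup]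
    · refine lintegral_congr fun x => ?_
      apply le_antisymm
      · refine le_of_forall_lt fun a ha => ?_
        rcases eq_or_ne (h x) ∞ with hx | hx
        · simp only [hx, min_eq_right le_top]
          rw [hx, ENNReal.top_rpow_of_pos hp0] at ha
          have ha' : a ^ p⁻¹ < ∞ := ENNReal.rpow_lt_top_of_nonneg (by positivity) ha.ne
          obtain ⟨N, hN⟩ := ENNReal.exists_nat_gt ha'.ne
          refine lt_of_lt_of_le ?_ (le_iSup _ N)
          rwa [ENNReal.rpow_inv_lt_iff hp0] at hN
        · obtain ⟨N, hN⟩ := ENNReal.exists_nat_gt hx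
          refine ha.trans_le (le_iSup_of_le N ?_)
          rw [min_eq_left hN.le]
      · exact iSup_le fun N => ENNReal.rpow_le_rpow (min_le_left _ _) hp0.le
    · exact fun N => (hh.min measurable_const).pow_const p
    · intro N N' hN x
      refine ENNReal.rpow_le_rpow (min_le_min_left _ ?_) hp0.le
      exact_mod_cast hN
  rw [hlim]
  exact iSup_le htrunc

theorem IsThirds.lintegral_dyadicMaximal_rpow_le {d : ℕ} {u : Fin d → ℝ} (hu : IsThirds u)
    {g : EuclideanSpace ℝ (Fin d) → ℝ≥0∞} (hg : Measurable g) {p : ℝ} (hp : 1 < p) :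
    ∫⁻ x, dyadicMaximal u g x ^ p
      ≤ ENNReal.ofReal (2 ^ p * p * (p - 1)⁻¹) * ∫⁻ x, g x ^ p :=
  lintegral_rpow_le_of_level_bound hg (measurable_dyadicMaximal u g)
    (fun t _ => hu.mul_volume_dyadicMaximal_le_indicator g t) hp

/-! ### Dyadic shifts over sparse collections. -/

/-- The positive dyadic shift of complexity `k` associated with the collection `L`. -/
def dyadicShift {d : ℕ} (u : Fin d → ℝ) (k : ℕ) (L : Set (ℤ × (Fin d → ℤ)))
    (g : EuclideanSpace ℝ (Fin d) → ℝ≥0∞) (x : EuclideanSpace ℝ (Fin d)) : ℝ≥0∞ :=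
  ∑' R : L, (dyadicCube u R.1.1 R.1.2).indicator
    (fun _ => ⨍⁻ y in dyadicAncestor u k R.1.1 R.1.2, g y ∂volume) x

/-- A collection of cubes is `Λ`-sparse if its members have disjoint major subsets. -/
def IsSparse {d : ℕ} (u : Fin d → ℝ) (Λ : ℝ≥0∞) (L : Set (ℤ × (Fin d → ℤ))) : Prop :=
  ∃ E : ℤ × (Fin d → ℤ) → Set (EuclideanSpace ℝ (Fin d)),
    (∀ R ∈ L, MeasurableSet (E R) ∧ E R ⊆ dyadicCube u R.1 R.2 ∧
      volume (dyadicCube u R.1 R.2) ≤ Λ * volume (E R)) ∧ L.PairwiseDisjoint E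

/-- The constant of the `L^p` estimate for the dyadic maximal function. -/
def maximalConst (p : ℝ) : ℝ≥0 := Real.toNNReal (2 ^ p * p * (p - 1)⁻¹) ^ (1 / p)

theorem IsThirds.dyadicMaximal_Lp_le {d : ℕ} {u : Fin d → ℝ} (hu : IsThirds u)
    {g : EuclideanSpace ℝ (Fin d) → ℝ≥0∞} (hg : Measurable g) {p : ℝ} (hp : 1 < p) :
    (∫⁻ x, dyadicMaximal u g x ^ p) ^ (1 / p)
      ≤ maximalConst p * (∫⁻ x, g x ^ p) ^ (1 / p) := by
  have hp' : 0 ≤ 1 / p := by positivity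
  refine (ENNReal.rpow_le_rpow (hu.lintegral_dyadicMaximal_rpow_le hg hp) hp').trans (le_of_eq ?_)
  rw [ENNReal.mul_rpow_of_nonneg _ _ hp', maximalConst, ENNReal.coe_rpow_of_nonneg _ hp',
    ENNReal.ofReal]

theorem maximalConst_pos {p : ℝ} (hp : 1 < p) : 0 < maximalConst p := by
  have : 0 < p - 1 := by linarith
  refine NNReal.rpow_pos (Real.toNNReal_pos.2 ?_)
  positivity

theorem IsThirds.laverage_dyadicAncestor_le {d : ℕ} {u : Fin d → ℝ} (hu : IsThirds u) (k : ℕ)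
    (g : EuclideanSpace ℝ (Fin d) → ℝ≥0∞) {j : ℤ} {m : Fin d → ℤ}
    {x : EuclideanSpace ℝ (Fin d)} (hx : x ∈ dyadicCube u j m) :
    ⨍⁻ y in dyadicAncestor u k j m, g y ∂volume ≤ dyadicMaximal u g x := by
  rw [hu.dyadicAncestor_eq k hx]
  exact laverage_dyadicCube_le_dyadicMaximal u g (mem_dyadicCube_dyadicIndex u _ x)

/-- Paired with `h`, each cube `R` contributes its volume times an average of `g` and one of `h`.
The volume is at most `Λ` times that of `E R`, and on `E R` both averages are below the maximal
functions; the sets `E R` are disjoint. The ancestor contains `R`, so the complexity does not affect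
the bound. -/
theorem IsThirds.lintegral_shift_mul_le {d : ℕ} {u : Fin d → ℝ} (hu : IsThirds u) (k : ℕ)
    {Λ : ℝ≥0∞} {L : Set (ℤ × (Fin d → ℤ))} (hL : IsSparse u Λ L) (F : Finset L)
    (g h : EuclideanSpace ℝ (Fin d) → ℝ≥0∞) (hh : Measurable h) :
    ∫⁻ x, (∑ R ∈ F, (dyadicCube u R.1.1 R.1.2).indicator
      (fun _ => ⨍⁻ y in dyadicAncestor u k R.1.1 R.1.2, g y ∂volume) x) * h x
      ≤ Λ * ∫⁻ x, dyadicMaximal u g x * dyadicMaximal u h x := by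
  obtain ⟨E, hE, hdisj⟩ := hL
  simp_rw [Finset.sum_mul]
  rw [lintegral_finsetSum]
  swap
  · intro R _
    exact (measurable_const.indicator (measurableSet_dyadicCube u _ _)).mul hh
  calc ∑ R ∈ F, ∫⁻ x, (dyadicCube u R.1.1 R.1.2).indicator
        (fun _ => ⨍⁻ y in dyadicAncestor u k R.1.1 R.1.2, g y ∂volume) x * h x
      ≤ ∑ R ∈ F, Λ * ∫⁻ x in E R, dyadicMaximal u g x * dyadicMaximal u h x := by
        refine Finset.sum_le_sum fun R _ => ?_
        obtain ⟨hm, hsub, hvol⟩ := hE R R.2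
        set Q := dyadicCube u R.1.1 R.1.2
        set c := ⨍⁻ y in dyadicAncestor u k R.1.1 R.1.2, g y ∂volume
        have hQ0 : volume Q ≠ 0 := by
          rw [volume_dyadicCube]; exact cubeVolume_ne_zero _ _
        have hQt : volume Q ≠ ∞ := by
          rw [volume_dyadicCube]; exact cubeVolume_ne_top _ _
        have e1 : ∫⁻ x, Q.indicator (fun _ => c) x * h x = c * ∫⁻ x in Q, h x := by
          rw [← lintegral_const_mul _ hh,
            ← lintegral_indicator (measurableSet_dyadicCube u R.1.1 R.1.2)]
          refine lintegral_congr fun x => ?_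
          by_cases hx : x ∈ Q <;> simp [hx, Q]
        have e2 : ∫⁻ x in Q, h x = volume Q * ⨍⁻ x in Q, h x ∂volume := by
          rw [setLAverage_eq, ENNReal.mul_div_cancel hQ0 hQt]
        rw [e1, e2]
        calc c * (volume Q * ⨍⁻ x in Q, h x ∂volume)
            ≤ c * ((Λ * volume (E R)) * ⨍⁻ x in Q, h x ∂volume) := by gcongr
          _ = Λ * ((c * ⨍⁻ x in Q, h x ∂volume) * volume (E R)) := by ring
          _ = Λ * ∫⁻ x in E R, c * ⨍⁻ x in Q, h x ∂volume := by rw [setLIntegral_const]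
          _ ≤ Λ * ∫⁻ x in E R, dyadicMaximal u g x * dyadicMaximal u h x := by
              gcongr Λ * ?_
              refine setLIntegral_mono' hm fun x hx => ?_
              exact mul_le_mul' (hu.laverage_dyadicAncestor_le k g (hsub hx))
                (laverage_dyadicCube_le_dyadicMaximal u h (hsub hx))
    _ = Λ * ∫⁻ x in ⋃ R ∈ F, E R, dyadicMaximal u g x * dyadicMaximal u h x := by
        rw [← Finset.mul_sum, lintegral_biUnion_finset]
        · intro R _ R' _ hne
          exact hdisj R.2 R'.2 fun h => hne (Subtype.ext h)
        · exact fun R _ => (hE R R.2).1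
    _ ≤ _ := by gcongr; exact Measure.restrict_le_self

/-- Dyadic shifts over sparse collections are bounded on `L^p`, uniformly in the complexity. -/
theorem IsThirds.dyadicShift_Lp_le {d : ℕ} {u : Fin d → ℝ} (hu : IsThirds u) (k : ℕ)
    {Λ : ℝ≥0} (hΛ : Λ ≠ 0) {L : Set (ℤ × (Fin d → ℤ))} (hL : IsSparse u Λ L)
    {g : EuclideanSpace ℝ (Fin d) → ℝ≥0∞} (hg : Measurable g) {p : ℝ} (hp : 1 < p) :
    (∫⁻ x, dyadicShift u k L g x ^ p) ^ (1 / p)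
      ≤ (Λ * maximalConst p * maximalConst p.conjExponent : ℝ≥0)
        * (∫⁻ x, g x ^ p) ^ (1 / p) := by
  have hp0 : 0 < p := by linarith
  have hp1 : 0 < p - 1 := by linarith
  have hpq : p.HolderConjugate p.conjExponent := Real.HolderConjugate.conjExponent hp
  have hq : 1 < p.conjExponent := hpq.symm.lt
  set D : ℝ≥0 := Λ * maximalConst p * maximalConst p.conjExponent with hD
  have hD0 : D ≠ 0 :=
    mul_ne_zero (mul_ne_zero hΛ (maximalConst_pos hp).ne') (maximalConst_pos hq).ne'
  -- The product `D * ∞` is `∞` only because `D ≠ 0`.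
  rcases eq_or_ne (∫⁻ x, g x ^ p) ∞ with hinf | hfin
  · rw [hinf, ENNReal.top_rpow_of_pos (by positivity), ENNReal.mul_top (by exact_mod_cast hD0)]
    exact le_top
  set SF : Finset L → EuclideanSpace ℝ (Fin d) → ℝ≥0∞ := fun F x =>
    ∑ R ∈ F, (dyadicCube u R.1.1 R.1.2).indicator
      (fun _ => ⨍⁻ y in dyadicAncestor u k R.1.1 R.1.2, g y ∂volume) x with hSF
  have hSFm : ∀ F, Measurable (SF F) := fun F => Finset.measurable_fun_sum _ fun R _ =>
    measurable_const.indicator (measurableSet_dyadicCube u _ _)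
  -- This qualitative finiteness permits the division by a power of `X` below; it is the reason for
  -- working with finite partial sums first.
  have hfinite : ∀ F : Finset L, ∫⁻ x, SF F x ^ p ≠ ∞ := by
    intro F
    have h1 : ∀ x, SF F x ≤ F.card * dyadicMaximal u g x := by
      intro x
      rw [← nsmul_eq_mul]
      refine Finset.sum_le_card_nsmul _ _ _ fun R _ => ?_
      by_cases hx : x ∈ dyadicCube u R.1.1 R.1.2
      · rw [Set.indicator_of_mem hx]
        exact hu.laverage_dyadicAncestor_le k g hx
      · rw [Set.indicator_of_notMem hx]
        exact zero_le
    refine ne_top_of_le_ne_top ?_ (lintegral_mono fun x => ENNReal.rpow_le_rpow (h1 x) hp0.le)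
    simp_rw [ENNReal.mul_rpow_of_nonneg _ _ hp0.le]
    rw [lintegral_const_mul' _ _ (ENNReal.rpow_ne_top_of_nonneg hp0.le (by finiteness))]
    refine ENNReal.mul_ne_top (ENNReal.rpow_ne_top_of_nonneg hp0.le (by finiteness)) ?_
    exact ne_top_of_le_ne_top (ENNReal.mul_ne_top ENNReal.ofReal_ne_top hfin)
      (hu.lintegral_dyadicMaximal_rpow_le hg hp)
  have hbound : ∀ F : Finset L,
      (∫⁻ x, SF F x ^ p) ^ (1 / p) ≤ D * (∫⁻ x, g x ^ p) ^ (1 / p) := by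
    intro F
    set X := ∫⁻ x, SF F x ^ p with hX
    set Y := (∫⁻ x, g x ^ p) ^ (1 / p) with hY
    -- The extremal dual function: `∫ SF F * h = X`, and the `p'`-th power of `h` also integrates to
    -- `X`.
    set h : EuclideanSpace ℝ (Fin d) → ℝ≥0∞ := fun x => SF F x ^ (p - 1) with hh
    have hhm : Measurable h := (hSFm F).pow_const _
    have e1 : X = ∫⁻ x, SF F x * h x := by
      refine lintegral_congr fun x => ?_
      conv_lhs => rw [show p = 1 + (p - 1) by ring]
      rw [ENNReal.rpow_add_of_nonneg _ _ zero_le_one hp1.le, ENNReal.rpow_one]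
    have e2 : ∫⁻ x, h x ^ p.conjExponent = X := by
      refine lintegral_congr fun x => ?_
      rw [hh, ← ENNReal.rpow_mul]
      congr 1
      rw [Real.conjExponent]
      field_simp
    have e3 : X ≤ D * Y * X ^ (1 / p.conjExponent) := by
      calc X = ∫⁻ x, SF F x * h x := e1
        _ ≤ Λ * ∫⁻ x, dyadicMaximal u g x * dyadicMaximal u h x :=
            hu.lintegral_shift_mul_le k hL F g h hhm
        _ ≤ Λ * ((∫⁻ x, dyadicMaximal u g x ^ p) ^ (1 / p) *
              (∫⁻ x, dyadicMaximal u h x ^ p.conjExponent) ^ (1 / p.conjExponent)) := by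
            gcongr Λ * ?_
            exact ENNReal.lintegral_mul_le_Lp_mul_Lq _ hpq
              (measurable_dyadicMaximal u g).aemeasurable
              (measurable_dyadicMaximal u h).aemeasurable
        _ ≤ Λ * ((maximalConst p * Y) * (maximalConst p.conjExponent *
              (∫⁻ x, h x ^ p.conjExponent) ^ (1 / p.conjExponent))) := by
            gcongr
            · exact hu.dyadicMaximal_Lp_le hg hp
            · exact hu.dyadicMaximal_Lp_le hhm hq
        _ = D * Y * X ^ (1 / p.conjExponent) := by
            rw [e2, hD]; push_cast; ring
    rcases eq_or_ne X 0 with hX0 | hX0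
    · rw [hX0, ENNReal.zero_rpow_of_pos (by positivity)]
      exact zero_le
    have hc0 : X ^ (1 / p.conjExponent) ≠ 0 :=
      (ENNReal.rpow_pos (pos_iff_ne_zero.2 hX0) (hfinite F)).ne'
    have hct : X ^ (1 / p.conjExponent) ≠ ∞ :=
      ENNReal.rpow_ne_top_of_nonneg (by positivity) (hfinite F)
    have e4 : X = X ^ (1 / p) * X ^ (1 / p.conjExponent) := by
      rw [← ENNReal.rpow_add _ _ hX0 (hfinite F), one_div, one_div, hpq.inv_add_inv_eq_one,
        ENNReal.rpow_one]
    refine (ENNReal.mul_le_mul_iff_left hc0 hct).1 ?_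
    rwa [← e4]
  have hS : ∀ x, dyadicShift u k L g x ^ p = ⨆ F, SF F x ^ p := by
    intro x
    rw [dyadicShift, ENNReal.tsum_eq_iSup_sum]
    exact (ENNReal.orderIsoRpow p hp0).map_iSup _
  simp_rw [hS]
  rw [lintegral_iSup_directed fun F => ((hSFm F).pow_const p).aemeasurable]
  · rw [show (⨆ F, ∫⁻ x, SF F x ^ p) ^ (1 / p) = ⨆ F, (∫⁻ x, SF F x ^ p) ^ (1 / p) from
      (ENNReal.orderIsoRpow (1 / p) (by positivity)).map_iSup _]
    exact iSup_le hbound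
  · refine Monotone.directed_le fun F F' hF x => ENNReal.rpow_le_rpow ?_ hp0.le
    exact Finset.sum_le_sum_of_subset hF

/-! ### Variation along a fixed sequence. -/

/-- The `ℓ^q` norm of the increments of `y` along the sequence `ε`. -/
def variationAlong (q : ℝ) (y : ℝ → ℂ) (ε : ℤ → ℝ) : ℝ≥0∞ :=
  (∑' i : ℤ, ‖y (ε i) - y (ε (i + 1))‖ₑ ^ q) ^ (1 / q)

theorem variationAlong_le_variationNorm (q : ℝ) (y : ℝ → ℂ) {ε : ℤ → ℝ} (hε : Monotone ε)
    (hpos : ∀ i, 0 < ε i) : variationAlong q y ε ≤ variationNorm q y :=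
  le_iSup_of_le ε (le_iSup_of_le hε (le_iSup_of_le hpos le_rfl))

theorem variationAlong_add_le {q : ℝ} (hq : 1 ≤ q) (y z : ℝ → ℂ) (ε : ℤ → ℝ) :
    variationAlong q (fun t => y t + z t) ε ≤ variationAlong q y ε + variationAlong q z ε := by
  have hq0 : 0 < q := by linarith
  have h := ENNReal.lintegral_Lp_add_le (μ := (Measure.count : Measure ℤ)) (p := q)
    (f := fun i => ‖y (ε i) - y (ε (i + 1))‖ₑ) (g := fun i => ‖z (ε i) - z (ε (i + 1))‖ₑ)
    (measurable_of_countable _).aemeasurable (measurable_of_countable _).aemeasurable hq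
  simp only [lintegral_count, Pi.add_apply] at h
  refine le_trans ?_ h
  unfold variationAlong
  gcongr with i
  refine le_trans (le_of_eq ?_) (enorm_add_le _ _)
  congr 1
  ring

theorem variationAlong_le_tsum {q : ℝ} (hq : 1 ≤ q) (y : ℝ → ℂ) (ε : ℤ → ℝ) :
    variationAlong q y ε ≤ ∑' i : ℤ, ‖y (ε i) - y (ε (i + 1))‖ₑ := by
  have hq0 : 0 < q := by linarith
  set S := ∑' i : ℤ, ‖y (ε i) - y (ε (i + 1))‖ₑ with hS
  have hsplit : ∀ a : ℝ≥0∞, a ^ q = a * a ^ (q - 1) := fun a => by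
    conv_lhs => rw [show q = 1 + (q - 1) by ring]
    rw [ENNReal.rpow_add_of_nonneg _ _ zero_le_one (by linarith), ENNReal.rpow_one]
  have h1 : ∑' i : ℤ, ‖y (ε i) - y (ε (i + 1))‖ₑ ^ q ≤ S ^ q := by
    rw [hsplit S, hS, ← ENNReal.tsum_mul_right]
    refine ENNReal.tsum_le_tsum fun i => ?_
    rw [hsplit]
    gcongr
    · exact ENNReal.le_tsum i
  calc variationAlong q y ε ≤ (S ^ q) ^ (1 / q) := ENNReal.rpow_le_rpow h1 (by positivity)
    _ = S := by rw [← ENNReal.rpow_mul, mul_one_div_cancel hq0.ne', ENNReal.rpow_one]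

/-- A finite partial sum only sees the sequence from some index `n` on, and replacing `ε i` by `max
(ε n) (ε i)` leaves those terms unchanged. Sequences bounded away from zero therefore suffice, which
makes the later recursion finite. -/
theorem variationNorm_le_of_forall_variationAlong_le {q : ℝ} (hq : 0 < q) (y : ℝ → ℂ) {b : ℝ≥0∞}
    (h : ∀ ε : ℤ → ℝ, Monotone ε → ∀ δ > 0, (∀ i, δ ≤ ε i) → variationAlong q y ε ≤ b) :
    variationNorm q y ≤ b := by
  refine iSup_le fun ε => iSup_le fun hε => iSup_le fun hpos => ?_
  rw [one_div, ENNReal.rpow_inv_le_iff hq, ENNReal.tsum_eq_iSup_sum]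
  refine iSup_le fun F => ?_
  obtain ⟨n, hn⟩ : ∃ n : ℤ, ∀ i ∈ F, n ≤ i := by
    obtain ⟨n, hn⟩ := F.bddBelow
    exact ⟨n, fun i hi => hn hi⟩
  have h1 := h (fun i => max (ε n) (ε i)) (fun i j hij => max_le_max_left _ (hε hij)) (ε n)
    (hpos n) (fun i => le_max_left _ _)
  rw [variationAlong, one_div, ENNReal.rpow_inv_le_iff hq] at h1
  refine le_trans ?_ h1
  refine le_trans (Finset.sum_le_sum fun i hi => ?_) (ENNReal.sum_le_tsum F)
  rw [max_eq_right (hε (hn i hi)), max_eq_right (hε ((hn i hi).trans (by omega)))]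

/-! ### Moduli of continuity and the Dini sum. -/

theorem IsModulusOfContinuity.nonneg {ω : ℝ → ℝ} (hω : IsModulusOfContinuity ω) {t : ℝ}
    (ht : 0 ≤ t) : 0 ≤ ω t := by
  rw [← hω.zero]
  exact hω.mono Set.self_mem_Ici ht ht

theorem two_zpow_neg_add_one (k : ℕ) : (2 : ℝ) ^ (-((k : ℤ) + 1)) = 2 ^ (-(k : ℤ)) / 2 := by
  rw [neg_add, zpow_add₀ two_ne_zero, zpow_neg_one]
  rfl

/-- By monotonicity `ω r ≤ 2 ∫ ω t / t` over `[r, 2r)`; for `r = 2 ^ (-k-1)` these intervals are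
disjoint and lie in `(0, 1)`. -/
theorem DiniCondition.tsum_ne_top {ω : ℝ → ℝ} (hω : IsModulusOfContinuity ω)
    (hD : DiniCondition ω) : ∑' k : ℕ, ENNReal.ofReal (ω ((2 : ℝ) ^ (-(k : ℤ)))) ≠ ∞ := by
  set I : ℕ → Set ℝ := fun k => Set.Ico ((2 : ℝ) ^ (-((k : ℤ) + 1))) (2 ^ (-(k : ℤ))) with hI
  have hterm : ∀ k : ℕ, ENNReal.ofReal (ω ((2 : ℝ) ^ (-((k + 1 : ℕ) : ℤ))))
      ≤ 2 * ∫⁻ t in I k, ‖ω t / t‖ₑ := by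
    intro k
    push_cast
    set r : ℝ := (2 : ℝ) ^ (-((k : ℤ) + 1)) with hr
    have hr0 : 0 < r := by positivity
    have hr2 : (2 : ℝ) ^ (-(k : ℤ)) = 2 * r := by
      rw [hr, two_zpow_neg_add_one]; ring
    have hIk : I k = Set.Ico r (2 * r) := by rw [hI]; simp only; rw [hr2]
    calc ENNReal.ofReal (ω r) = 2 * ∫⁻ _t in I k, ENNReal.ofReal (ω r / (2 * r)) := by
          rw [setLIntegral_const, hIk, Real.volume_Ico, ← ENNReal.ofReal_mul
            (div_nonneg (hω.nonneg hr0.le) (by positivity)), ← ENNReal.ofReal_ofNat,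
            ← ENNReal.ofReal_mul (by norm_num)]
          congr 1
          field_simp
          ring
      _ ≤ 2 * ∫⁻ t in I k, ‖ω t / t‖ₑ := by
          gcongr 2 * ?_
          refine setLIntegral_mono' (by rw [hIk]; exact measurableSet_Ico) fun t ht => ?_
          rw [hIk] at ht
          have ht0 : 0 < t := hr0.trans_le ht.1
          rw [← ofReal_norm]
          refine ENNReal.ofReal_le_ofReal ((div_le_div₀ (hω.nonneg ht0.le)
            (hω.mono hr0.le ht0.le ht.1) ht0 ht.2.le).trans (Real.le_norm_self _))
  have hdisj : Pairwise (Function.onFun Disjoint I) := by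
    refine (pairwise_disjoint_on I).2 fun m n hmn => ?_
    rw [Set.disjoint_left]
    intro t ht ht'
    have : (2 : ℝ) ^ (-(n : ℤ)) ≤ 2 ^ (-((m : ℤ) + 1)) :=
      zpow_le_zpow_right₀ one_le_two (by omega)
    exact absurd (ht'.2.trans_le this) (not_lt.2 ht.1)
  have hsub : ⋃ k, I k ⊆ Set.Ioo 0 1 := by
    refine Set.iUnion_subset fun k t ht => ⟨lt_of_lt_of_le (by positivity) ht.1, ?_⟩
    exact ht.2.trans_le (zpow_le_one_of_nonpos₀ one_le_two (by omega))
  -- The term `ω 1` would need the interval `[1, 2)`, beyond the Dini integral, and is split off.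
  rw [tsum_eq_zero_add' ENNReal.summable]
  refine ENNReal.add_ne_top.2 ⟨ENNReal.ofReal_ne_top, ?_⟩
  refine ne_top_of_le_ne_top ?_ (ENNReal.tsum_le_tsum hterm)
  rw [ENNReal.tsum_mul_left, ← lintegral_iUnion (fun k => measurableSet_Ico) hdisj]
  refine ENNReal.mul_ne_top (by norm_num) ?_
  exact ne_top_of_le_ne_top hD.2.ne (lintegral_mono_set hsub)

theorem DiniCondition.exists_forall_lt {ω : ℝ → ℝ} (hω : IsModulusOfContinuity ω)
    (hD : DiniCondition ω) {η : ℝ} (hη : 0 < η) :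
    ∃ δ > 0, ∀ t, 0 ≤ t → t ≤ δ → ω t < η := by
  have h := ENNReal.tendsto_atTop_zero_of_tsum_ne_top (hD.tsum_ne_top hω)
  obtain ⟨k, hk⟩ := (h.eventually (gt_mem_nhds (ENNReal.ofReal_pos.2 hη))).exists
  refine ⟨2 ^ (-(k : ℤ)), by positivity, fun t ht ht' => ?_⟩
  exact (hω.mono ht (by simp) ht').trans_lt ((ENNReal.ofReal_lt_ofReal_iff hη).1 hk)

/-! ### Continuity and integrability of truncated kernels. -/

section Kernel

variable {d : ℕ} {ω : ℝ → ℝ} {A : ℝ}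
  {K : EuclideanSpace ℝ (Fin d) → EuclideanSpace ℝ (Fin d) → ℂ}

theorem IsCZKernel.const_nonneg (hK : IsCZKernel ω A K) {x y : EuclideanSpace ℝ (Fin d)}
    (h : x ≠ y) : 0 ≤ A := by
  have h0 : 0 < ‖x - y‖ ^ d := pow_pos (norm_pos_iff.2 (sub_ne_zero.2 h)) d
  have := (norm_nonneg _).trans (hK.size x y h)
  rw [le_div_iff₀ h0, zero_mul] at this
  exact this

/-- The Dini condition forces `ω t → 0` as `t → 0`, so the regularity estimate yields continuity off
the diagonal, in either variable. -/
theorem IsCZKernel.continuousAt_of_regularity (hω : IsModulusOfContinuity ω)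
    (hD : DiniCondition ω) {k : EuclideanSpace ℝ (Fin d) → ℂ} {x y : EuclideanSpace ℝ (Fin d)}
    (h : x ≠ y) (hA : 0 ≤ A)
    (hk : ∀ x', 0 < ‖x - x'‖ → 2 * ‖x - x'‖ < ‖x - y‖ →
      ‖k x - k x'‖ ≤ A * ω (‖x - x'‖ / ‖x - y‖) / ‖x - y‖ ^ d) : ContinuousAt k x := by
  have h0 : 0 < ‖x - y‖ := norm_pos_iff.2 (sub_ne_zero.2 h)
  rw [Metric.continuousAt_iff]
  intro η hη
  obtain ⟨δ, hδ, hδ'⟩ := hD.exists_forall_lt hω (η := η * ‖x - y‖ ^ d / (A + 1)) (by positivity)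
  refine ⟨min (δ * ‖x - y‖) (‖x - y‖ / 2), by positivity, fun x' hx' => ?_⟩
  rcases eq_or_ne x x' with rfl | hne
  · simpa using hη
  rw [dist_comm, dist_eq_norm] at hx'
  rw [dist_comm, dist_eq_norm]
  have h1 : 0 < ‖x - x'‖ := norm_pos_iff.2 (sub_ne_zero.2 hne)
  refine (hk x' h1 (by linarith [min_le_right (δ * ‖x - y‖) (‖x - y‖ / 2)])).trans_lt ?_
  have h2 : ω (‖x - x'‖ / ‖x - y‖) < η * ‖x - y‖ ^ d / (A + 1) := by
    refine hδ' _ (by positivity) ?_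
    rw [div_le_iff₀ h0]
    exact (hx'.trans_le (min_le_left _ _)).le
  have h3 : 0 ≤ ω (‖x - x'‖ / ‖x - y‖) := hω.nonneg (by positivity)
  rw [lt_div_iff₀ (by positivity)] at h2
  rw [div_lt_iff₀ (by positivity)]
  nlinarith

theorem IsCZKernel.continuousAt_left (hK : IsCZKernel ω A K) (hω : IsModulusOfContinuity ω)
    (hD : DiniCondition ω) {x y : EuclideanSpace ℝ (Fin d)} (h : x ≠ y) :
    ContinuousAt (fun x => K x y) x :=
  continuousAt_of_regularity hω hD h (hK.const_nonneg h) fun x' h1 h2 =>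
    (le_add_of_nonneg_right (norm_nonneg _)).trans (hK.regularity x x' y h1 h2)

theorem IsCZKernel.continuousAt_right (hK : IsCZKernel ω A K) (hω : IsModulusOfContinuity ω)
    (hD : DiniCondition ω) {x y : EuclideanSpace ℝ (Fin d)} (h : x ≠ y) :
    ContinuousAt (K x) y :=
  continuousAt_of_regularity hω hD h.symm (hK.const_nonneg h) fun y' h1 h2 =>
    (le_add_of_nonneg_left (norm_nonneg _)).trans (hK.regularity y y' x h1 h2)

variable {φ : EuclideanSpace ℝ (Fin d) → ℝ}

theorem IsSmoothCutoff.nonneg (hφ : IsSmoothCutoff φ) (z : EuclideanSpace ℝ (Fin d)) :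
    0 ≤ φ z :=
  (Set.indicator_nonneg (f := 1) (fun _ _ => zero_le_one) z).trans (hφ.lower z)

theorem IsSmoothCutoff.eq_zero (hφ : IsSmoothCutoff φ) {z : EuclideanSpace ℝ (Fin d)}
    (hz : ‖z‖ < 1 / 2) : φ z = 0 := by
  refine le_antisymm ((hφ.upper z).trans ?_) (hφ.nonneg z)
  rw [Set.indicator_of_notMem (by simpa using hz)]

theorem IsSmoothCutoff.eq_one (hφ : IsSmoothCutoff φ) {z : EuclideanSpace ℝ (Fin d)}
    (hz : 1 ≤ ‖z‖) : φ z = 1 := by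
  have h1 := hφ.upper z
  have h2 := hφ.lower z
  rw [Set.indicator_of_mem (by simp; linarith)] at h1
  rw [Set.indicator_of_mem (by simpa using hz)] at h2
  exact le_antisymm h1 h2

theorem IsSmoothCutoff.le_one (hφ : IsSmoothCutoff φ) (z : EuclideanSpace ℝ (Fin d)) :
    φ z ≤ 1 :=
  (hφ.upper z).trans (Set.indicator_le_self' (fun _ _ => zero_le_one) z)

theorem IsSmoothCutoff.eq_zero_smul (hφ : IsSmoothCutoff φ) {ε : ℝ} (hε : 0 < ε)
    {z : EuclideanSpace ℝ (Fin d)} (hz : ‖z‖ < ε / 2) : φ (ε⁻¹ • z) = 0 := by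
  refine hφ.eq_zero ?_
  rw [norm_smul, norm_inv, Real.norm_of_nonneg hε.le, inv_mul_lt_iff₀ hε]
  linarith

theorem norm_truncatedKernel_le (hφ : IsSmoothCutoff φ) (hK : IsCZKernel ω A K)
    {ε : ℝ} (hε : 0 < ε) (x y : EuclideanSpace ℝ (Fin d)) :
    ‖(φ (ε⁻¹ • (x - y)) : ℂ) * K x y‖ ≤ |A| * (2 / ε) ^ d := by
  rcases lt_or_ge ‖x - y‖ (ε / 2) with h | h
  · rw [hφ.eq_zero_smul hε h]
    simp only [Complex.ofReal_zero, zero_mul, norm_zero]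
    positivity
  · have h0 : 0 < ‖x - y‖ := lt_of_lt_of_le (by positivity) h
    have hne : x ≠ y := by
      rintro rfl
      simp at h0
    rw [norm_mul, Complex.norm_real, Real.norm_of_nonneg (hφ.nonneg _)]
    calc φ (ε⁻¹ • (x - y)) * ‖K x y‖ ≤ 1 * (|A| / ‖x - y‖ ^ d) := by
          gcongr
          · exact hφ.le_one _
          · exact (hK.size x y hne).trans (by gcongr; exact le_abs_self A)
      _ ≤ 1 * (|A| / (ε / 2) ^ d) := by gcongr
      _ = |A| * (2 / ε) ^ d := by
          rw [one_mul, div_eq_mul_inv, ← inv_pow, inv_div]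

theorem continuous_truncatedKernel_left (hφ : IsSmoothCutoff φ) (hK : IsCZKernel ω A K)
    (hω : IsModulusOfContinuity ω) (hD : DiniCondition ω) {ε : ℝ} (hε : 0 < ε)
    (y : EuclideanSpace ℝ (Fin d)) :
    Continuous fun x => (φ (ε⁻¹ • (x - y)) : ℂ) * K x y := by
  have hφc := hφ.smooth.continuous
  rw [continuous_iff_continuousAt]
  intro x
  rcases eq_or_ne x y with rfl | h
  · refine (continuousAt_const (y := (0 : ℂ))).congr ?_
    filter_upwards [Metric.ball_mem_nhds x (half_pos hε)] with z hz
    rw [hφ.eq_zero_smul hε (by simpa [dist_eq_norm] using hz), Complex.ofReal_zero, zero_mul]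
  · exact ContinuousAt.mul (by fun_prop) (hK.continuousAt_left hω hD h)

theorem continuous_truncatedKernel_right (hφ : IsSmoothCutoff φ) (hK : IsCZKernel ω A K)
    (hω : IsModulusOfContinuity ω) (hD : DiniCondition ω) {ε : ℝ} (hε : 0 < ε)
    (x : EuclideanSpace ℝ (Fin d)) :
    Continuous fun y => (φ (ε⁻¹ • (x - y)) : ℂ) * K x y := by
  have hφc := hφ.smooth.continuous
  rw [continuous_iff_continuousAt]
  intro y
  rcases eq_or_ne x y with rfl | h
  · refine (continuousAt_const (y := (0 : ℂ))).congr ?_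
    filter_upwards [Metric.ball_mem_nhds x (half_pos hε)] with z hz
    rw [hφ.eq_zero_smul hε (by simpa [dist_eq_norm, norm_sub_rev] using hz),
      Complex.ofReal_zero, zero_mul]
  · exact ContinuousAt.mul (by fun_prop) (hK.continuousAt_right hω hD h)

theorem integrable_truncatedKernel_mul (hφ : IsSmoothCutoff φ)
    (hK : IsCZKernel ω A K) (hω : IsModulusOfContinuity ω) (hD : DiniCondition ω) {ε : ℝ}
    (hε : 0 < ε) {f : EuclideanSpace ℝ (Fin d) → ℂ} (hf : Integrable f)
    (x : EuclideanSpace ℝ (Fin d)) :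
    Integrable fun y => (φ (ε⁻¹ • (x - y)) : ℂ) * K x y * f y :=
  hf.bdd_mul (continuous_truncatedKernel_right hφ hK hω hD hε x).aestronglyMeasurable
    (Filter.Eventually.of_forall fun y => norm_truncatedKernel_le hφ hK hε x y)

theorem smoothTruncation_add (hφ : IsSmoothCutoff φ)
    (hK : IsCZKernel ω A K) (hω : IsModulusOfContinuity ω) (hD : DiniCondition ω) {ε : ℝ}
    (hε : 0 < ε) {f g : EuclideanSpace ℝ (Fin d) → ℂ} (hf : Integrable f) (hg : Integrable g)
    (x : EuclideanSpace ℝ (Fin d)) :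
    smoothTruncation φ K ε (f + g) x
      = smoothTruncation φ K ε f x + smoothTruncation φ K ε g x := by
  rw [smoothTruncation, smoothTruncation, smoothTruncation,
    ← integral_add (integrable_truncatedKernel_mul hφ hK hω hD hε hf x)
      (integrable_truncatedKernel_mul hφ hK hω hD hε hg x)]
  simp only [Pi.add_apply, mul_add]

theorem smoothTruncation_neg (ε : ℝ) (f : EuclideanSpace ℝ (Fin d) → ℂ)
    (x : EuclideanSpace ℝ (Fin d)) :
    smoothTruncation φ K ε (-f) x = -smoothTruncation φ K ε f x := by
  simp only [smoothTruncation, Pi.neg_apply, mul_neg, integral_neg]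

theorem continuous_smoothTruncation (hφ : IsSmoothCutoff φ)
    (hK : IsCZKernel ω A K) (hω : IsModulusOfContinuity ω) (hD : DiniCondition ω) {ε : ℝ}
    (hε : 0 < ε) {f : EuclideanSpace ℝ (Fin d) → ℂ} (hf : Integrable f) :
    Continuous (smoothTruncation φ K ε f) := by
  refine continuous_of_dominated (bound := fun y => |A| * (2 / ε) ^ d * ‖f y‖)
    (fun x => (integrable_truncatedKernel_mul hφ hK hω hD hε hf x).aestronglyMeasurable)
    (fun x => Filter.Eventually.of_forall fun y => ?_) (hf.norm.const_mul _)
    (Filter.Eventually.of_forall fun y =>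
      (continuous_truncatedKernel_left hφ hK hω hD hε y).mul continuous_const)
  rw [norm_mul]
  gcongr
  exact norm_truncatedKernel_le hφ hK hε x y

/-- The variation is a supremum of lower semicontinuous functions, since each truncation is
continuous. Openness is what later gives bounds at every point outside the stopping children. -/
theorem isOpen_lt_smoothVariation (hφ : IsSmoothCutoff φ)
    (hK : IsCZKernel ω A K) (hω : IsModulusOfContinuity ω) (hD : DiniCondition ω) {q : ℝ}
    (hq : 0 < q) {f : EuclideanSpace ℝ (Fin d) → ℂ} (hf : Integrable f) (t : ℝ≥0∞) :
    IsOpen {x | t < smoothVariation q φ K f x} := by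
  suffices h : LowerSemicontinuous (smoothVariation q φ K f) from h.isOpen_preimage t
  refine lowerSemicontinuous_iSup fun ε => lowerSemicontinuous_iSup fun hε =>
    lowerSemicontinuous_iSup fun hpos => ?_
  refine Continuous.comp_lowerSemicontinuous (g := fun a : ℝ≥0∞ => a ^ (1 / q))
    ENNReal.continuous_rpow_const ?_ fun a b hab => ENNReal.rpow_le_rpow hab (by positivity)
  refine lowerSemicontinuous_tsum fun i => Continuous.lowerSemicontinuous ?_
  exact ENNReal.continuous_rpow_const.comp (continuous_enorm.comp
    ((continuous_smoothTruncation hφ hK hω hD (hpos i) hf).sub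
      (continuous_smoothTruncation hφ hK hω hD (hpos (i + 1)) hf)))

theorem smoothTruncation_eq_zero (hφ : IsSmoothCutoff φ) {ε : ℝ} (hε : 0 < ε)
    {f : EuclideanSpace ℝ (Fin d) → ℂ} {x : EuclideanSpace ℝ (Fin d)}
    (h : ∀ y, f y ≠ 0 → ‖x - y‖ < ε / 2) : smoothTruncation φ K ε f x = 0 := by
  rw [smoothTruncation, ← integral_zero (EuclideanSpace ℝ (Fin d)) ℂ]
  congr 1
  funext y
  by_cases hy : f y = 0
  · simp [hy]
  · simp [hφ.eq_zero_smul hε (h y hy)]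

end Kernel

/-! ### Total variation of dilated cut-offs and kernel increments. -/

theorem Antitone.sum_sub_le {c : ℤ → ℝ} (hc : Antitone c) {a b : ℝ}
    (h : ∀ i, c i ∈ Set.Icc a b) (F : Finset ℤ) : ∑ i ∈ F, (c i - c (i + 1)) ≤ b - a := by
  obtain ⟨n, hn⟩ : ∃ n : ℤ, ∀ i ∈ F, n ≤ i := by
    obtain ⟨n, hn⟩ := F.bddBelow
    exact ⟨n, fun i hi => hn hi⟩
  obtain ⟨m, hm⟩ : ∃ m : ℤ, ∀ i ∈ F, i ≤ m := by
    obtain ⟨m, hm⟩ := F.bddAbove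
    exact ⟨m, fun i hi => hm hi⟩
  -- The increments are nonnegative, so `F` may be enlarged to an interval, where the sum
  -- telescopes.
  have hsub : F ⊆ (Finset.range (m - n + 1).toNat).image fun k : ℕ => n + (k : ℤ) := by
    intro i hi
    have := hn i hi
    have := hm i hi
    simp only [Finset.mem_image, Finset.mem_range]
    exact ⟨(i - n).toNat, by omega, by omega⟩
  calc ∑ i ∈ F, (c i - c (i + 1))
      ≤ ∑ i ∈ (Finset.range (m - n + 1).toNat).image fun k : ℕ => n + (k : ℤ),
          (c i - c (i + 1)) :=
        Finset.sum_le_sum_of_subset_of_nonneg hsub fun i _ _ =>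
          sub_nonneg.2 (hc (by omega))
    _ = ∑ k ∈ Finset.range (m - n + 1).toNat, (c (n + (k : ℤ)) - c (n + ((k + 1 : ℕ) : ℤ))) := by
        rw [Finset.sum_image fun a _ b _ hab => by simpa using hab]
        refine Finset.sum_congr rfl fun k _ => ?_
        push_cast
        rw [add_assoc]
    _ = c (n + ((0 : ℕ) : ℤ)) - c (n + ((m - n + 1).toNat : ℤ)) :=
        Finset.sum_range_sub' (fun k : ℕ => c (n + (k : ℤ))) _
    _ ≤ b - a := sub_le_sub (h _).2 (h _).1

/-- The total variation of a function that is `Λ`-Lipschitz on `[0, b]` and constant on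
`[b, ∞)`. -/
theorem tsum_enorm_sub_le_of_lipschitz {γ : ℝ → ℝ} {b Λ : ℝ} (hb : 0 ≤ b)
    (hlip : ∀ s ∈ Set.Icc 0 b, ∀ t ∈ Set.Icc 0 b, |γ s - γ t| ≤ Λ * |s - t|)
    (hconst : ∀ s, b ≤ s → γ s = γ b) {s : ℤ → ℝ} (hs : Antitone s) (hs0 : ∀ i, 0 ≤ s i)
    (hΛ : 0 ≤ Λ) :
    ∑' i, ‖γ (s i) - γ (s (i + 1))‖ₑ ≤ ENNReal.ofReal (Λ * b) := by
  set c : ℤ → ℝ := fun i => min b (s i) with hc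
  have hcI : ∀ i, c i ∈ Set.Icc 0 b := fun i => ⟨le_min hb (hs0 i), min_le_left _ _⟩
  have hca : Antitone c := fun i j h => min_le_min_left _ (hs h)
  have hγ : ∀ i, γ (s i) = γ (c i) := by
    intro i
    rcases le_total b (s i) with h | h
    · rw [hconst _ h, hc]; simp only [min_eq_left h]
    · rw [hc]; simp only [min_eq_right h]
  rw [ENNReal.tsum_eq_iSup_sum]
  refine iSup_le fun F => ?_
  calc ∑ i ∈ F, ‖γ (s i) - γ (s (i + 1))‖ₑ
      ≤ ∑ i ∈ F, ENNReal.ofReal (Λ * (c i - c (i + 1))) := by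
        refine Finset.sum_le_sum fun i _ => ?_
        rw [hγ, hγ, ← ofReal_norm, Real.norm_eq_abs]
        refine ENNReal.ofReal_le_ofReal ((hlip _ (hcI i) _ (hcI (i + 1))).trans ?_)
        rw [abs_of_nonneg (sub_nonneg.2 (hca (by omega)))]
    _ = ENNReal.ofReal (Λ * ∑ i ∈ F, (c i - c (i + 1))) := by
        rw [Finset.mul_sum, ENNReal.ofReal_sum_of_nonneg fun i _ =>
          mul_nonneg hΛ (sub_nonneg.2 (hca (by omega)))]
    _ ≤ ENNReal.ofReal (Λ * b) := by
        refine ENNReal.ofReal_le_ofReal (mul_le_mul_of_nonneg_left ?_ hΛ)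
        simpa using hca.sum_sub_le hcI F

section Cutoff

variable {d : ℕ} {φ : EuclideanSpace ℝ (Fin d) → ℝ}

theorem IsSmoothCutoff.exists_bounds (hφ : IsSmoothCutoff φ) :
    ∃ M : ℝ, 0 ≤ M ∧ (∀ v, ‖fderiv ℝ φ v‖ ≤ M) ∧
      ∀ v w, ‖fderiv ℝ φ v - fderiv ℝ φ w‖ ≤ M * ‖v - w‖ := by
  have hc : HasCompactSupport fun v => φ v - 1 := by
    refine HasCompactSupport.of_support_subset_isCompact
      (isCompact_closedBall (0 : EuclideanSpace ℝ (Fin d)) 1) fun v hv => ?_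
    by_contra h
    rw [mem_closedBall_zero_iff, not_le] at h
    exact hv (sub_eq_zero.2 (hφ.eq_one h.le))
  have hs : ContDiff ℝ ((⊤ : ℕ∞) : WithTop ℕ∞) (fderiv ℝ φ) :=
    hφ.smooth.fderiv_right (m := ((⊤ : ℕ∞) : WithTop ℕ∞)) (by simp)
  have hc' : HasCompactSupport (fderiv ℝ φ) := by
    have := hc.fderiv (𝕜 := ℝ)
    rwa [show (fderiv ℝ fun v => φ v - 1) = fderiv ℝ φ from
      funext fun v => fderiv_sub_const 1] at this
  obtain ⟨M₁, hM₁⟩ := hs.continuous.bounded_above_of_compact_support hc'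
  obtain ⟨M₂, hM₂⟩ := ContDiff.lipschitzWith_of_hasCompactSupport hc' hs (by simp)
  refine ⟨max M₁ M₂, le_max_of_le_right M₂.2, fun v => (hM₁ v).trans (le_max_left _ _),
    fun v w => ?_⟩
  have := hM₂.dist_le_mul v w
  rw [dist_eq_norm, dist_eq_norm] at this
  exact this.trans (by gcongr; exact le_max_right _ _)

theorem IsSmoothCutoff.hasDerivAt (hφ : IsSmoothCutoff φ) (z : EuclideanSpace ℝ (Fin d))
    (s : ℝ) : HasDerivAt (fun s : ℝ => φ (s • z)) (fderiv ℝ φ (s • z) z) s := by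
  have h1 : HasFDerivAt φ (fderiv ℝ φ (s • z)) (s • z) :=
    (hφ.smooth.differentiable (by simp) _).hasFDerivAt
  have h2 : HasDerivAt (fun s : ℝ => s • z) z s := by
    simpa using (hasDerivAt_id s).smul_const z
  exact h1.comp_hasDerivAt s h2

/-- The dilates of a smooth cut-off at a point have bounded variation. -/
theorem IsSmoothCutoff.tsum_enorm_sub_le (hφ : IsSmoothCutoff φ) {M : ℝ} (hM : 0 ≤ M)
    (h1 : ∀ v, ‖fderiv ℝ φ v‖ ≤ M) {z : EuclideanSpace ℝ (Fin d)} (hz : z ≠ 0) {s : ℤ → ℝ}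
    (hs : Antitone s) (hs0 : ∀ i, 0 ≤ s i) :
    ∑' i, ‖φ (s i • z) - φ (s (i + 1) • z)‖ₑ ≤ ENNReal.ofReal M := by
  have hz0 : 0 < ‖z‖ := norm_pos_iff.2 hz
  have hlarge : ∀ s, ‖z‖⁻¹ ≤ s → φ (s • z) = 1 := by
    intro s h
    refine hφ.eq_one ?_
    rw [norm_smul, Real.norm_of_nonneg ((by positivity : (0 : ℝ) ≤ ‖z‖⁻¹).trans h)]
    calc 1 = ‖z‖⁻¹ * ‖z‖ := (inv_mul_cancel₀ hz0.ne').symm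
      _ ≤ s * ‖z‖ := by gcongr
  refine (tsum_enorm_sub_le_of_lipschitz (γ := fun s => φ (s • z)) (b := ‖z‖⁻¹)
    (Λ := M * ‖z‖) (by positivity) ?_ ?_ hs hs0 (by positivity)).trans (le_of_eq ?_)
  · intro s hs t ht
    have := (convex_Icc (0 : ℝ) ‖z‖⁻¹).norm_image_sub_le_of_norm_hasDerivWithin_le
      (fun r _ => (hφ.hasDerivAt z r).hasDerivWithinAt)
      (fun r _ => (ContinuousLinearMap.le_opNorm _ _).trans
        (mul_le_mul_of_nonneg_right (h1 (r • z)) (norm_nonneg z))) ht hs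
    simpa using this
  · intro s h
    rw [hlarge s h, hlarge _ le_rfl]
  · rw [mul_assoc, mul_inv_cancel₀ hz0.ne', mul_one]

/-- The variation of the difference of the dilates of a smooth cut-off at two comparable
points. -/
theorem IsSmoothCutoff.tsum_enorm_sub_sub_le (hφ : IsSmoothCutoff φ) {M : ℝ} (hM : 0 ≤ M)
    (h1 : ∀ v, ‖fderiv ℝ φ v‖ ≤ M)
    (h2 : ∀ v w, ‖fderiv ℝ φ v - fderiv ℝ φ w‖ ≤ M * ‖v - w‖)
    {z z' : EuclideanSpace ℝ (Fin d)} (hz : z ≠ 0) (hzz : 2 * ‖z - z'‖ ≤ ‖z‖) {s : ℤ → ℝ}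
    (hs : Antitone s) (hs0 : ∀ i, 0 ≤ s i) :
    ∑' i, ‖(φ (s i • z) - φ (s (i + 1) • z)) - (φ (s i • z') - φ (s (i + 1) • z'))‖ₑ
      ≤ ENNReal.ofReal (10 * M * (‖z - z'‖ / ‖z‖)) := by
  have hz0 : 0 < ‖z‖ := norm_pos_iff.2 hz
  have hz'1 : ‖z‖ ≤ 2 * ‖z'‖ := by
    have := norm_le_norm_add_norm_sub' z z'
    linarith
  have hz'2 : ‖z'‖ ≤ 2 * ‖z‖ := by
    have := norm_le_norm_add_norm_sub z z'
    linarith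
  -- From `s = b` on both dilates equal `1`, because `‖z'‖ ≥ ‖z‖ / 2`.
  set b : ℝ := 2 / ‖z‖ with hb
  have hb0 : 0 < b := by positivity
  have hbz : b * ‖z‖ = 2 := div_mul_cancel₀ _ hz0.ne'
  have hlarge : ∀ w : EuclideanSpace ℝ (Fin d), ‖z‖ ≤ 2 * ‖w‖ → ∀ s, b ≤ s → φ (s • w) = 1 := by
    intro w hw s h
    refine hφ.eq_one ?_
    rw [norm_smul, Real.norm_of_nonneg (hb0.le.trans h)]
    have : b * ‖w‖ ≤ s * ‖w‖ := by gcongr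
    nlinarith
  set Λ : ℝ := M * ‖z - z'‖ + M * (b * ‖z - z'‖) * ‖z'‖ with hΛ
  have hderiv : ∀ s ∈ Set.Icc 0 b,
      ‖fderiv ℝ φ (s • z) z - fderiv ℝ φ (s • z') z'‖ ≤ Λ := by
    intro s hs
    have e : fderiv ℝ φ (s • z) z - fderiv ℝ φ (s • z') z'
        = fderiv ℝ φ (s • z) (z - z') + (fderiv ℝ φ (s • z) - fderiv ℝ φ (s • z')) z' := by
      simp
    rw [e]
    refine (norm_add_le _ _).trans (add_le_add ?_ ?_)
    · exact (ContinuousLinearMap.le_opNorm _ _).trans (by gcongr; exact h1 _)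
    · refine (ContinuousLinearMap.le_opNorm _ _).trans ?_
      gcongr
      refine (h2 _ _).trans ?_
      rw [← smul_sub, norm_smul, Real.norm_of_nonneg hs.1]
      gcongr
      exact hs.2
  have hre : ∀ i, (φ (s i • z) - φ (s (i + 1) • z)) - (φ (s i • z') - φ (s (i + 1) • z'))
      = (fun s : ℝ => φ (s • z) - φ (s • z')) (s i)
        - (fun s : ℝ => φ (s • z) - φ (s • z')) (s (i + 1)) := fun i => by
    simp only; ring
  simp_rw [hre]
  refine (tsum_enorm_sub_le_of_lipschitz (γ := fun s => φ (s • z) - φ (s • z')) (b := b)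
    (Λ := Λ) hb0.le ?_ ?_ hs hs0 (by positivity)).trans (ENNReal.ofReal_le_ofReal ?_)
  · intro s hs t ht
    have := (convex_Icc (0 : ℝ) b).norm_image_sub_le_of_norm_hasDerivWithin_le
      (fun r _ => ((hφ.hasDerivAt z r).sub (hφ.hasDerivAt z' r)).hasDerivWithinAt) hderiv ht hs
    simpa using this
  · intro s h
    rw [hlarge z (by linarith) s h, hlarge z' hz'1 s h, hlarge z (by linarith) b le_rfl,
      hlarge z' hz'1 b le_rfl]
  · have e1 : Λ * b = M * (‖z - z'‖ * b) + M * (‖z - z'‖ * b) * (b * ‖z'‖) := by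
      rw [hΛ]; ring
    -- With `τ = ‖z - z'‖ / ‖z‖` one has `‖z - z'‖ * b = 2 τ`, hence `Λ * b ≤ 2 M τ + 2 M τ * 4 = 10
    -- M τ`.
    have e2 : b * ‖z'‖ ≤ 4 := by nlinarith
    have e3 : 0 ≤ M * (‖z - z'‖ * b) := by positivity
    have e4 : ‖z - z'‖ / ‖z‖ = ‖z - z'‖ * b / 2 := by
      rw [hb]; field_simp
    rw [e1, e4]
    nlinarith

variable {ω : ℝ → ℝ} {A : ℝ} {K : EuclideanSpace ℝ (Fin d) → EuclideanSpace ℝ (Fin d) → ℂ}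

/-- The increment of the truncated kernels along the sequence `ε`. -/
def kernelIncrement (φ : EuclideanSpace ℝ (Fin d) → ℝ)
    (K : EuclideanSpace ℝ (Fin d) → EuclideanSpace ℝ (Fin d) → ℂ) (ε : ℤ → ℝ) (i : ℤ)
    (x y : EuclideanSpace ℝ (Fin d)) : ℂ :=
  (φ ((ε i)⁻¹ • (x - y)) : ℂ) * K x y - (φ ((ε (i + 1))⁻¹ • (x - y)) : ℂ) * K x y

/-- Product rule for differences: a change of `K` is weighted by the total variation of the cut-off
at one point, and gives `ω`; a change of the cut-off is weighted by the size of `K`, and gives the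
linear term. Summing in `i` before integrating is what makes the bound independent of the sequence.
-/
theorem tsum_enorm_kernelIncrement_sub_le (hφ : IsSmoothCutoff φ) {M : ℝ} (hM : 0 ≤ M)
    (h1 : ∀ v, ‖fderiv ℝ φ v‖ ≤ M)
    (h2 : ∀ v w, ‖fderiv ℝ φ v - fderiv ℝ φ w‖ ≤ M * ‖v - w‖)
    (hω : IsModulusOfContinuity ω) (hK : IsCZKernel ω A K)
    {ε : ℤ → ℝ} (hε : Monotone ε) (hpos : ∀ i, 0 < ε i)
    {x x' y : EuclideanSpace ℝ (Fin d)} (hx : 0 < ‖x - x'‖) (hxy : 2 * ‖x - x'‖ < ‖x - y‖) :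
    ∑' i, ‖kernelIncrement φ K ε i x y - kernelIncrement φ K ε i x' y‖ₑ
      ≤ ENNReal.ofReal (10 * 2 ^ d * M * |A| *
        (ω (‖x - x'‖ / ‖x - y‖) + ‖x - x'‖ / ‖x - y‖) / ‖x - y‖ ^ d) := by
  set r := ‖x - y‖ with hr
  have hr0 : 0 < r := by linarith
  have hzz : (x - y) - (x' - y) = x - x' := by abel
  have hr' : r ≤ 2 * ‖x' - y‖ := by
    have := norm_le_norm_add_norm_sub' (x - y) (x' - y)
    rw [hzz] at this
    linarith
  have hxy0 : x - y ≠ 0 := norm_pos_iff.1 hr0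
  have hx'y : x' ≠ y := by
    rintro rfl
    simp at hr'
    linarith
  have hA : 0 ≤ A := hK.const_nonneg hx'y
  set ψ : ℤ → EuclideanSpace ℝ (Fin d) → ℝ :=
    fun i z => φ ((ε i)⁻¹ • z) - φ ((ε (i + 1))⁻¹ • z) with hψ
  have hs : Antitone fun i => (ε i)⁻¹ := fun i j h => inv_anti₀ (hpos i) (hε h)
  have hs0 : ∀ i, 0 ≤ (ε i)⁻¹ := fun i => (inv_pos.2 (hpos i)).le
  have hω0 : 0 ≤ ω (‖x - x'‖ / r) := hω.nonneg (by positivity)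
  have hterm : ∀ i, ‖kernelIncrement φ K ε i x y - kernelIncrement φ K ε i x' y‖ₑ
      ≤ ‖ψ i (x - y)‖ₑ * ENNReal.ofReal (A * ω (‖x - x'‖ / r) / r ^ d)
        + ‖ψ i (x - y) - ψ i (x' - y)‖ₑ * ENNReal.ofReal (2 ^ d * A / r ^ d) := by
    intro i
    have e : kernelIncrement φ K ε i x y - kernelIncrement φ K ε i x' y
        = (ψ i (x - y) : ℂ) * (K x y - K x' y)
          + ((ψ i (x - y) - ψ i (x' - y) : ℝ) : ℂ) * K x' y := by
      simp only [kernelIncrement, hψ]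
      push_cast
      ring
    rw [e]
    refine (enorm_add_le _ _).trans (add_le_add ?_ ?_)
    · rw [enorm_mul]
      have e1 : ‖((ψ i (x - y) : ℝ) : ℂ)‖ₑ = ‖ψ i (x - y)‖ₑ := by
        rw [← ofReal_norm, Complex.norm_real, ofReal_norm]
      rw [e1, ← ofReal_norm (K x y - K x' y)]
      gcongr
      exact (le_add_of_nonneg_right (norm_nonneg _)).trans (hK.regularity x x' y hx hxy)
    · rw [enorm_mul]
      have e1 : ‖((ψ i (x - y) - ψ i (x' - y) : ℝ) : ℂ)‖ₑ = ‖ψ i (x - y) - ψ i (x' - y)‖ₑ := by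
        rw [← ofReal_norm, Complex.norm_real, ofReal_norm]
      rw [e1, ← ofReal_norm (K x' y)]
      gcongr
      refine (hK.size x' y hx'y).trans ?_
      calc A / ‖x' - y‖ ^ d ≤ A / (r / 2) ^ d := by
            gcongr
            linarith
        _ = 2 ^ d * A / r ^ d := by
            rw [div_pow]; field_simp
  refine (ENNReal.tsum_le_tsum hterm).trans ?_
  rw [ENNReal.tsum_add, ENNReal.tsum_mul_right, ENNReal.tsum_mul_right]
  have b1 := hφ.tsum_enorm_sub_le hM h1 hxy0 hs hs0
  have b2 := hφ.tsum_enorm_sub_sub_le hM h1 h2 (z' := x' - y) hxy0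
    (by rw [hzz]; exact hxy.le) hs hs0
  rw [hzz] at b2
  refine (add_le_add (mul_le_mul_left b1 _) (mul_le_mul_left b2 _)).trans ?_
  rw [← ENNReal.ofReal_mul hM, ← ENNReal.ofReal_mul (by positivity),
    ← ENNReal.ofReal_add (by positivity) (by positivity), abs_of_nonneg hA]
  refine ENNReal.ofReal_le_ofReal ?_
  have h2d : (1 : ℝ) ≤ 2 ^ d := one_le_pow₀ one_le_two
  have e1 : 0 ≤ M * (A * ω (‖x - x'‖ / r) / r ^ d) := by positivity
  have e2 : 10 * 2 ^ d * M * A * (ω (‖x - x'‖ / r) + ‖x - x'‖ / r) / r ^ d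
      = 10 * 2 ^ d * (M * (A * ω (‖x - x'‖ / r) / r ^ d))
        + 10 * M * (‖x - x'‖ / r) * (2 ^ d * A / r ^ d) := by ring
  rw [e2]
  exact add_le_add (le_mul_of_one_le_left e1 (by linarith)) le_rfl

end Cutoff

/-! ### Comparison of truncations at nearby points. -/

section Comparison

variable {d : ℕ} {φ : EuclideanSpace ℝ (Fin d) → ℝ} {ω : ℝ → ℝ} {A : ℝ}
  {K : EuclideanSpace ℝ (Fin d) → EuclideanSpace ℝ (Fin d) → ℂ}

/-- The points `x`, `x'` are at most `ρ / 4` apart, while `‖x - y‖ ≥ 2 ^ k ρ - ρ / 8 ≥ 2 ^ k ρ / 2`.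
Thus the ratio of distances is at most `2 ^ (-k)`, and the halved distance turns `2 ^ d` into `4 ^
d`. -/
theorem tsum_enorm_kernelIncrement_sub_le_of_annulus (hφ : IsSmoothCutoff φ) {M : ℝ}
    (hM : 0 ≤ M) (h1 : ∀ v, ‖fderiv ℝ φ v‖ ≤ M)
    (h2 : ∀ v w, ‖fderiv ℝ φ v - fderiv ℝ φ w‖ ≤ M * ‖v - w‖)
    (hω : IsModulusOfContinuity ω) (hK : IsCZKernel ω A K)
    {ε : ℤ → ℝ} (hε : Monotone ε) (hpos : ∀ i, 0 < ε i)
    {x x' y c : EuclideanSpace ℝ (Fin d)} {ρ : ℝ} (hρ : 0 < ρ) (hx : ‖x - c‖ ≤ ρ / 8)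
    (hx' : ‖x' - c‖ ≤ ρ / 8) (hne : x ≠ x') {k : ℕ} (hk : 2 ^ k * ρ ≤ ‖y - c‖) :
    ∑' i, ‖kernelIncrement φ K ε i x y - kernelIncrement φ K ε i x' y‖ₑ
      ≤ ENNReal.ofReal (10 * 4 ^ d * M * |A|) *
        ENNReal.ofReal (ω (2 ^ (-(k : ℤ))) + 2 ^ (-(k : ℤ))) /
          ENNReal.ofReal ((2 ^ k * ρ) ^ d) := by
  have hpow : (1 : ℝ) ≤ 2 ^ k := one_le_pow₀ one_le_two
  have hkρ : ρ ≤ 2 ^ k * ρ := le_mul_of_one_le_left hρ.le hpow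
  have hxx0 : 0 < ‖x - x'‖ := norm_pos_iff.2 (sub_ne_zero.2 hne)
  have hxx : ‖x - x'‖ ≤ ρ / 4 := by
    have := norm_sub_le (x - c) (x' - c)
    rw [sub_sub_sub_cancel_right] at this
    linarith
  have hr : 2 ^ k * ρ - ρ / 8 ≤ ‖x - y‖ := by
    have := norm_sub_le (x - c) (x - y)
    rw [sub_sub_sub_cancel_left] at this
    linarith
  have hr0 : 0 < ‖x - y‖ := by linarith
  have hratio : ‖x - x'‖ / ‖x - y‖ ≤ 2 ^ (-(k : ℤ)) := by
    rw [div_le_iff₀ hr0, zpow_neg, zpow_natCast, ← div_eq_inv_mul, le_div_iff₀ (by positivity)]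
    nlinarith
  refine (tsum_enorm_kernelIncrement_sub_le hφ hM h1 h2 hω hK hε hpos hxx0
    (by linarith)).trans ?_
  rw [← ENNReal.ofReal_mul (by positivity), ← ENNReal.ofReal_div_of_pos (by positivity)]
  refine ENNReal.ofReal_le_ofReal ?_
  have hω1 : ω (‖x - x'‖ / ‖x - y‖) ≤ ω (2 ^ (-(k : ℤ))) :=
    hω.mono (by simp only [Set.mem_Ici]; positivity) (by simp only [Set.mem_Ici]; positivity)
      hratio
  have hω0 : 0 ≤ ω (‖x - x'‖ / ‖x - y‖) := hω.nonneg (by positivity)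
  calc 10 * 2 ^ d * M * |A| * (ω (‖x - x'‖ / ‖x - y‖) + ‖x - x'‖ / ‖x - y‖) / ‖x - y‖ ^ d
      ≤ 10 * 2 ^ d * M * |A| * (ω (2 ^ (-(k : ℤ))) + 2 ^ (-(k : ℤ))) / (2 ^ k * ρ / 2) ^ d := by
        have := hω0.trans hω1
        gcongr
        linarith
    _ = 10 * 4 ^ d * M * |A| * (ω (2 ^ (-(k : ℤ))) + 2 ^ (-(k : ℤ))) / (2 ^ k * ρ) ^ d := by
        rw [div_pow, show (4 : ℝ) = 2 * 2 by norm_num, mul_pow 2 2 d]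
        field_simp

/-- The variation of the truncations of a function that vanishes near two points varies little
between them. -/
theorem variationAlong_smoothTruncation_le (hφ : IsSmoothCutoff φ) {M : ℝ}
    (hM : 0 ≤ M) (h1 : ∀ v, ‖fderiv ℝ φ v‖ ≤ M)
    (h2 : ∀ v w, ‖fderiv ℝ φ v - fderiv ℝ φ w‖ ≤ M * ‖v - w‖)
    (hω : IsModulusOfContinuity ω) (hD : DiniCondition ω) (hK : IsCZKernel ω A K) {q : ℝ}
    (hq : 1 ≤ q) {ε : ℤ → ℝ} (hε : Monotone ε) (hpos : ∀ i, 0 < ε i)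
    {x x' c : EuclideanSpace ℝ (Fin d)} {ρ : ℝ} (hρ : 0 < ρ) (hx : ‖x - c‖ ≤ ρ / 8)
    (hx' : ‖x' - c‖ ≤ ρ / 8) {f : EuclideanSpace ℝ (Fin d) → ℂ} (hf : Integrable f)
    (hf0 : ∀ y ∈ Metric.closedBall c ρ, f y = 0) {α : ℝ≥0∞}
    (hα : ∀ k : ℕ, ∫⁻ y in Metric.closedBall c (2 ^ (k + 1) * ρ), ‖f y‖ₑ
      ≤ ENNReal.ofReal ((2 ^ k * ρ) ^ d) * α) :
    variationAlong q (fun t => smoothTruncation φ K t f x) ε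
      ≤ variationAlong q (fun t => smoothTruncation φ K t f x') ε
        + ENNReal.ofReal (10 * 4 ^ d * M * |A|)
          * (∑' k : ℕ, ENNReal.ofReal (ω (2 ^ (-(k : ℤ))) + 2 ^ (-(k : ℤ)))) * α := by
  rcases eq_or_ne x x' with rfl | hne
  · exact le_self_add
  have hsplit : (fun t => smoothTruncation φ K t f x)
      = fun t => smoothTruncation φ K t f x'
        + (smoothTruncation φ K t f x - smoothTruncation φ K t f x') := by
    funext t; ring
  rw [hsplit]
  refine (variationAlong_add_le hq _ _ ε).trans (add_le_add le_rfl ?_)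
  refine (variationAlong_le_tsum hq _ ε).trans ?_
  set B := ENNReal.ofReal (10 * 4 ^ d * M * |A|)
  set σ : ℕ → ℝ≥0∞ := fun k => ENNReal.ofReal (ω (2 ^ (-(k : ℤ))) + 2 ^ (-(k : ℤ))) with hσ
  have hcont : ∀ i z, Continuous (kernelIncrement φ K ε i z) := fun i z =>
    (continuous_truncatedKernel_right hφ hK hω hD (hpos i) z).sub
      (continuous_truncatedKernel_right hφ hK hω hD (hpos (i + 1)) z)
  have hinc : ∀ i z, smoothTruncation φ K (ε i) f z - smoothTruncation φ K (ε (i + 1)) f z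
      = ∫ y, kernelIncrement φ K ε i z y * f y := by
    intro i z
    rw [smoothTruncation, smoothTruncation, ← integral_sub
      (integrable_truncatedKernel_mul hφ hK hω hD (hpos i) hf z)
      (integrable_truncatedKernel_mul hφ hK hω hD (hpos (i + 1)) hf z)]
    simp only [kernelIncrement, sub_mul]
  have hint : ∀ i z, Integrable fun y => kernelIncrement φ K ε i z y * f y := by
    intro i z
    refine ((integrable_truncatedKernel_mul hφ hK hω hD (hpos i) hf z).sub
      (integrable_truncatedKernel_mul hφ hK hω hD (hpos (i + 1)) hf z)).congr
      (Filter.Eventually.of_forall fun y => ?_)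
    simp only [kernelIncrement, sub_mul, Pi.sub_apply]
  have hterm : ∀ i, ‖(smoothTruncation φ K (ε i) f x - smoothTruncation φ K (ε i) f x')
      - (smoothTruncation φ K (ε (i + 1)) f x - smoothTruncation φ K (ε (i + 1)) f x')‖ₑ
      ≤ ∫⁻ y, ‖kernelIncrement φ K ε i x y - kernelIncrement φ K ε i x' y‖ₑ * ‖f y‖ₑ := by
    intro i
    rw [sub_sub_sub_comm, hinc, hinc, ← integral_sub (hint i x) (hint i x')]
    refine (enorm_integral_le_lintegral_enorm _).trans (le_of_eq (lintegral_congr fun y => ?_))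
    rw [← sub_mul, enorm_mul]
  have hpoint : ∀ y, (∑' i, ‖kernelIncrement φ K ε i x y - kernelIncrement φ K ε i x' y‖ₑ)
        * ‖f y‖ₑ
      ≤ ∑' k : ℕ, B * σ k / ENNReal.ofReal ((2 ^ k * ρ) ^ d) *
        (Metric.closedBall c (2 ^ (k + 1) * ρ)).indicator (fun y => ‖f y‖ₑ) y := by
    intro y
    by_cases hy : y ∈ Metric.closedBall c ρ
    · simp [hf0 y hy]
    rw [mem_closedBall_iff_norm, not_le] at hy
    -- Of the sum over `k` only the dyadic annulus containing `y` is kept.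
    obtain ⟨k, hk1, hk2⟩ := exists_nat_pow_near (x := ‖y - c‖ / ρ) (y := (2 : ℝ))
      (by rw [le_div_iff₀ hρ]; linarith) one_lt_two
    rw [le_div_iff₀ hρ] at hk1
    rw [div_lt_iff₀ hρ] at hk2
    refine le_trans ?_ (ENNReal.le_tsum k)
    rw [Set.indicator_of_mem (mem_closedBall_iff_norm.2 hk2.le)]
    exact mul_le_mul_left (tsum_enorm_kernelIncrement_sub_le_of_annulus hφ hM h1 h2 hω hK hε hpos
      hρ hx hx' hne hk1) _
  calc ∑' i, ‖(smoothTruncation φ K (ε i) f x - smoothTruncation φ K (ε i) f x')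
      - (smoothTruncation φ K (ε (i + 1)) f x - smoothTruncation φ K (ε (i + 1)) f x')‖ₑ
      ≤ ∑' i, ∫⁻ y, ‖kernelIncrement φ K ε i x y - kernelIncrement φ K ε i x' y‖ₑ * ‖f y‖ₑ :=
        ENNReal.tsum_le_tsum hterm
    _ = ∫⁻ y, (∑' i, ‖kernelIncrement φ K ε i x y - kernelIncrement φ K ε i x' y‖ₑ)
          * ‖f y‖ₑ := by
        rw [← lintegral_tsum]
        · simp_rw [ENNReal.tsum_mul_right]
        · exact fun i => ((hcont i x).sub (hcont i x')).enorm.measurable.aemeasurable.mul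
            hf.aestronglyMeasurable.enorm
    _ ≤ ∫⁻ y, ∑' k : ℕ, B * σ k / ENNReal.ofReal ((2 ^ k * ρ) ^ d) *
        (Metric.closedBall c (2 ^ (k + 1) * ρ)).indicator (fun y => ‖f y‖ₑ) y :=
        lintegral_mono hpoint
    _ = ∑' k : ℕ, B * σ k / ENNReal.ofReal ((2 ^ k * ρ) ^ d) *
        ∫⁻ y in Metric.closedBall c (2 ^ (k + 1) * ρ), ‖f y‖ₑ := by
        have hm : ∀ k : ℕ, AEMeasurable
            ((Metric.closedBall c (2 ^ (k + 1) * ρ)).indicator fun y => ‖f y‖ₑ) :=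
          fun k => hf.aestronglyMeasurable.enorm.indicator Metric.isClosed_closedBall.measurableSet
        rw [lintegral_tsum fun k => (hm k).const_mul _]
        refine tsum_congr fun k => ?_
        rw [lintegral_const_mul'' _ (hm k),
          lintegral_indicator Metric.isClosed_closedBall.measurableSet]
    _ ≤ ∑' k : ℕ, B * σ k * α := by
        refine ENNReal.tsum_le_tsum fun k => (mul_le_mul_right (hα k) _).trans (le_of_eq ?_)
        have h0 : ENNReal.ofReal ((2 ^ k * ρ) ^ d) ≠ 0 := by
          rw [Ne, ENNReal.ofReal_eq_zero, not_le]
          positivity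
        rw [← mul_assoc, ENNReal.div_mul_cancel h0 ENNReal.ofReal_ne_top]
    _ = B * (∑' k, σ k) * α := by
        rw [ENNReal.tsum_mul_right, ENNReal.tsum_mul_left]

/-- If `ω 1 = 0` then `ω` vanishes on `[0, 1]`, and `K x y` is unchanged when `x` moves by less than
half of its distance to `y`. Moving away from `y` by successive factors `4/3` reaches infinity,
where the size bound decays because `d > 0`; so `K` vanishes off the diagonal. -/
theorem smoothVariation_eq_zero (hφ : IsSmoothCutoff φ) (hω : IsModulusOfContinuity ω)
    (hK : IsCZKernel ω A K) (hd : 0 < d) (hω1 : ω 1 = 0) {q : ℝ} (hq : 0 < q)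
    (f : EuclideanSpace ℝ (Fin d) → ℂ) (x : EuclideanSpace ℝ (Fin d)) :
    smoothVariation q φ K f x = 0 := by
  have hconst : ∀ x x' y, 0 < ‖x - x'‖ → 2 * ‖x - x'‖ < ‖x - y‖ → K x y = K x' y := by
    intro x x' y h h'
    have hω0 : ω (‖x - x'‖ / ‖x - y‖) = 0 := by
      have h01 : ‖x - x'‖ / ‖x - y‖ ≤ 1 := by
        rw [div_le_one (by linarith)]
        linarith
      refine le_antisymm (hω1 ▸ hω.mono ?_ ?_ h01) (hω.nonneg (by positivity))
      · simp only [Set.mem_Ici]; positivity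
      · simp
    have := hK.regularity x x' y h h'
    rw [hω0, mul_zero, zero_div] at this
    have h3 := norm_nonneg (K y x - K y x')
    exact sub_eq_zero.1 (norm_le_zero_iff.1 (by linarith))
  have hzero : ∀ x y, x ≠ y → K x y = 0 := by
    intro x y hxy
    have hr : 0 < ‖x - y‖ := norm_pos_iff.2 (sub_ne_zero.2 hxy)
    have hn : ∀ n : ℕ, K x y = K (y + ((4 : ℝ) / 3) ^ n • (x - y)) y := by
      intro n
      induction n with
      | zero => simp
      | succ n ih =>
        rw [ih]
        have e1 : (y + ((4 : ℝ) / 3) ^ n • (x - y)) - (y + ((4 : ℝ) / 3) ^ (n + 1) • (x - y))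
            = (-(((4 : ℝ) / 3) ^ n / 3)) • (x - y) := by
          rw [add_sub_add_left_eq_sub, ← sub_smul]
          congr 1
          ring
        have e2 : (y + ((4 : ℝ) / 3) ^ n • (x - y)) - y = ((4 : ℝ) / 3) ^ n • (x - y) := by
          abel
        have hp : (0 : ℝ) < (4 / 3) ^ n * ‖x - y‖ := by positivity
        apply hconst
        · rw [e1, norm_smul, norm_neg, Real.norm_of_nonneg (by positivity)]
          positivity
        · rw [e1, e2, norm_smul, norm_smul, norm_neg, Real.norm_of_nonneg (by positivity),
            Real.norm_of_nonneg (by positivity)]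
          linarith
    have hlim : Filter.Tendsto (fun n : ℕ => A / (((4 : ℝ) / 3) ^ n * ‖x - y‖) ^ d)
        Filter.atTop (nhds 0) := by
      refine Filter.Tendsto.const_div_atTop ?_ A
      refine (Filter.tendsto_pow_atTop hd.ne').comp ?_
      exact (tendsto_pow_atTop_atTop_of_one_lt (by norm_num)).atTop_mul_const hr
    have hle : ∀ n : ℕ, ‖K x y‖ ≤ A / (((4 : ℝ) / 3) ^ n * ‖x - y‖) ^ d := by
      intro n
      have hne : ((4 : ℝ) / 3) ^ n • (x - y) ≠ 0 :=
        smul_ne_zero (by positivity) (sub_ne_zero.2 hxy)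
      rw [hn n]
      refine (hK.size _ _ fun h => hne (by simpa using h)).trans (le_of_eq ?_)
      rw [add_sub_cancel_left, norm_smul, Real.norm_of_nonneg (by positivity)]
    exact norm_le_zero_iff.1 (ge_of_tendsto' hlim hle)
  have htrunc : ∀ ε > 0, smoothTruncation φ K ε f x = 0 := by
    intro ε hε
    rw [smoothTruncation, ← integral_zero (EuclideanSpace ℝ (Fin d)) ℂ]
    congr 1
    funext y
    rcases eq_or_ne x y with rfl | h
    · rw [hφ.eq_zero_smul hε (by simpa using hε)]
      simp
    · simp [hzero x y h]
  refine le_antisymm ?_ zero_le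
  refine iSup_le fun ε => iSup_le fun _ => iSup_le fun hpos => ?_
  simp only [htrunc _ (hpos _), sub_self, enorm_zero, ENNReal.zero_rpow_of_pos hq, tsum_zero]
  rw [ENNReal.zero_rpow_of_pos (by positivity)]

end Comparison

/-! ### Balls around dyadic cubes. -/

theorem norm_sub_le_of_forall_abs_le {d : ℕ} {x c : EuclideanSpace ℝ (Fin d)} {s : ℝ}
    (hs : 0 ≤ s) (h : ∀ i, |x i - c i| ≤ s) : ‖x - c‖ ≤ d * s := by
  rw [EuclideanSpace.norm_eq]
  refine Real.sqrt_le_iff.2 ⟨by positivity, ?_⟩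
  calc ∑ i, ‖(x - c) i‖ ^ 2 ≤ ∑ _i : Fin d, s ^ 2 := by
        refine Finset.sum_le_sum fun i _ => ?_
        have := h i
        rw [PiLp.sub_apply, Real.norm_eq_abs]
        gcongr
    _ = d * s ^ 2 := by simp
    _ ≤ (d : ℝ) ^ 2 * s ^ 2 := by
        gcongr
        exact_mod_cast Nat.le_self_pow two_ne_zero d
    _ = (d * s) ^ 2 := by ring

/-- The lower corner of a dyadic cube. -/
def cubeCorner {d : ℕ} (v : Fin d → ℝ) (R : ℤ × (Fin d → ℤ)) : EuclideanSpace ℝ (Fin d) :=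
  WithLp.toLp 2 fun i => (2 : ℝ) ^ (-R.1) * (R.2 i + (-1) ^ R.1 * v i)

/-- A ball comparable to a dyadic cube, with a large margin around it. -/
def cubeBall {d : ℕ} (v : Fin d → ℝ) (R : ℤ × (Fin d → ℤ)) : Set (EuclideanSpace ℝ (Fin d)) :=
  Metric.closedBall (cubeCorner v R) (8 * (d * (2 : ℝ) ^ (-R.1)))

theorem norm_sub_cubeCorner_le {d : ℕ} {v : Fin d → ℝ} {R : ℤ × (Fin d → ℤ)}
    {x : EuclideanSpace ℝ (Fin d)} (hx : x ∈ dyadicCube v R.1 R.2) :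
    ‖x - cubeCorner v R‖ ≤ d * (2 : ℝ) ^ (-R.1) := by
  refine norm_sub_le_of_forall_abs_le (by positivity) fun i => ?_
  have h := hx i
  simp only [cubeCorner]
  rw [abs_le]
  constructor <;> nlinarith [h.1, h.2, zpow_pos (two_pos (α := ℝ)) (-R.1)]

theorem dyadicCube_subset_cubeBall {d : ℕ} (v : Fin d → ℝ) (R : ℤ × (Fin d → ℤ)) :
    dyadicCube v R.1 R.2 ⊆ cubeBall v R := fun x hx => by
  rw [cubeBall, mem_closedBall_iff_norm]
  have h0 : 0 ≤ d * (2 : ℝ) ^ (-R.1) := by positivity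
  linarith [norm_sub_cubeCorner_le hx]

theorem cubeBall_subset_cubeBall {d : ℕ} {v : Fin d → ℝ} {P R : ℤ × (Fin d → ℤ)}
    (h : R.1 + 1 ≤ P.1) {x : EuclideanSpace ℝ (Fin d)} (hP : x ∈ dyadicCube v P.1 P.2)
    (hR : x ∈ dyadicCube v R.1 R.2) : cubeBall v P ⊆ cubeBall v R := by
  refine Metric.closedBall_subset_closedBall' ?_
  have h2 : (2 : ℝ) ^ (-P.1) ≤ 2 ^ (-R.1) / 2 := by
    calc (2 : ℝ) ^ (-P.1) ≤ 2 ^ (-R.1 - 1) := zpow_le_zpow_right₀ one_le_two (by omega)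
      _ = 2 ^ (-R.1) / 2 := by rw [zpow_sub_one₀ two_ne_zero]; rfl
  have h3 : (d : ℝ) * 2 ^ (-P.1) ≤ d * 2 ^ (-R.1) / 2 := by
    rw [mul_div_assoc]; gcongr
  have h4 := dist_triangle_left (cubeCorner v P) (cubeCorner v R) x
  rw [dist_eq_norm x, dist_eq_norm x] at h4
  linarith [norm_sub_cubeCorner_le hP, norm_sub_cubeCorner_le hR,
    (by positivity : (0 : ℝ) ≤ d * 2 ^ (-R.1))]

theorem exists_mul_two_zpow_neg_lt (c : ℝ) {η : ℝ} (hη : 0 < η) (j₀ : ℤ) :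
    ∃ N : ℤ, j₀ ≤ N ∧ ∀ j, N ≤ j → c * (2 : ℝ) ^ (-j) < η := by
  obtain ⟨n, hn⟩ := pow_unbounded_of_one_lt (|c| / η) (one_lt_two (α := ℝ))
  refine ⟨max j₀ n, le_max_left _ _, fun j hj => ?_⟩
  have h1 : (2 : ℝ) ^ n ≤ 2 ^ j := by
    rw [← zpow_natCast]
    exact zpow_le_zpow_right₀ one_le_two ((le_max_right _ _).trans hj)
  have h2 : (0 : ℝ) < 2 ^ j := by positivity
  rw [zpow_neg, ← div_eq_mul_inv, div_lt_iff₀ h2]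
  rw [div_lt_iff₀ hη] at hn
  calc c ≤ |c| := le_abs_self c
    _ < 2 ^ n * η := hn
    _ ≤ η * 2 ^ j := by rw [mul_comm]; gcongr

/-! ### Stopping cubes and their sparseness. -/

section Stopping

variable {d : ℕ} {v : Fin d → ℝ}

/-- The stopping children of `R`: the maximal proper dyadic subcubes of which the exceptional set
`E R` occupies a substantial part. -/
def stoppingChildren (v : Fin d → ℝ) (E : ℤ × (Fin d → ℤ) → Set (EuclideanSpace ℝ (Fin d)))
    (R : ℤ × (Fin d → ℤ)) : Set (ℤ × (Fin d → ℤ)) :=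
  maximalCubes v (R.1 + 1) fun j m => dyadicCube v j m ⊆ dyadicCube v R.1 R.2 ∧
    cubeVolume d j < 2 ^ (d + 1) * volume (dyadicCube v j m ∩ E R)

/-- The family of the iterated stopping children of `R₀`. -/
inductive IsStoppingCube (v : Fin d → ℝ)
    (E : ℤ × (Fin d → ℤ) → Set (EuclideanSpace ℝ (Fin d))) (R₀ : ℤ × (Fin d → ℤ)) :
    ℤ × (Fin d → ℤ) → Prop
  | top : IsStoppingCube v E R₀ R₀
  | child {R P : ℤ × (Fin d → ℤ)} : IsStoppingCube v E R₀ R → P ∈ stoppingChildren v E R →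
      IsStoppingCube v E R₀ P

variable {E : ℤ × (Fin d → ℤ) → Set (EuclideanSpace ℝ (Fin d))} {R₀ : ℤ × (Fin d → ℤ)}

theorem stoppingChildren_level {R P : ℤ × (Fin d → ℤ)} (h : P ∈ stoppingChildren v E R) :
    R.1 + 1 ≤ P.1 := h.1

theorem stoppingChildren_subset {R P : ℤ × (Fin d → ℤ)} (h : P ∈ stoppingChildren v E R) :
    dyadicCube v P.1 P.2 ⊆ dyadicCube v R.1 R.2 := h.2.1.1

theorem IsStoppingCube.level_le {R : ℤ × (Fin d → ℤ)} (h : IsStoppingCube v E R₀ R) :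
    R₀.1 ≤ R.1 := by
  induction h with
  | top => exact le_rfl
  | child _ hP ih => have := stoppingChildren_level hP; omega

theorem eq_of_mem_of_level_eq {R R' : ℤ × (Fin d → ℤ)} {x : EuclideanSpace ℝ (Fin d)}
    (hx : x ∈ dyadicCube v R.1 R.2) (hx' : x ∈ dyadicCube v R'.1 R'.2) (h : R.1 = R'.1) :
    R = R' := by
  refine Prod.ext h ?_
  rw [← mem_dyadicCube_iff.1 hx, ← mem_dyadicCube_iff.1 hx', h]

/-- The stopping cubes form a tree: a stopping cube strictly finer than `R` and meeting it at `x`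
lies below a stopping child of `R`. The induction is on the depth of the finer cube, through the
stopping cube `S` of which it is a child. -/
theorem IsStoppingCube.exists_child {n : ℕ} {R R' : ℤ × (Fin d → ℤ)}
    (hn : R'.1 ≤ R₀.1 + n) (hR : IsStoppingCube v E R₀ R) (hR' : IsStoppingCube v E R₀ R')
    {x : EuclideanSpace ℝ (Fin d)} (hx : x ∈ dyadicCube v R.1 R.2)
    (hx' : x ∈ dyadicCube v R'.1 R'.2) (hlt : R.1 < R'.1) :
    ∃ P ∈ stoppingChildren v E R, x ∈ dyadicCube v P.1 P.2 ∧ P.1 ≤ R'.1 := by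
  induction n using Nat.strong_induction_on generalizing R R' with
  | _ n ih =>
    cases hR' with
    | top => exact absurd hR.level_le (by omega)
    | @child S _ hS hR'S =>
      have hxS := stoppingChildren_subset hR'S hx'
      have hlev := stoppingChildren_level hR'S
      have hS0 := hS.level_le
      have hR0 := hR.level_le
      rcases lt_trichotomy R.1 S.1 with h | h | h
      · obtain ⟨P, hP, hxP, hPl⟩ := ih (S.1 - R₀.1).toNat (by omega) (by omega) hR hS hx hxS h
        exact ⟨P, hP, hxP, by omega⟩
      · obtain rfl := eq_of_mem_of_level_eq hx hxS h
        exact ⟨R', hR'S, hx', le_rfl⟩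
      -- If `R` were strictly between `S` and `R'`, the child of `S` through `x` would be no finer
      -- than `R`; but by maximality this child is `R'`.
      · obtain ⟨P, hP, hxP, hPl⟩ := ih (R.1 - R₀.1).toNat (by omega) (by omega) hS hR hxS hx h
        have := maximalCubes_eq_of_mem hP hR'S hxP hx'
        rw [this] at hPl
        omega

/-- The part of a stopping cube outside of its stopping children. -/
def stoppingCore (v : Fin d → ℝ) (E : ℤ × (Fin d → ℤ) → Set (EuclideanSpace ℝ (Fin d)))
    (R : ℤ × (Fin d → ℤ)) : Set (EuclideanSpace ℝ (Fin d)) :=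
  dyadicCube v R.1 R.2 \ ⋃ P ∈ stoppingChildren v E R, dyadicCube v P.1 P.2

theorem volume_stoppingChildren_le (R : ℤ × (Fin d → ℤ)) :
    volume (⋃ P ∈ stoppingChildren v E R, dyadicCube v P.1 P.2)
      ≤ 2 ^ (d + 1) * volume (E R) := by
  have h := mul_volume_maximalCubes_le (u := v) (j₀ := R.1 + 1)
    (p := fun j m => dyadicCube v j m ⊆ dyadicCube v R.1 R.2 ∧
      cubeVolume d j < 2 ^ (d + 1) * volume (dyadicCube v j m ∩ E R))
    ((2 ^ (d + 1) : ℝ≥0∞) • volume.restrict (E R)) 1 fun j m hp => by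
      rw [one_mul, volume_dyadicCube, Measure.smul_apply, smul_eq_mul,
        Measure.restrict_apply (measurableSet_dyadicCube v j m)]
      exact hp.2.le
  rwa [one_mul, Measure.smul_apply, smul_eq_mul, Measure.restrict_apply_univ] at h

/-- The family of stopping cubes is sparse. -/
theorem isSparse_stoppingCubes
    (hE : ∀ R, 2 ^ (d + 2) * volume (E R) ≤ cubeVolume d R.1) (R₀ : ℤ × (Fin d → ℤ)) :
    IsSparse v 2 {R | IsStoppingCube v E R₀ R} := by
  refine ⟨stoppingCore v E, fun R _ => ⟨?_, Set.sdiff_subset, ?_⟩, ?_⟩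
  · exact (measurableSet_dyadicCube v _ _).diff
      (MeasurableSet.biUnion (Set.to_countable _) fun P _ => measurableSet_dyadicCube v _ _)
  · set U := ⋃ P ∈ stoppingChildren v E R, dyadicCube v P.1 P.2 with hU
    have h1 : 2 * volume U ≤ cubeVolume d R.1 := by
      calc 2 * volume U ≤ 2 * (2 ^ (d + 1) * volume (E R)) := by
            gcongr; exact volume_stoppingChildren_le R
        _ = 2 ^ (d + 2) * volume (E R) := by rw [pow_succ 2 (d + 1)]; ring
        _ ≤ _ := hE R
    have h2 : volume (dyadicCube v R.1 R.2) ≤ volume (stoppingCore v E R) + volume U := by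
      refine (measure_mono ?_).trans (measure_union_le _ _)
      rw [stoppingCore, Set.sdiff_union_self]
      exact Set.subset_union_left
    rw [volume_dyadicCube] at h2 ⊢
    have h3 : cubeVolume d R.1 + cubeVolume d R.1
        ≤ 2 * volume (stoppingCore v E R) + cubeVolume d R.1 := by
      calc cubeVolume d R.1 + cubeVolume d R.1 = 2 * cubeVolume d R.1 := (two_mul _).symm
        _ ≤ 2 * (volume (stoppingCore v E R) + volume U) := by gcongr
        _ = 2 * volume (stoppingCore v E R) + 2 * volume U := mul_add _ _ _
        _ ≤ _ := by gcongr
    exact (ENNReal.add_le_add_iff_right (cubeVolume_ne_top d R.1)).1 h3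
  · intro R hR R' hR' hne
    rw [Function.onFun, Set.disjoint_left]
    have key : ∀ {R R' : ℤ × (Fin d → ℤ)}, IsStoppingCube v E R₀ R → IsStoppingCube v E R₀ R' →
        R.1 < R'.1 → ∀ x ∈ stoppingCore v E R, x ∉ dyadicCube v R'.1 R'.2 := by
      intro R R' hR hR' hlt x hx hx'
      have h0 := hR'.level_le
      obtain ⟨P, hP, hxP, -⟩ := IsStoppingCube.exists_child (n := (R'.1 - R₀.1).toNat)
        (by omega) hR hR' hx.1 hx' hlt
      exact hx.2 (Set.mem_biUnion hP hxP)
    intro x hx hx'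
    rcases lt_trichotomy R.1 R'.1 with h | h | h
    · exact key hR hR' h x hx hx'.1
    · exact hne (eq_of_mem_of_level_eq hx.1 hx'.1 h)
    · exact key hR' hR h x hx' hx.1

/-- A stopping child contains a point outside of the exceptional sets of its parent and of
itself. -/
theorem exists_good_point (hv : IsThirds v)
    (hE : ∀ R, 2 ^ (d + 2) * volume (E R) ≤ cubeVolume d R.1) {R P : ℤ × (Fin d → ℤ)}
    (hP : P ∈ stoppingChildren v E R) : ∃ x ∈ dyadicCube v P.1 P.2, x ∉ E R ∧ x ∉ E P := by
  by_contra! hcon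
  obtain ⟨x, hx⟩ := exists_mem_dyadicCube v P.1 P.2
  have hlev := stoppingChildren_level hP
  have hxR := stoppingChildren_subset hP hx
  set m' := dyadicIndex v (P.1 - 1) x with hm'
  -- The dyadic parent of `P` is either `R` itself, where the smallness of `E R` applies, or a
  -- proper subcube of `R`, which violates the stopping condition by maximality of `P`.
  have hpar : 2 ^ (d + 1) * volume (dyadicCube v (P.1 - 1) m' ∩ E R)
      ≤ cubeVolume d (P.1 - 1) := by
    rcases eq_or_lt_of_le hlev with h | h
    · calc 2 ^ (d + 1) * volume (dyadicCube v (P.1 - 1) m' ∩ E R)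
          ≤ 2 ^ (d + 2) * volume (E R) := by
            gcongr
            · exact one_le_two
            · omega
            · exact Set.inter_subset_right
        _ ≤ cubeVolume d (P.1 - 1) := by rw [← h, add_sub_cancel_right]; exact hE R
    · have hsub : dyadicCube v (P.1 - 1) m' ⊆ dyadicCube v R.1 R.2 := by
        rw [← mem_dyadicCube_iff.1 hxR]
        exact hv.dyadicCube_subset (by omega) (mem_dyadicCube_dyadicIndex v _ x)
      have := hP.2.2 x hx (P.1 - 1) (by omega) (by omega)
      exact not_lt.1 fun hlt => this ⟨hsub, hlt⟩
  have hPpar : dyadicCube v P.1 P.2 ⊆ dyadicCube v (P.1 - 1) m' :=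
    hv.dyadicCube_subset (by omega) hx
  have hvol : cubeVolume d (P.1 - 1) = 2 ^ d * cubeVolume d P.1 := by
    simpa using cubeVolume_sub d P.1 1
  have h0 : (2 ^ d : ℝ≥0∞) ≠ 0 := by positivity
  have ht : (2 ^ d : ℝ≥0∞) ≠ ∞ := by finiteness
  have h1 : 2 * volume (dyadicCube v P.1 P.2 ∩ E R) ≤ cubeVolume d P.1 := by
    refine (ENNReal.mul_le_mul_iff_right h0 ht).1 ?_
    rw [← hvol, ← mul_assoc, ← pow_succ]
    exact (mul_le_mul_right (measure_mono (Set.inter_subset_inter_left _ hPpar)) _).trans hpar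
  have h2 : 4 * volume (E P) ≤ cubeVolume d P.1 := by
    refine le_trans ?_ (hE P)
    gcongr
    calc (4 : ℝ≥0∞) = 2 ^ 2 := by norm_num
      _ ≤ 2 ^ (d + 2) := pow_le_pow_right₀ one_le_two (by omega)
  have h3 : cubeVolume d P.1 ≤ volume (dyadicCube v P.1 P.2 ∩ E R) + volume (E P) := by
    rw [← volume_dyadicCube v P.1 P.2]
    refine (measure_mono fun y hy => ?_).trans (measure_union_le _ _)
    by_cases hyR : y ∈ E R
    · exact Or.inl ⟨hy, hyR⟩
    · exact Or.inr (hcon y hy hyR)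
  set V := cubeVolume d P.1 with hV
  -- `E R` covers at most half of `P` and `E P` at most a quarter, so they cannot cover `P`.
  have h4 : 4 * V ≤ 3 * V := by
    calc 4 * V ≤ 4 * (volume (dyadicCube v P.1 P.2 ∩ E R) + volume (E P)) := by gcongr
      _ = 2 * (2 * volume (dyadicCube v P.1 P.2 ∩ E R)) + 4 * volume (E P) := by ring
      _ ≤ 2 * V + V := by gcongr
      _ = 3 * V := by ring
  have h5 := (ENNReal.mul_le_mul_iff_left (cubeVolume_ne_zero d P.1)
    (cubeVolume_ne_top d P.1)).1 h4
  norm_num at h5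

/-- The stopping children of `R` cover the interior of the exceptional set of `R`. -/
theorem exists_stoppingChild_of_isOpen (hv : IsThirds v) {R : ℤ × (Fin d → ℤ)}
    {x : EuclideanSpace ℝ (Fin d)} (hx : x ∈ dyadicCube v R.1 R.2)
    {U : Set (EuclideanSpace ℝ (Fin d))} (hU : IsOpen U) (hxU : x ∈ U) (hUE : U ⊆ E R) :
    ∃ P ∈ stoppingChildren v E R, x ∈ dyadicCube v P.1 P.2 := by
  obtain ⟨η, hη, hball⟩ := Metric.isOpen_iff.1 hU x hxU
  obtain ⟨N, hN, hN'⟩ := exists_mul_two_zpow_neg_lt (2 * d) hη (R.1 + 1)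
  have hxN := mem_dyadicCube_dyadicIndex v N x
  refine hv.exists_maximalCubes hN ⟨?_, ?_⟩
  · rw [← mem_dyadicCube_iff.1 hx]
    exact hv.dyadicCube_subset (by omega) hxN
  · have hsub : dyadicCube v N (dyadicIndex v N x) ⊆ E R := by
      refine fun y hy => hUE (hball ?_)
      rw [mem_ball_iff_norm]
      have h1 := norm_sub_cubeCorner_le (R := (N, dyadicIndex v N x)) hy
      have h2 := norm_sub_cubeCorner_le (R := (N, dyadicIndex v N x)) hxN
      have h3 := norm_sub_le (y - cubeCorner v (N, dyadicIndex v N x))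
        (x - cubeCorner v (N, dyadicIndex v N x))
      rw [sub_sub_sub_cancel_right] at h3
      have h4 := hN' N le_rfl
      linarith
    rw [Set.inter_eq_left.2 hsub, volume_dyadicCube]
    conv_lhs => rw [← one_mul (cubeVolume d N)]
    refine (ENNReal.mul_lt_mul_iff_left (cubeVolume_ne_zero d N) (cubeVolume_ne_top d N)).2 ?_
    exact one_lt_pow₀ ENNReal.one_lt_two (by omega)

end Stopping

/-! ### Localization and exceptional sets. -/

/-- A level above which a function of weak type is large only on a small set. -/
theorem mul_volume_le_of_weakType {α : Type*} [MeasurableSpace α] {μ : Measure α}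
    {h : α → ℝ≥0∞} {W N : ℝ≥0} {I V : ℝ≥0∞} (hI : I ≠ ∞) (hV0 : V ≠ 0)
    (hV : V ≠ ∞) (hweak : ∀ t : ℝ≥0, t * μ {x | (t : ℝ≥0∞) < h x} ≤ W * I) :
    N * μ {x | ((N * (W + 1) : ℝ≥0) : ℝ≥0∞) * (I / V) < h x} ≤ V := by
  rcases eq_or_ne I 0 with rfl | hI0
  -- Here the threshold is zero, and the weak estimates at the levels `1 / (n + 1)` show that `h`
  -- vanishes almost everywhere.
  · have hnull : μ {x | 0 < h x} = 0 := by
      have hset : {x | 0 < h x} ⊆ ⋃ n : ℕ, {x | (((n : ℝ≥0) + 1)⁻¹ : ℝ≥0) < h x} := by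
        intro x hx
        obtain ⟨n, hn⟩ := ENNReal.exists_inv_nat_lt (ne_of_gt hx)
        refine Set.mem_iUnion.2 ⟨n, lt_of_le_of_lt ?_ hn⟩
        rw [ENNReal.coe_inv (by positivity)]
        push_cast
        gcongr
        exact le_self_add
      refine measure_mono_null hset (measure_iUnion_null fun n => ?_)
      have := hweak ((n : ℝ≥0) + 1)⁻¹
      rw [mul_zero, nonpos_iff_eq_zero, mul_eq_zero] at this
      exact this.resolve_left (ENNReal.coe_ne_zero.2 (by positivity))
    rw [ENNReal.zero_div, mul_zero, hnull, mul_zero]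
    exact zero_le
  -- The factor `W + 1` in the level, instead of `W`, can be cancelled even if `W = 0`.
  · set a := I / V with ha
    have ha0 : a ≠ 0 := (ENNReal.div_pos hI0 hV).ne'
    have hat : a ≠ ∞ := ENNReal.div_ne_top hI hV0
    have hc : ((W + 1 : ℝ≥0) : ℝ≥0∞) * a ≠ 0 :=
      mul_ne_zero (by rw [ENNReal.coe_ne_zero]; positivity) ha0
    have hct : ((W + 1 : ℝ≥0) : ℝ≥0∞) * a ≠ ∞ := ENNReal.mul_ne_top ENNReal.coe_ne_top hat
    have ht : ((N * (W + 1) * a.toNNReal : ℝ≥0) : ℝ≥0∞) = ((N * (W + 1) : ℝ≥0) : ℝ≥0∞) * a := by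
      rw [ENNReal.coe_mul, ENNReal.coe_toNNReal hat]
    have := hweak (N * (W + 1) * a.toNNReal)
    rw [ht] at this
    refine (ENNReal.mul_le_mul_iff_right hc hct).1 ?_
    set m := μ {x | ((N * (W + 1) : ℝ≥0) : ℝ≥0∞) * a < h x}
    calc ((W + 1 : ℝ≥0) : ℝ≥0∞) * a * (N * m)
        = ((N * (W + 1) : ℝ≥0) : ℝ≥0∞) * a * m := by push_cast; ring
      _ ≤ W * I := this
      _ ≤ ((W + 1 : ℝ≥0) : ℝ≥0∞) * I := by
          gcongr
          exact le_self_add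
      _ = ((W + 1 : ℝ≥0) : ℝ≥0∞) * a * V := by
          rw [ha, mul_assoc, ENNReal.div_mul_cancel hV0 hV]

section Localization

variable {d : ℕ}

/-- The restriction of `f` to the ball around a dyadic cube. -/
def localized (v : Fin d → ℝ) (f : EuclideanSpace ℝ (Fin d) → ℂ) (R : ℤ × (Fin d → ℤ)) :
    EuclideanSpace ℝ (Fin d) → ℂ :=
  (cubeBall v R).indicator f

/-- The mean of `|f|` near a dyadic cube, normalized by the volume of the cube. -/
def localMean (v : Fin d → ℝ) (f : EuclideanSpace ℝ (Fin d) → ℂ) (R : ℤ × (Fin d → ℤ)) :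
    ℝ≥0∞ :=
  (∫⁻ y in cubeBall v R, ‖f y‖ₑ) / cubeVolume d R.1

theorem measurableSet_cubeBall (v : Fin d → ℝ) (R : ℤ × (Fin d → ℤ)) :
    MeasurableSet (cubeBall v R) := Metric.isClosed_closedBall.measurableSet

theorem integrable_localized {f : EuclideanSpace ℝ (Fin d) → ℂ} (hf : Integrable f)
    (v : Fin d → ℝ) (R : ℤ × (Fin d → ℤ)) : Integrable (localized v f R) :=
  hf.indicator (measurableSet_cubeBall v R)

theorem lintegral_localized (v : Fin d → ℝ) (f : EuclideanSpace ℝ (Fin d) → ℂ)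
    (R : ℤ × (Fin d → ℤ)) :
    ∫⁻ y, ‖localized v f R y‖ₑ = ∫⁻ y in cubeBall v R, ‖f y‖ₑ := by
  rw [← lintegral_indicator (measurableSet_cubeBall v R)]
  simp only [localized, enorm_indicator_eq_indicator_enorm]

variable {φ : EuclideanSpace ℝ (Fin d) → ℝ}
  {K : EuclideanSpace ℝ (Fin d) → EuclideanSpace ℝ (Fin d) → ℂ}

/-- The set where the variation of the localized function, or one of its dyadic maximal functions,
exceeds the local mean by far. -/
def exceptionalSet (q : ℝ) (φ : EuclideanSpace ℝ (Fin d) → ℝ)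
    (K : EuclideanSpace ℝ (Fin d) → EuclideanSpace ℝ (Fin d) → ℂ) (c₁ c₂ : ℝ≥0)
    (v : Fin d → ℝ) (f : EuclideanSpace ℝ (Fin d) → ℂ) (R : ℤ × (Fin d → ℤ)) :
    Set (EuclideanSpace ℝ (Fin d)) :=
  {x | c₁ * localMean v f R < smoothVariation q φ K (localized v f R) x} ∪
    ⋃ u : Fin d → Fin 3, {x | c₂ * localMean v f R
      < dyadicMaximal (fun i => ((u i : ℕ) : ℝ) / 3) (fun y => ‖localized v f R y‖ₑ) x}

/-- The factor by which the exceptional sets are small. -/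
def smallness (d : ℕ) : ℝ≥0 := 2 ^ (d + 2) * (Fintype.card (Fin d → Fin 3) + 1)

/-- The exceptional set is a union of `3 ^ d + 1` level sets, and `smallness d` contains this number
as a factor. The second threshold has `1 + 1` because the dyadic maximal function has weak type
constant `1`. -/
theorem volume_exceptionalSet_le {q : ℝ} {W : ℝ≥0} (hW : WeakOneOne W (smoothVariation q φ K))
    {f : EuclideanSpace ℝ (Fin d) → ℂ} (hf : Integrable f) (v : Fin d → ℝ)
    (R : ℤ × (Fin d → ℤ)) :
    2 ^ (d + 2) * volume (exceptionalSet q φ K (smallness d * (W + 1)) (smallness d * (1 + 1))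
      v f R) ≤ cubeVolume d R.1 := by
  have hI := lintegral_localized v f R
  have hIt : ∫⁻ y in cubeBall v R, ‖f y‖ₑ ≠ ∞ := by
    rw [← hI]
    exact (integrable_localized hf v R).2.ne
  set V := cubeVolume d R.1 with hV
  set S := {x | ((smallness d * (W + 1) : ℝ≥0) : ℝ≥0∞) * localMean v f R
    < smoothVariation q φ K (localized v f R) x} with hS
  set D : (Fin d → Fin 3) → Set (EuclideanSpace ℝ (Fin d)) := fun u =>
    {x | ((smallness d * (1 + 1) : ℝ≥0) : ℝ≥0∞) * localMean v f R
      < dyadicMaximal (fun i => ((u i : ℕ) : ℝ) / 3) (fun y => ‖localized v f R y‖ₑ) x} with hDef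
  have h1 : smallness d * volume S ≤ V :=
    mul_volume_le_of_weakType hIt (cubeVolume_ne_zero d R.1) (cubeVolume_ne_top d R.1)
      fun t => hI ▸ hW _ (integrable_localized hf v R) t
  have h2 : ∀ u, smallness d * volume (D u) ≤ V := fun u =>
    mul_volume_le_of_weakType hIt (cubeVolume_ne_zero d R.1) (cubeVolume_ne_top d R.1)
      fun t => by
        rw [ENNReal.coe_one, one_mul, ← hI]
        exact (isThirds_div_three u).mul_volume_dyadicMaximal_le _ t
  have h3 : smallness d * volume (S ∪ ⋃ u, D u)
      ≤ (Fintype.card (Fin d → Fin 3) + 1) * V := by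
    calc smallness d * volume (S ∪ ⋃ u, D u)
        ≤ smallness d * (volume S + ∑ u, volume (D u)) := by
          gcongr
          refine (measure_union_le _ _).trans ?_
          gcongr
          exact measure_iUnion_fintype_le _ _
      _ = smallness d * volume S + ∑ u, smallness d * volume (D u) := by
          rw [mul_add, Finset.mul_sum]
      _ ≤ V + ∑ _u : Fin d → Fin 3, V := add_le_add h1 (Finset.sum_le_sum fun u _ => h2 u)
      _ = _ := by
          rw [Finset.sum_const, Finset.card_univ, nsmul_eq_mul]; ring
  have h0 : ((Fintype.card (Fin d → Fin 3) : ℝ≥0∞) + 1) ≠ 0 := by positivity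
  have ht : ((Fintype.card (Fin d → Fin 3) : ℝ≥0∞) + 1) ≠ ∞ := by finiteness
  refine (ENNReal.mul_le_mul_iff_right h0 ht).1 (le_trans (le_of_eq ?_) h3)
  rw [smallness, ENNReal.coe_mul, ← mul_assoc]
  push_cast
  rw [mul_comm (_ + 1 : ℝ≥0∞)]
  rfl

/-- A ball lies in a comparable cube of some system depending on the ball; this is why the
exceptional set involves the maximal functions of all systems. -/
theorem setLIntegral_localized_le {q : ℝ} {c₁ c₂ : ℝ≥0} {v : Fin d → ℝ}
    {f : EuclideanSpace ℝ (Fin d) → ℂ} {R : ℤ × (Fin d → ℤ)} {x : EuclideanSpace ℝ (Fin d)}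
    (hx : x ∉ exceptionalSet q φ K c₁ c₂ v f R) {c : EuclideanSpace ℝ (Fin d)} {r : ℝ} {j : ℤ}
    (hr : 6 * r < (2 : ℝ) ^ (-j)) (hxc : x ∈ Metric.closedBall c r) :
    ∫⁻ y in Metric.closedBall c r, ‖localized v f R y‖ₑ
      ≤ cubeVolume d j * (c₂ * localMean v f R) := by
  obtain ⟨u, m, hsub⟩ := exists_closedBall_subset_dyadicCube c hr
  refine (lintegral_mono_set hsub).trans
    ((setLIntegral_dyadicCube_le_dyadicMaximal _ _ (hsub hxc)).trans ?_)
  gcongr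
  exact not_lt.1 fun h => hx (Or.inr (Set.mem_iUnion.2 ⟨u, h⟩))

/-- The `d + 6` extra generations absorb the constants: `6 * 8 < 2 ^ 6` and `d < 2 ^ d`. -/
theorem six_mul_ball_radius_lt (d : ℕ) (j : ℤ) (k : ℕ) :
    6 * (2 ^ k * (8 * (d * (2 : ℝ) ^ (-j)))) < 2 ^ (-(j - ((k + (d + 6) : ℕ) : ℤ))) := by
  have h1 : (2 : ℝ) ^ (-(j - ((k + (d + 6) : ℕ) : ℤ))) = 2 ^ k * (2 ^ d * 64) * 2 ^ (-j) := by
    rw [neg_sub, sub_eq_add_neg, zpow_add₀ two_ne_zero, zpow_natCast, pow_add, pow_add]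
    norm_num
  have h2 : (d : ℝ) < 2 ^ d := by exact_mod_cast Nat.lt_two_pow_self
  have h3 : (0 : ℝ) < 2 ^ k * 2 ^ (-j) := by positivity
  rw [h1]
  nlinarith

theorem localMean_child_le {q : ℝ} {c₁ c₂ : ℝ≥0} {v : Fin d → ℝ}
    {f : EuclideanSpace ℝ (Fin d) → ℂ} {P R : ℤ × (Fin d → ℤ)}
    (hsub : cubeBall v P ⊆ cubeBall v R) {x : EuclideanSpace ℝ (Fin d)}
    (hxP : x ∈ dyadicCube v P.1 P.2) (hx : x ∉ exceptionalSet q φ K c₁ c₂ v f R) :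
    localMean v f P ≤ 2 ^ ((d + 6) * d) * (c₂ * localMean v f R) := by
  have h := setLIntegral_localized_le hx (c := cubeCorner v P)
    (r := 8 * (d * (2 : ℝ) ^ (-P.1))) (j := P.1 - (d + 6 : ℕ))
    (by simpa using six_mul_ball_radius_lt d P.1 0) (dyadicCube_subset_cubeBall v P hxP)
  have e : ∫⁻ y in cubeBall v P, ‖f y‖ₑ
      = ∫⁻ y in Metric.closedBall (cubeCorner v P) (8 * (d * (2 : ℝ) ^ (-P.1))),
        ‖localized v f R y‖ₑ := by
    refine setLIntegral_congr_fun (measurableSet_cubeBall v P) fun y hy => ?_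
    simp only [localized, Set.indicator_of_mem (hsub hy)]
  rw [localMean, e]
  refine ENNReal.div_le_of_le_mul (h.trans (le_of_eq ?_))
  rw [cubeVolume_sub]
  ring

end Localization

/-! ### The recursion over stopping cubes. -/

section Recursion

variable {d : ℕ} {φ : EuclideanSpace ℝ (Fin d) → ℝ} {ω : ℝ → ℝ} {A : ℝ}
  {K : EuclideanSpace ℝ (Fin d) → EuclideanSpace ℝ (Fin d) → ℂ}

theorem variationAlong_smoothTruncation_add_le (hφ : IsSmoothCutoff φ)
    (hK : IsCZKernel ω A K) (hω : IsModulusOfContinuity ω) (hD : DiniCondition ω) {q : ℝ}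
    (hq : 1 ≤ q) {ε : ℤ → ℝ} (hpos : ∀ i, 0 < ε i) {f g : EuclideanSpace ℝ (Fin d) → ℂ}
    (hf : Integrable f) (hg : Integrable g) (x : EuclideanSpace ℝ (Fin d)) :
    variationAlong q (fun t => smoothTruncation φ K t (f + g) x) ε
      ≤ variationAlong q (fun t => smoothTruncation φ K t f x) ε
        + variationAlong q (fun t => smoothTruncation φ K t g x) ε := by
  refine le_trans (le_of_eq ?_) (variationAlong_add_le hq _ _ ε)
  simp only [variationAlong, smoothTruncation_add hφ hK hω hD (hpos _) hf hg x]

theorem variationAlong_smoothTruncation_neg (q : ℝ) (ε : ℤ → ℝ)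
    (f : EuclideanSpace ℝ (Fin d) → ℂ) (x : EuclideanSpace ℝ (Fin d)) :
    variationAlong q (fun t => smoothTruncation φ K t (-f) x) ε
      = variationAlong q (fun t => smoothTruncation φ K t f x) ε := by
  simp only [variationAlong, smoothTruncation_neg, neg_sub_neg]
  congr 2
  funext i
  rw [← enorm_neg, neg_sub]

theorem tsum_modulus_add_ne_top (hω : IsModulusOfContinuity ω) (hD : DiniCondition ω) :
    ∑' k : ℕ, ENNReal.ofReal (ω (2 ^ (-(k : ℤ))) + 2 ^ (-(k : ℤ))) ≠ ∞ := by
  have h : ∀ k : ℕ, ENNReal.ofReal (ω (2 ^ (-(k : ℤ))) + 2 ^ (-(k : ℤ)))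
      = ENNReal.ofReal (ω (2 ^ (-(k : ℤ)))) + ENNReal.ofReal ((1 / 2) ^ k) := by
    intro k
    rw [ENNReal.ofReal_add (hω.nonneg (by positivity)) (by positivity), zpow_neg, zpow_natCast,
      one_div, inv_pow]
  simp_rw [h]
  rw [ENNReal.tsum_add]
  exact ENNReal.add_ne_top.2 ⟨hD.tsum_ne_top hω, summable_geometric_two.tsum_ofReal_ne_top⟩

/-- The constant of the recursion over the stopping cubes. -/
def recursionConst (d : ℕ) (ω : ℝ → ℝ) (A M : ℝ) (c₁ c₂ : ℝ≥0) : ℝ≥0∞ :=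
  c₁ + c₁ * (2 ^ ((d + 6) * d) * c₂) + ENNReal.ofReal (10 * 4 ^ d * M * |A|)
    * (∑' k : ℕ, ENNReal.ofReal (ω (2 ^ (-(k : ℤ))) + 2 ^ (-(k : ℤ)))) *
      (2 ^ ((d + 7) * d) * c₂)

theorem recursionConst_ne_top (hω : IsModulusOfContinuity ω) (hD : DiniCondition ω) (M : ℝ)
    (c₁ c₂ : ℝ≥0) : recursionConst d ω A M c₁ c₂ ≠ ∞ := by
  have := tsum_modulus_add_ne_top hω hD
  unfold recursionConst
  finiteness

/-- The error `FR - FP` vanishes on the ball of `P`, so its variation may be moved from `x` to a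
good point `x'` of `P`. There the variations of `FR` and `FP` are bounded by the local means of `R`
and `P`, and the latter is controlled by the former through the maximal function. -/
theorem variationAlong_localized_le_child (hφ : IsSmoothCutoff φ) (hd : 0 < d) {M : ℝ}
    (hM : 0 ≤ M) (h1 : ∀ v, ‖fderiv ℝ φ v‖ ≤ M)
    (h2 : ∀ v w, ‖fderiv ℝ φ v - fderiv ℝ φ w‖ ≤ M * ‖v - w‖)
    (hω : IsModulusOfContinuity ω) (hD : DiniCondition ω) (hK : IsCZKernel ω A K) {q : ℝ}
    (hq : 1 ≤ q) {ε : ℤ → ℝ} (hε : Monotone ε) (hpos : ∀ i, 0 < ε i) {c₁ c₂ : ℝ≥0}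
    {v : Fin d → ℝ} (hv : IsThirds v) {f : EuclideanSpace ℝ (Fin d) → ℂ} (hf : Integrable f)
    (hE : ∀ R : ℤ × (Fin d → ℤ),
      2 ^ (d + 2) * volume (exceptionalSet q φ K c₁ c₂ v f R) ≤ cubeVolume d R.1)
    {R P : ℤ × (Fin d → ℤ)}
    (hP : P ∈ stoppingChildren v (exceptionalSet q φ K c₁ c₂ v f) R)
    {x : EuclideanSpace ℝ (Fin d)} (hx : x ∈ dyadicCube v P.1 P.2) :
    variationAlong q (fun t => smoothTruncation φ K t (localized v f R) x) ε
      ≤ recursionConst d ω A M c₁ c₂ * localMean v f R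
        + variationAlong q (fun t => smoothTruncation φ K t (localized v f P) x) ε := by
  obtain ⟨x', hx'P, hx'R, hx'E⟩ := exists_good_point hv hE hP
  have hsub : cubeBall v P ⊆ cubeBall v R :=
    cubeBall_subset_cubeBall (stoppingChildren_level hP) hx (stoppingChildren_subset hP hx)
  set FR := localized v f R with hFR
  set FP := localized v f P with hFP
  set a := localMean v f R with ha
  have hFRi : Integrable FR := integrable_localized hf v R
  have hFPi : Integrable FP := integrable_localized hf v P
  have hGi : Integrable (FR + -FP) := hFRi.add hFPi.neg
  have hVR : variationAlong q (fun t => smoothTruncation φ K t FR x') ε ≤ c₁ * a :=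
    (variationAlong_le_variationNorm q _ hε hpos).trans
      (not_lt.1 fun h => hx'R (Or.inl h))
  have hVP : variationAlong q (fun t => smoothTruncation φ K t FP x') ε
      ≤ c₁ * (2 ^ ((d + 6) * d) * (c₂ * a)) :=
    (variationAlong_le_variationNorm q _ hε hpos).trans
      ((not_lt.1 fun h => hx'E (Or.inl h) :
        smoothVariation q φ K FP x' ≤ c₁ * localMean v f P).trans
          (mul_le_mul_right (localMean_child_le hsub hx'P hx'R) _))
  have hG0 : ∀ y ∈ cubeBall v P, (FR + -FP) y = 0 := by
    intro y hy
    simp only [hFR, hFP, localized, Pi.add_apply, Pi.neg_apply, Set.indicator_of_mem hy,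
      Set.indicator_of_mem (hsub hy), add_neg_cancel]
  have hGle : ∀ y, ‖(FR + -FP) y‖ₑ ≤ ‖FR y‖ₑ := by
    intro y
    by_cases hy : y ∈ cubeBall v P
    · rw [hG0 y hy]; simp
    · simp [hFP, localized, Set.indicator_of_notMem hy]
  set ρ : ℝ := 8 * (d * (2 : ℝ) ^ (-P.1)) with hρ
  have hd' : (1 : ℝ) ≤ d := by exact_mod_cast hd
  have hρ0 : 0 < ρ := by positivity
  have hρ1 : (2 : ℝ) ^ (-P.1) ≤ ρ := by
    have : (0 : ℝ) < 2 ^ (-P.1) := by positivity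
    rw [hρ]; nlinarith
  have hcomp := variationAlong_smoothTruncation_le hφ hM h1 h2 hω hD hK hq hε hpos
    (x := x) (x' := x') (c := cubeCorner v P) hρ0
    (by rw [hρ]; linarith [norm_sub_cubeCorner_le hx])
    (by rw [hρ]; linarith [norm_sub_cubeCorner_le hx'P]) hGi hG0
    -- The ball of radius `2 ^ (k + 1) ρ` fits into a cube `k + d + 7` generations above `P`, of
    -- volume `2 ^ (k d) 2 ^ ((d + 7) d) |P|`, and `|P| ≤ ρ ^ d`. It contains `x'`, at which the
    -- maximal functions of `FR` are small.
    (α := 2 ^ ((d + 7) * d) * c₂ * a) (by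
      intro k
      refine (lintegral_mono hGle).trans ((setLIntegral_localized_le hx'R
        (six_mul_ball_radius_lt d P.1 (k + 1)) ?_).trans ?_)
      · refine Metric.closedBall_subset_closedBall ?_ (dyadicCube_subset_cubeBall v P hx'P)
        exact le_mul_of_one_le_left hρ0.le (one_le_pow₀ one_le_two)
      · rw [cubeVolume_sub]
        have e1 : (2 : ℝ≥0∞) ^ ((k + 1 + (d + 6)) * d) * cubeVolume d P.1
            = (2 ^ k) ^ d * cubeVolume d P.1 * 2 ^ ((d + 7) * d) := by
          rw [show (k + 1 + (d + 6)) * d = k * d + (d + 7) * d by ring, pow_add, pow_mul]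
          ring
        have e2 : (2 ^ k) ^ d * cubeVolume d P.1 ≤ ENNReal.ofReal ((2 ^ k * ρ) ^ d) := by
          rw [cubeVolume, ← mul_pow, ENNReal.ofReal_pow (by positivity),
            ENNReal.ofReal_mul (by positivity), ENNReal.ofReal_pow (by norm_num),
            ENNReal.ofReal_ofNat]
          gcongr
        rw [e1, mul_assoc, mul_assoc (2 ^ ((d + 7) * d))]
        gcongr)
  have hsplit : FR = FP + (FR + -FP) := by abel
  calc variationAlong q (fun t => smoothTruncation φ K t FR x) ε
      ≤ variationAlong q (fun t => smoothTruncation φ K t FP x) ε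
        + variationAlong q (fun t => smoothTruncation φ K t (FR + -FP) x) ε := by
        conv_lhs => rw [hsplit]
        exact variationAlong_smoothTruncation_add_le hφ hK hω hD hq hpos hFPi hGi x
    _ ≤ variationAlong q (fun t => smoothTruncation φ K t FP x) ε
        + ((c₁ * a + c₁ * (2 ^ ((d + 6) * d) * (c₂ * a)))
          + ENNReal.ofReal (10 * 4 ^ d * M * |A|)
          * (∑' k : ℕ, ENNReal.ofReal (ω (2 ^ (-(k : ℤ))) + 2 ^ (-(k : ℤ))))
          * (2 ^ ((d + 7) * d) * c₂ * a)) := by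
        gcongr
        refine hcomp.trans ?_
        gcongr
        refine (variationAlong_smoothTruncation_add_le hφ hK hω hD hq hpos hFRi hFPi.neg
          x').trans ?_
        rw [variationAlong_smoothTruncation_neg]
        exact add_le_add hVR hVP
    _ = _ := by
        rw [recursionConst]
        ring

open Classical in
/-- The local mean over the cube of generation `j` that contains `x`, if it is a stopping cube. -/
def stoppingMean (v : Fin d → ℝ)
    (E : ℤ × (Fin d → ℤ) → Set (EuclideanSpace ℝ (Fin d))) (R₀ : ℤ × (Fin d → ℤ))
    (f : EuclideanSpace ℝ (Fin d) → ℂ) (x : EuclideanSpace ℝ (Fin d)) (j : ℤ) : ℝ≥0∞ :=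
  if IsStoppingCube v E R₀ (j, dyadicIndex v j x) then localMean v f (j, dyadicIndex v j x) else 0

theorem IsStoppingCube.stoppingMean_eq {v : Fin d → ℝ}
    {E : ℤ × (Fin d → ℤ) → Set (EuclideanSpace ℝ (Fin d))} {R₀ R : ℤ × (Fin d → ℤ)}
    (hR : IsStoppingCube v E R₀ R) (f : EuclideanSpace ℝ (Fin d) → ℂ)
    {x : EuclideanSpace ℝ (Fin d)} (hx : x ∈ dyadicCube v R.1 R.2) :
    stoppingMean v E R₀ f x R.1 = localMean v f R := by
  have e : (R.1, dyadicIndex v R.1 x) = R := by rw [mem_dyadicCube_iff.1 hx]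
  rw [stoppingMean, e, if_pos hR]

theorem localMean_add_tsum_le {v : Fin d → ℝ}
    {E : ℤ × (Fin d → ℤ) → Set (EuclideanSpace ℝ (Fin d))} {R₀ R : ℤ × (Fin d → ℤ)}
    (hR : IsStoppingCube v E R₀ R) (f : EuclideanSpace ℝ (Fin d) → ℂ)
    {x : EuclideanSpace ℝ (Fin d)} (hx : x ∈ dyadicCube v R.1 R.2) {j : ℤ} (hj : R.1 < j) :
    localMean v f R + ∑' i, (Set.Ici j).indicator (stoppingMean v E R₀ f x) i
      ≤ ∑' i, (Set.Ici R.1).indicator (stoppingMean v E R₀ f x) i := by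
  classical
  rw [← hR.stoppingMean_eq f hx,
    ← tsum_ite_eq R.1 (fun i => stoppingMean v E R₀ f x i), ← ENNReal.tsum_add]
  refine ENNReal.tsum_le_tsum fun i => ?_
  by_cases h : i = R.1
  · subst h
    simp [hj]
  · by_cases h' : j ≤ i
    · simp [h, h', hj.le.trans h']
    · simp [h, h']

/-- Iteration of the step from a cube to its child. The induction is on the number of generations
left until `N`, from which the truncations at scales at least `δ` vanish. -/
theorem variationAlong_localized_le_tsum (hφ : IsSmoothCutoff φ) (hd : 0 < d) {M : ℝ}
    (hM : 0 ≤ M) (h1 : ∀ v, ‖fderiv ℝ φ v‖ ≤ M)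
    (h2 : ∀ v w, ‖fderiv ℝ φ v - fderiv ℝ φ w‖ ≤ M * ‖v - w‖)
    (hω : IsModulusOfContinuity ω) (hD : DiniCondition ω) (hK : IsCZKernel ω A K) {q : ℝ}
    (hq : 1 ≤ q) {ε : ℤ → ℝ} (hε : Monotone ε) {δ : ℝ} (hδ : 0 < δ) (hεδ : ∀ i, δ ≤ ε i)
    {c₁ c₂ : ℝ≥0}
    {v : Fin d → ℝ} (hv : IsThirds v) {f : EuclideanSpace ℝ (Fin d) → ℂ} (hf : Integrable f)
    (hE : ∀ R : ℤ × (Fin d → ℤ),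
      2 ^ (d + 2) * volume (exceptionalSet q φ K c₁ c₂ v f R) ≤ cubeVolume d R.1)
    (R₀ : ℤ × (Fin d → ℤ)) {x : EuclideanSpace ℝ (Fin d)} {N : ℤ}
    (hN : ∀ j, N ≤ j → 9 * d * (2 : ℝ) ^ (-j) < δ / 2) (n : ℕ) {R : ℤ × (Fin d → ℤ)}
    (hn : N ≤ R.1 + n) (hR : IsStoppingCube v (exceptionalSet q φ K c₁ c₂ v f) R₀ R)
    (hx : x ∈ dyadicCube v R.1 R.2) :
    variationAlong q (fun t => smoothTruncation φ K t (localized v f R) x) ε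
      ≤ recursionConst d ω A M c₁ c₂ * ∑' i, (Set.Ici R.1).indicator
        (stoppingMean v (exceptionalSet q φ K c₁ c₂ v f) R₀ f x) i := by
  have hpos : ∀ i, 0 < ε i := fun i => hδ.trans_le (hεδ i)
  have hq0 : 0 < q := by linarith
  induction n using Nat.strong_induction_on generalizing R with
  | _ n ih =>
    rcases le_or_gt N R.1 with hlev | hlev
    -- A point of `R` is within `9 d 2 ^ (-j)` of the ball around `R`: `d 2 ^ (-j)` to the corner
    -- plus the radius `8 d 2 ^ (-j)`. This is less than `ε i / 2`, where the cut-off is zero.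
    · have hzero : ∀ i, smoothTruncation φ K (ε i) (localized v f R) x = 0 := by
        intro i
        refine smoothTruncation_eq_zero hφ (hpos i) fun y hy => ?_
        have hyB : y ∈ cubeBall v R := by
          by_contra h
          exact hy (Set.indicator_of_notMem h f)
        rw [cubeBall, mem_closedBall_iff_norm] at hyB
        have h3 := norm_sub_le (x - cubeCorner v R) (y - cubeCorner v R)
        rw [sub_sub_sub_cancel_right] at h3
        linarith [norm_sub_cubeCorner_le hx, hN _ hlev, hεδ i]
      simp only [variationAlong, hzero, sub_self, enorm_zero, ENNReal.zero_rpow_of_pos hq0,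
        tsum_zero]
      rw [ENNReal.zero_rpow_of_pos (by positivity)]
      exact zero_le
    · by_cases hch : ∃ P ∈ stoppingChildren v (exceptionalSet q φ K c₁ c₂ v f) R,
        x ∈ dyadicCube v P.1 P.2
      · obtain ⟨P, hP, hxP⟩ := hch
        have hl := stoppingChildren_level hP
        refine (variationAlong_localized_le_child hφ hd hM h1 h2 hω hD hK hq hε hpos hv hf hE hP
          hxP).trans ?_
        refine (add_le_add le_rfl (ih (n - 1) (by omega) (by omega)
          (IsStoppingCube.child hR hP) hxP)).trans ?_
        rw [← mul_add]
        gcongr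
        exact localMean_add_tsum_le hR f hx (by omega)
      -- The part of `E R` coming from the variation is open, hence covered by the stopping children
      -- inside `R`; a point in no child satisfies the good bound.
      · have hopen := isOpen_lt_smoothVariation hφ hK hω hD hq0
          (integrable_localized hf v R) (c₁ * localMean v f R)
        have hV : smoothVariation q φ K (localized v f R) x ≤ c₁ * localMean v f R := by
          by_contra h
          exact hch (exists_stoppingChild_of_isOpen hv hx hopen (not_le.1 h)
            Set.subset_union_left)
        refine (variationAlong_le_variationNorm q _ hε hpos).trans (hV.trans ?_)
        gcongr
        · rw [recursionConst, add_assoc]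
          exact le_self_add
        · exact le_self_add.trans (localMean_add_tsum_le hR f hx (lt_add_one R.1))

/-- The domination of the variation by the local means over the stopping cubes, at every point. -/
theorem smoothVariation_localized_le_tsum (hφ : IsSmoothCutoff φ) (hd : 0 < d) {M : ℝ}
    (hM : 0 ≤ M) (h1 : ∀ v, ‖fderiv ℝ φ v‖ ≤ M)
    (h2 : ∀ v w, ‖fderiv ℝ φ v - fderiv ℝ φ w‖ ≤ M * ‖v - w‖)
    (hω : IsModulusOfContinuity ω) (hD : DiniCondition ω) (hK : IsCZKernel ω A K) {q : ℝ}
    (hq : 1 ≤ q) {c₁ c₂ : ℝ≥0}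
    {v : Fin d → ℝ} (hv : IsThirds v) {f : EuclideanSpace ℝ (Fin d) → ℂ} (hf : Integrable f)
    (hE : ∀ R : ℤ × (Fin d → ℤ),
      2 ^ (d + 2) * volume (exceptionalSet q φ K c₁ c₂ v f R) ≤ cubeVolume d R.1)
    {R₀ : ℤ × (Fin d → ℤ)} {x : EuclideanSpace ℝ (Fin d)} (hx : x ∈ dyadicCube v R₀.1 R₀.2) :
    smoothVariation q φ K (localized v f R₀) x ≤ recursionConst d ω A M c₁ c₂ *
      ∑' j, stoppingMean v (exceptionalSet q φ K c₁ c₂ v f) R₀ f x j := by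
  refine variationNorm_le_of_forall_variationAlong_le (by linarith) _ fun ε hε δ hδ hεδ => ?_
  obtain ⟨N, hN, hN'⟩ := exists_mul_two_zpow_neg_lt (9 * d) (half_pos hδ) R₀.1
  refine (variationAlong_localized_le_tsum hφ hd hM h1 h2 hω hD hK hq hε hδ hεδ hv hf hE R₀ hN'
    (N - R₀.1).toNat (by omega) IsStoppingCube.top hx).trans ?_
  gcongr with i
  exact Set.indicator_le_self _ _ i

end Recursion

/-! ### Transfer to host cubes in the `3 ^ d` systems. -/

section Transfer

variable {d : ℕ}

theorem exists_cubeBall_subset_dyadicCube (v : Fin d → ℝ) (R : ℤ × (Fin d → ℤ)) :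
    ∃ (u : Fin d → Fin 3) (m : Fin d → ℤ), cubeBall v R ⊆
      dyadicCube (fun i => ((u i : ℕ) : ℝ) / 3) (R.1 - ((d + 6 : ℕ) : ℤ)) m :=
  exists_closedBall_subset_dyadicCube _ (by simpa using six_mul_ball_radius_lt d R.1 0)

/-- The translation of a dyadic system in which the ball around `R` lies in a comparable cube. -/
def hostShift (v : Fin d → ℝ) (R : ℤ × (Fin d → ℤ)) : Fin d → Fin 3 :=
  (exists_cubeBall_subset_dyadicCube v R).choose

/-- A cube of the system given by `hostShift v R` that contains the ball around `R`. -/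
def hostCube (v : Fin d → ℝ) (R : ℤ × (Fin d → ℤ)) : ℤ × (Fin d → ℤ) :=
  (R.1 - ((d + 6 : ℕ) : ℤ), (exists_cubeBall_subset_dyadicCube v R).choose_spec.choose)

theorem cubeBall_subset_hostCube (v : Fin d → ℝ) (R : ℤ × (Fin d → ℤ)) :
    cubeBall v R ⊆ dyadicCube (fun i => ((hostShift v R i : ℕ) : ℝ) / 3) (hostCube v R).1
      (hostCube v R).2 :=
  (exists_cubeBall_subset_dyadicCube v R).choose_spec.choose_spec

/-- The host cubes, in the system with translation `u`, of the cubes of the collection `L`. -/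
def hostCubes (v : Fin d → ℝ) (L : Set (ℤ × (Fin d → ℤ))) (u : Fin d → Fin 3) :
    Set (ℤ × (Fin d → ℤ)) :=
  {R' | ∃ R ∈ L, hostShift v R = u ∧ hostCube v R = R'}

/-- Many cubes may share a host. Choosing one guest `σ R'` for each host makes `σ` injective on
hosts, so the guest's major subset can serve the host, with the ratio of volumes as loss. -/
theorem isSparse_hostCubes {v : Fin d → ℝ} {L : Set (ℤ × (Fin d → ℤ))} {Λ : ℝ≥0∞}
    (hL : IsSparse v Λ L) (u : Fin d → Fin 3) :
    IsSparse (fun i => ((u i : ℕ) : ℝ) / 3) (2 ^ ((d + 6) * d) * Λ) (hostCubes v L u) := by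
  classical
  obtain ⟨E, hE, hdisj⟩ := hL
  have hex : ∀ R', ∃ R, R' ∈ hostCubes v L u → R ∈ L ∧ hostShift v R = u ∧ hostCube v R = R' := by
    intro R'
    by_cases h : R' ∈ hostCubes v L u
    · obtain ⟨R, hR⟩ := h
      exact ⟨R, fun _ => hR⟩
    · exact ⟨R', fun h' => absurd h' h⟩
  choose σ hσ using hex
  refine ⟨fun R' => E (σ R'), fun R' hR' => ?_, fun R' hR' R'' hR'' hne => ?_⟩
  · obtain ⟨hm, hu, hh⟩ := hσ R' hR'
    obtain ⟨h1, h2, h3⟩ := hE _ hm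
    refine ⟨h1, ?_, ?_⟩
    · have := (h2.trans (dyadicCube_subset_cubeBall v _)).trans (cubeBall_subset_hostCube v (σ R'))
      rwa [hu, hh] at this
    · rw [volume_dyadicCube] at h3 ⊢
      have e : R'.1 = (σ R').1 - ((d + 6 : ℕ) : ℤ) := (congrArg Prod.fst hh).symm
      rw [e, cubeVolume_sub, mul_assoc]
      exact mul_le_mul_right h3 _
  · obtain ⟨hm, hu, hh⟩ := hσ R' hR'
    obtain ⟨hm', hu', hh'⟩ := hσ R'' hR''
    refine hdisj hm hm' fun h => hne ?_
    rw [← hh, ← hh', h]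

theorem localMean_le_hostCube (v : Fin d → ℝ) (f : EuclideanSpace ℝ (Fin d) → ℂ)
    (R : ℤ × (Fin d → ℤ)) :
    localMean v f R ≤ 2 ^ ((d + 6) * d) *
      ⨍⁻ y in dyadicCube (fun i => ((hostShift v R i : ℕ) : ℝ) / 3) (hostCube v R).1
        (hostCube v R).2, ‖f y‖ₑ ∂volume := by
  rw [localMean, setLAverage_eq, volume_dyadicCube]
  refine ENNReal.div_le_of_le_mul ((lintegral_mono_set (cubeBall_subset_hostCube v R)).trans
    (le_of_eq ?_))
  have e : cubeVolume d (hostCube v R).1 = 2 ^ ((d + 6) * d) * cubeVolume d R.1 :=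
    cubeVolume_sub d R.1 (d + 6)
  rw [mul_right_comm, ← e, ENNReal.mul_div_cancel (cubeVolume_ne_zero d _)
    (cubeVolume_ne_top d _)]

/-- The local means over the stopping cubes are dominated by the dyadic shifts over their host
cubes. -/
theorem tsum_stoppingMean_le {v : Fin d → ℝ}
    {E : ℤ × (Fin d → ℤ) → Set (EuclideanSpace ℝ (Fin d))} {R₀ : ℤ × (Fin d → ℤ)}
    (f : EuclideanSpace ℝ (Fin d) → ℂ) (x : EuclideanSpace ℝ (Fin d)) :
    ∑' j, stoppingMean v E R₀ f x j ≤ 2 ^ ((d + 6) * d) * ∑ u : Fin d → Fin 3,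
      dyadicShift (fun i => ((u i : ℕ) : ℝ) / 3) 0
        (hostCubes v {R | IsStoppingCube v E R₀ R} u) (fun y => ‖f y‖ₑ) x := by
  classical
  set w : (Fin d → Fin 3) → Fin d → ℝ := fun u i => ((u i : ℕ) : ℝ) / 3 with hw
  set L : (Fin d → Fin 3) → Set (ℤ × (Fin d → ℤ)) :=
    hostCubes v {R | IsStoppingCube v E R₀ R} with hL
  set F : (Fin d → Fin 3) → ℤ × (Fin d → ℤ) → ℝ≥0∞ := fun u R =>
    (dyadicCube (w u) R.1 R.2).indicator
      (fun _ => ⨍⁻ y in dyadicAncestor (w u) 0 R.1 R.2, ‖f y‖ₑ ∂volume) x with hF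
  -- In each system only one cube of the right generation contains `x`. Stopping cubes through `x`
  -- of different generations thus have hosts of different generations, and no host is counted
  -- twice.
  set g : (Fin d → Fin 3) → ℤ → ℤ × (Fin d → ℤ) := fun u j =>
    (j - ((d + 6 : ℕ) : ℤ), dyadicIndex (w u) (j - ((d + 6 : ℕ) : ℤ)) x) with hg
  have hinj : ∀ u, Function.Injective (g u) := by
    intro u i j hij
    have := congrArg Prod.fst hij
    simp only [hg] at this
    omega
  have hterm : ∀ j, stoppingMean v E R₀ f x j
      ≤ 2 ^ ((d + 6) * d) * ∑ u, (L u).indicator (F u) (g u j) := by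
    intro j
    rw [stoppingMean]
    split_ifs with hj
    swap
    · exact zero_le
    set R : ℤ × (Fin d → ℤ) := (j, dyadicIndex v j x) with hR
    have hx : x ∈ dyadicCube (w (hostShift v R)) (hostCube v R).1 (hostCube v R).2 :=
      cubeBall_subset_hostCube v R
        (dyadicCube_subset_cubeBall v R (mem_dyadicCube_dyadicIndex v j x))
    have hgR : g (hostShift v R) j = hostCube v R := Prod.ext rfl (mem_dyadicCube_iff.1 hx)
    refine (localMean_le_hostCube v f R).trans ?_
    gcongr
    refine le_trans ?_ (Finset.single_le_sum (f := fun u => (L u).indicator (F u) (g u j))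
      (fun _ _ => zero_le) (Finset.mem_univ (hostShift v R)))
    rw [hgR, Set.indicator_of_mem (show hostCube v R ∈ L (hostShift v R) from ⟨R, hj, rfl, rfl⟩)]
    simp only [hF]
    rw [Set.indicator_of_mem hx, (isThirds_div_three (hostShift v R)).dyadicAncestor_eq 0 hx]
    simp only [Nat.cast_zero, sub_zero]
    rw [mem_dyadicCube_iff.1 hx]
  calc ∑' j, stoppingMean v E R₀ f x j
      ≤ ∑' j, 2 ^ ((d + 6) * d) * ∑ u, (L u).indicator (F u) (g u j) :=
        ENNReal.tsum_le_tsum hterm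
    _ = 2 ^ ((d + 6) * d) * ∑ u, ∑' j, (L u).indicator (F u) (g u j) := by
        rw [ENNReal.tsum_mul_left, Summable.tsum_finsetSum fun _ _ => ENNReal.summable]
    _ ≤ _ := by
        gcongr with u
        refine (ENNReal.tsum_comp_le_tsum_of_injective (hinj u) _).trans (le_of_eq ?_)
        rw [dyadicShift, ← tsum_subtype (L u) (F u)]

end Transfer

/-! ### Conclusion. -/

theorem exists_closedCube_subset_dyadicCube {d : ℕ} (a : EuclideanSpace ℝ (Fin d)) {ℓ : ℝ}
    (hℓ : 0 < ℓ) : ∃ (u : Fin d → Fin 3) (R : ℤ × (Fin d → ℤ)),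
      closedCube a ℓ ⊆ dyadicCube (fun i => ((u i : ℕ) : ℝ) / 3) R.1 R.2 := by
  obtain ⟨n, hn⟩ := pow_unbounded_of_one_lt (6 * (d * ℓ)) (one_lt_two (α := ℝ))
  obtain ⟨u, m, h⟩ := exists_closedBall_subset_dyadicCube a (r := d * ℓ) (j := -(n : ℤ))
    (by simpa using hn)
  refine ⟨u, (-(n : ℤ), m), Set.Subset.trans (fun x hx => ?_) h⟩
  rw [mem_closedBall_iff_norm]
  refine norm_sub_le_of_forall_abs_le hℓ.le fun i => ?_
  have := hx i
  rw [abs_le]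
  constructor <;> linarith [this.1, this.2]

end

theorem theorem3p1 (d : ℕ) (hd : 0 < d) :
    -- the bounds of the shifts depend only on `d` (and on the exponent)
    ∃ B : ℝ → ℝ≥0,
      ∀ (q : ℝ) (_ : 1 ≤ q)
        (φ : EuclideanSpace ℝ (Fin d) → ℝ) (_ : IsSmoothCutoff φ)
        (ω : ℝ → ℝ) (_ : IsModulusOfContinuity ω) (_ : DiniCondition ω)
        (A : ℝ) (W : ℝ≥0),
      -- the constant depends only on `d`, `q`, `φ`, `ω`, `A`, `W`
      ∃ C : ℝ≥0,
        ∀ (K : EuclideanSpace ℝ (Fin d) → EuclideanSpace ℝ (Fin d) → ℂ)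
          (T : Lp ℂ 2 (volume : Measure (EuclideanSpace ℝ (Fin d))) →L[ℂ]
            Lp ℂ 2 (volume : Measure (EuclideanSpace ℝ (Fin d))))
          (_ : IsCZOperator ω A K T)
          (_ : WeakOneOne W (smoothVariation q φ K))
          (a : EuclideanSpace ℝ (Fin d)) (ℓ : ℝ) (_ : 0 < ℓ)
          (f : EuclideanSpace ℝ (Fin d) → ℂ) (_ : Integrable f volume)
          (_ : Function.support f ⊆ closedCube a ℓ),
        ∃ S : (Fin d → Fin 3) → ℕ →
            (EuclideanSpace ℝ (Fin d) → ℝ≥0∞) → EuclideanSpace ℝ (Fin d) → ℝ≥0∞,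
          (∀ u k, IsPositiveDyadicShift (fun i => ((u i : ℕ) : ℝ) / 3) k B (S u k)) ∧
          ∀ x ∈ closedCube a ℓ,
            smoothVariation q φ K f x ≤
              C * (cubeMaximal f x +
                ∑ u : Fin d → Fin 3, ∑' k : ℕ,
                  ENNReal.ofReal (ω ((2 : ℝ) ^ (-(k : ℤ)))) * S u k (fun y => ‖f y‖ₑ) x) := by
  -- The sparseness constant of the host cubes, `2` from the stopping cubes times the volume ratio,
  -- enters with the two maximal constants of the duality argument.
  refine ⟨fun p => 2 ^ ((d + 6) * d) * 2 * maximalConst p * maximalConst p.conjExponent,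
    fun q hq φ hφ ω hω hD A W => ?_⟩
  obtain ⟨M, hM, hM1, hM2⟩ := hφ.exists_bounds
  set c₁ : ℝ≥0 := smallness d * (W + 1) with hc₁
  set c₂ : ℝ≥0 := smallness d * (1 + 1) with hc₂
  set C₀ : ℝ≥0∞ := recursionConst d ω A M c₁ c₂ * 2 ^ ((d + 6) * d) with hC₀
  have hC₀t : C₀ ≠ ∞ :=
    ENNReal.mul_ne_top (recursionConst_ne_top hω hD M c₁ c₂) (by finiteness)
  -- The inverse compensates the weight of the shift of complexity `0`. For `ω 1 = 0` the convention
  -- `0⁻¹ = 0` makes the constant zero, which suffices since the variation vanishes.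
  refine ⟨C₀.toNNReal * (Real.toNNReal (ω 1))⁻¹, fun K T hT hW a ℓ hℓ f hf hsupp => ?_⟩
  have hK := hT.kernel
  obtain ⟨u₀, R₀, hR₀⟩ := exists_closedCube_subset_dyadicCube a hℓ
  set v : Fin d → ℝ := fun i => ((u₀ i : ℕ) : ℝ) / 3 with hvdef
  have hv : IsThirds v := isThirds_div_three u₀
  have hE := fun R => volume_exceptionalSet_le hW hf v R
  set E := exceptionalSet q φ K c₁ c₂ v f with hEdef
  set L := hostCubes v {R | IsStoppingCube v E R₀ R} with hL
  -- The same collection serves every complexity `k`, the `L^p` bounds being uniform in `k`.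
  refine ⟨fun u k => dyadicShift (fun i => ((u i : ℕ) : ℝ) / 3) k (L u),
    fun u k => ⟨⟨L u, fun g x => rfl⟩, fun p hp g hg => ?_⟩, fun x hx => ?_⟩
  · refine (isThirds_div_three u).dyadicShift_Lp_le k (Λ := 2 ^ ((d + 6) * d) * 2)
      (by positivity) ?_ hg hp
    push_cast
    exact isSparse_hostCubes (isSparse_stoppingCubes hE R₀) u
  have hω1 : 0 ≤ ω 1 := hω.nonneg zero_le_one
  rcases hω1.eq_or_lt with h0 | h0
  · rw [smoothVariation_eq_zero hφ hω hK hd h0.symm (by linarith) f x]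
    exact zero_le
  have hloc : localized v f R₀ = f := by
    refine Set.indicator_eq_self.2 (hsupp.trans (hR₀.trans ?_))
    exact dyadicCube_subset_cubeBall v R₀
  have hmain := smoothVariation_localized_le_tsum hφ hd hM hM1 hM2 hω hD hK hq hv hf hE (hR₀ hx)
  rw [hloc] at hmain
  set S₀ := ∑ u : Fin d → Fin 3,
    dyadicShift (fun i => ((u i : ℕ) : ℝ) / 3) 0 (L u) (fun y => ‖f y‖ₑ) x with hS
  have hone : ((Real.toNNReal (ω 1))⁻¹ : ℝ≥0) * ENNReal.ofReal (ω 1) = 1 := by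
    rw [ENNReal.ofReal, ← ENNReal.coe_mul, inv_mul_cancel₀ (Real.toNNReal_pos.2 h0).ne',
      ENNReal.coe_one]
  calc smoothVariation q φ K f x
      ≤ recursionConst d ω A M c₁ c₂ * (2 ^ ((d + 6) * d) * S₀) :=
        hmain.trans (mul_le_mul_right (tsum_stoppingMean_le f x) _)
    _ = C₀ * (((Real.toNNReal (ω 1))⁻¹ : ℝ≥0) * ENNReal.ofReal (ω 1)) * S₀ := by
        rw [hone, hC₀]; ring
    _ = ((C₀.toNNReal * (Real.toNNReal (ω 1))⁻¹ : ℝ≥0) : ℝ≥0∞)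
          * (ENNReal.ofReal (ω 1) * S₀) := by
        rw [ENNReal.coe_mul, ENNReal.coe_toNNReal hC₀t]; ring
    _ ≤ _ := by
        gcongr
        -- The maximal function and all terms with `k ≥ 1` are dropped.
        refine le_trans ?_ le_add_self
        rw [hS, Finset.mul_sum]
        refine Finset.sum_le_sum fun u _ => le_trans (le_of_eq ?_) (ENNReal.le_tsum 0)
        simp
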